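/- All graphs are finite and simple. An instance of Token Sliding is a tuple $(G,S,T,k)$ where $S$ and $T$ are independent sets of the graph $G$, each of size $k\ge 1$. The question is whether $S$ can be transformed into $T$ through independent sets of $G$ of size $k$, where in each step one token (an element of the current set) slides along an edge of $G$ to an adjacent vertex. **Theorem.** Token Sliding on bipartite graphs of maximum degree $\Delta\ge 1$, parameterized by $k$, has a kernel with $O(k^2\Delta^5)$ vertices. That is, there are a polynomial-time algorithm and an absolute constant $C$ such that the following holds. For every instance $(G,S,T,k)$ with $G$ bipartite, and every $\Delta\ge 1$ such that all degrees of $G$ are at most $\Delta$, the algorithm computes an instance $(G',S',T',k')$ of Token Sliding with these properties: - $(G',S',T',k')$ is a yes-instance if and only if $(G,S,T,k)$ is one; - $G'$ is bipartite with all degrees at most $\Delta$; - $k'\le k$; - $|V(G')|\le C k^2\Delta^5$. Moreover, the problem can be solved in $O^\star(k^{2k}\Delta^{5k})$ time. That is, there are an algorithm and a polynomial $p$ such that the algorithm decides every such instance in at most $k^{2k}\Delta^{5k}\cdot p(|V(G)|)$ steps. (Neither algorithm, nor $C$, nor either polynomial depends on $k$ or $\Delta$. Running times are measured on programs over binary trees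 in which creating a leaf, taking a subtree, joining two trees and testing for a leaf have unit cost, the input being given by $k$ in unary, the adjacency matrix of $G$, and the characteristic vectors of $S$ and $T$.) -/

import Mathlib

/-! ## Token Sliding -/

/-- The reconfiguration graph of Token Sliding: its nodes are the independent sets of `G` of size
exactly `k`, and two of them are joined by an edge when one is obtained from the other by sliding
a single token along an edge of `G`. -/
def tokenSlidingGraph {V : Type*} [DecidableEq V] (G : SimpleGraph V) (k : ℕ) :
    SimpleGraph {A : Finset V // G.IsNIndepSet k A} where
  Adj A B := ∃ u v, G.Adj u v ∧ A.1 \ B.1 = {u} ∧ B.1 \ A.1 = {v}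
  symm := ⟨fun _ _ ⟨u, v, h, hA, hB⟩ => ⟨v, u, h.symm, hB, hA⟩⟩
  loopless := ⟨fun A ⟨u, _, _, hA, _⟩ => by simp at hA⟩

/-- An instance `(G, S, T, k)` of Token Sliding: a finite simple graph `G` (on the vertices
`0, …, n - 1`) and two independent sets `S`, `T` of `G`, each of size `k ≥ 1`. -/
structure TSInstance where
  n : ℕ
  G : SimpleGraph (Fin n)
  k : ℕ
  one_le_k : 1 ≤ k
  S : {A : Finset (Fin n) // G.IsNIndepSet k A}
  T : {A : Finset (Fin n) // G.IsNIndepSet k A}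

namespace TSInstance

/-- `(G, S, T, k)` is a yes-instance when `S` and `T` belong to the same connected component of
the reconfiguration graph. -/
def IsYes (I : TSInstance) : Prop := (tokenSlidingGraph I.G I.k).Reachable I.S I.T

open scoped Classical in
/-- The maximum degree of the graph of an instance. -/
noncomputable def maxDegree (I : TSInstance) : ℕ := I.G.maxDegree

end TSInstance

/-! ## The machine model

The running times below are measured on WHILE programs over binary trees (as in Jones,
*Computability and complexity from a programming perspective*), presented without variables: a
program maps one tree to one tree. Every elementary operation (create a leaf, take the left or
right subtree, join two trees, test for a leaf) has unit cost and handles a constant number of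
pointers only; there is no arithmetic and no equality test of trees. So `t` steps of a program are
simulated by a random access machine in `O(t)` steps on words of `O(log t)` bits, besides the
reading of the input, and conversely a step of such a machine by polynomially many (in the word
length) steps of a program. -/

/-- Programs over binary trees. -/
inductive TreeProg : Type
  /-- return the input -/
  | id : TreeProg
  /-- return the leaf -/
  | leaf : TreeProg
  /-- return the left subtree of the input (the leaf, if the input is the leaf) -/
  | left : TreeProg
  /-- return the right subtree of the input (the leaf, if the input is the leaf) -/
  | right : TreeProg
  /-- run `f` and `g` on the input and join the results -/
  | pair (f g : TreeProg) : TreeProg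
  /-- run `f`, then run `g` on its result -/
  | seq (f g : TreeProg) : TreeProg
  /-- run `c` on the input, then run `f` on the input if the result is not the leaf, and `g` on
  the input otherwise -/
  | cond (c f g : TreeProg) : TreeProg
  /-- as long as the result of `c` on the current tree is not the leaf, replace the current tree
  by the result of `f` on it; then return the current tree -/
  | loop (c f : TreeProg) : TreeProg

namespace TreeProg

/-- `p.Eval x y t`: on the input `x`, the program `p` halts with the output `y` after exactly `t`
steps. -/
inductive Eval : TreeProg → BinaryTree Unit → BinaryTree Unit → ℕ → Prop
  | id (x) : Eval id x x 1
  | leaf (x) : Eval leaf x .nil 1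
  | left (x) : Eval left x x.left 1
  | right (x) : Eval right x x.right 1
  | pair {f g x y z s t} : Eval f x y s → Eval g x z t →
      Eval (pair f g) x (.node () y z) (s + t + 1)
  | seq {f g x y z s t} : Eval f x y s → Eval g y z t → Eval (seq f g) x z (s + t + 1)
  | cond_true {c f g x b y s t} : Eval c x b s → b ≠ .nil → Eval f x y t →
      Eval (cond c f g) x y (s + t + 1)
  | cond_false {c f g x y s t} : Eval c x .nil s → Eval g x y t →
      Eval (cond c f g) x y (s + t + 1)
  | loop_step {c f x b y z s t r} : Eval c x b s → b ≠ .nil → Eval f x y t →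
      Eval (loop c f) y z r → Eval (loop c f) x z (s + t + r + 1)
  | loop_stop {c f x s} : Eval c x .nil s → Eval (loop c f) x x (s + 1)

/-- Programs are deterministic: output and number of steps are determined by the input. -/
theorem Eval.unique {p : TreeProg} {x y z : BinaryTree Unit} {s t : ℕ} (h : p.Eval x y s)
    (h' : p.Eval x z t) : y = z ∧ s = t := by
  induction h generalizing z t with
  | id | leaf | left | right => cases h'; exact ⟨rfl, rfl⟩
  | pair _ _ ih₁ ih₂ =>
    cases h' with
    | pair a b =>
      obtain ⟨rfl, rfl⟩ := ih₁ a
      obtain ⟨rfl, rfl⟩ := ih₂ b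
      exact ⟨rfl, rfl⟩
  | seq _ _ ih₁ ih₂ =>
    cases h' with
    | seq a b =>
      obtain ⟨rfl, rfl⟩ := ih₁ a
      obtain ⟨rfl, rfl⟩ := ih₂ b
      exact ⟨rfl, rfl⟩
  | cond_true _ hb _ ih₁ ih₂ =>
    cases h' with
    | cond_true a _ b =>
      obtain ⟨rfl, rfl⟩ := ih₁ a
      obtain ⟨rfl, rfl⟩ := ih₂ b
      exact ⟨rfl, rfl⟩
    | cond_false a _ => exact absurd (ih₁ a).1 hb
  | cond_false _ _ ih₁ ih₂ =>
    cases h' with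
    | cond_true a hb _ => exact absurd (ih₁ a).1.symm hb
    | cond_false a b =>
      obtain ⟨_, rfl⟩ := ih₁ a
      obtain ⟨rfl, rfl⟩ := ih₂ b
      exact ⟨rfl, rfl⟩
  | loop_step _ hb _ _ ih₁ ih₂ ih₃ =>
    cases h' with
    | loop_step a _ b d =>
      obtain ⟨rfl, rfl⟩ := ih₁ a
      obtain ⟨rfl, rfl⟩ := ih₂ b
      obtain ⟨rfl, rfl⟩ := ih₃ d
      exact ⟨rfl, rfl⟩
    | loop_stop a => exact absurd (ih₁ a).1 hb
  | loop_stop _ ih =>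
    cases h' with
    | loop_step a hb _ _ => exact absurd (ih a).1.symm hb
    | loop_stop a => exact ⟨rfl, by rw [(ih a).2]⟩

end TreeProg

/-! ## Encoding of instances -/

namespace TreeEnc

/-- Truth values: false is the leaf, true the tree with one inner node. -/
def bool : Bool → BinaryTree Unit
  | false => .nil
  | true => .node () .nil .nil

open scoped Classical in
/-- The truth value of a proposition. -/
noncomputable def prop (P : Prop) : BinaryTree Unit := bool (decide P)

/-- Lists of trees, as nested pairs that end in the leaf. -/
def list : List (BinaryTree Unit) → BinaryTree Unit
  | [] => .nil
  | x :: l => .node () x (list l)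

/-- Natural numbers, in unary. -/
def nat (m : ℕ) : BinaryTree Unit := list (List.replicate m .nil)

end TreeEnc

/-- The encoding of an instance `(G, S, T, k)`: the number `k` in unary, the adjacency matrix
of `G`, row by row, and the characteristic vectors of `S` and `T`. -/
noncomputable def TSInstance.encode (I : TSInstance) : BinaryTree Unit :=
  .node () (TreeEnc.nat I.k) <|
    .node () (TreeEnc.list (List.ofFn fun i => TreeEnc.list (List.ofFn fun j =>
      TreeEnc.prop (I.G.Adj i j)))) <|
    .node () (TreeEnc.list (List.ofFn fun i => TreeEnc.prop (i ∈ I.S.1)))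
      (TreeEnc.list (List.ofFn fun i => TreeEnc.prop (i ∈ I.T.1)))

/-! Call a vertex near if it carries a token of `S` or `T` or is adjacent to such a vertex, and let
`D = Δ + 1` bound the closed neighbourhoods. There are at most `2kD` near vertices. Let `C` be a
component of the graph on the other vertices and `B` its border, the near vertices adjacent to `C`.

A large `C` is a reservoir for tokens. Tokens in a connected set whose closed neighbourhoods are
pairwise disjoint can be permuted as if they jumped over each other (`reach_exchange`), and `4kD³`
vertices leave enough room for such scattered arrangements (`Conn.absorbing`). So tokens in `C` can
be rearranged at will, and make way for any token that wants to enter from `B`. Hence all that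
matters of a configuration is its tokens outside of `C ∪ B` and the number of the remaining ones,
and all that matters of `C` is `B` (`reach_iff_of_absorbing`).

Therefore `C` may be replaced by a path with the same border. The path has at least `threshold`
vertices and at most `2|B|` more; each border vertex is attached to one path vertex of the right
colour, which keeps the graph bipartite. A component with empty border is deleted. A border vertex
loses at least one neighbour and gains one. Path vertices have degree at most 3; if `Δ = 2`,
counting edges (`Conn.card_add_le`) shows that `|B| ≤ 2`, and the attachments are at the two ends of
the path. A replacement is made only if it lowers the number of vertices, so the process stops. At
the end every component has at most `4kD³ + 4kD` vertices and contains a neighbour of a near vertex,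
so there are at most `2kD²` components; this gives `576 k²Δ⁵` vertices in total
(`n_le_of_large_eq_nil`).

For the decision algorithm, the `k`-subsets of the kernel are searched, the known ones being stored
in a trie. Their number is at most `576^k (k²Δ⁵)^k / k!`, and `c^k / k!` never exceeds the constant
`c^c` (`choose_le`).

The algorithms are functions on lists, and combinators for `PolyTime` turn them into programs. As a
tree is passed on at unit cost whatever its size, only the lengths of loops have to be bounded. -/

/-! ## Encoded types and polynomial-time functions -/

/-- Types whose elements are encoded as binary trees. -/
class TEnc (α : Type) where
  /-- the encoding -/
  enc : α → BinaryTree Unit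

open TEnc (enc)

instance : TEnc Unit := ⟨fun _ => .nil⟩
instance : TEnc Bool := ⟨TreeEnc.bool⟩
instance : TEnc ℕ := ⟨TreeEnc.nat⟩
instance : TEnc (BinaryTree Unit) := ⟨id⟩
instance {α β : Type} [TEnc α] [TEnc β] : TEnc (α × β) := ⟨fun p => .node () (enc p.1) (enc p.2)⟩
instance {α : Type} [TEnc α] : TEnc (List α) := ⟨fun l => TreeEnc.list (l.map enc)⟩

section Enc
variable {α β : Type} [TEnc α] [TEnc β]

theorem enc_nil : enc ([] : List α) = .nil := rfl
theorem enc_cons (a : α) (l : List α) : enc (a :: l) = .node () (enc a) (enc l) := rfl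
theorem enc_true : enc true = .node () .nil .nil := rfl
theorem enc_false : enc false = .nil := rfl
theorem enc_zero : enc (0 : ℕ) = .nil := rfl
theorem enc_succ (n : ℕ) : enc (n + 1) = .node () .nil (enc n) := rfl

theorem enc_replicate (n : ℕ) : enc (List.replicate n ()) = enc n := by
  induction n with
  | zero => rfl
  | succ n ih => rw [List.replicate_succ, enc_cons, ih, enc_succ]; rfl

theorem enc_bool_eq_nil (b : Bool) : enc b = .nil ↔ b = false := by
  cases b <;> simp [enc_true, enc_false]

end Enc

/-- `PolyTime Γ f`: some program computes `f`, in time polynomial in `N` on the arguments `a` with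
`Γ a N`. -/
def PolyTime {α β : Type} [TEnc α] [TEnc β] (Γ : α → ℕ → Prop) (f : α → β) : Prop :=
  ∃ (p : TreeProg) (q : Polynomial ℕ), ∀ a N, Γ a N →
    ∃ t, p.Eval (enc a) (enc (f a)) t ∧ t ≤ q.eval N

/-- `PolyBdd Γ f`: the function `f` is at most polynomial in `N` on the arguments `a` with
`Γ a N`. -/
def PolyBdd {α : Type} (Γ : α → ℕ → Prop) (f : α → ℕ) : Prop :=
  ∃ q : Polynomial ℕ, ∀ a N, Γ a N → f a ≤ q.eval N

namespace PolyBdd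
variable {α β : Type} {Γ : α → ℕ → Prop} {f g : α → ℕ}

theorem const (n : ℕ) : PolyBdd Γ (fun _ => n) := ⟨.C n, fun _ _ _ => by simp⟩

theorem of_le_param (h : ∀ a N, Γ a N → f a ≤ N) : PolyBdd Γ f :=
  ⟨.X, fun a N ha => by simpa using h a N ha⟩

theorem mono (hg : PolyBdd Γ g) (h : ∀ a N, Γ a N → f a ≤ g a) : PolyBdd Γ f :=
  let ⟨q, hq⟩ := hg
  ⟨q, fun a N ha => (h a N ha).trans (hq a N ha)⟩

theorem add (hf : PolyBdd Γ f) (hg : PolyBdd Γ g) : PolyBdd Γ (fun a => f a + g a) :=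
  let ⟨q, hq⟩ := hf
  let ⟨r, hr⟩ := hg
  ⟨q + r, fun a N ha => by simpa using add_le_add (hq a N ha) (hr a N ha)⟩

theorem mul (hf : PolyBdd Γ f) (hg : PolyBdd Γ g) : PolyBdd Γ (fun a => f a * g a) :=
  let ⟨q, hq⟩ := hf
  let ⟨r, hr⟩ := hg
  ⟨q * r, fun a N ha => by simpa using Nat.mul_le_mul (hq a N ha) (hr a N ha)⟩

theorem weaken {Γ' : α → ℕ → Prop} (hf : PolyBdd Γ f) (h : ∀ a N, Γ' a N → Γ a N) :
    PolyBdd Γ' f :=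
  let ⟨q, hq⟩ := hf
  ⟨q, fun a N ha => hq a N (h a N ha)⟩

theorem comp {Γ' : β → ℕ → Prop} {i : β → α} (hf : PolyBdd Γ f)
    (h : ∀ b N, Γ' b N → Γ (i b) N) : PolyBdd Γ' (fun b => f (i b)) :=
  let ⟨q, hq⟩ := hf
  ⟨q, fun b N hb => hq (i b) N (h b N hb)⟩

end PolyBdd

theorem TreeProg.Eval.left_eq {x y : BinaryTree Unit} (h : x.left = y) :
    TreeProg.left.Eval x y 1 := h ▸ .left x

theorem TreeProg.Eval.right_eq {x y : BinaryTree Unit} (h : x.right = y) :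
    TreeProg.right.Eval x y 1 := h ▸ .right x

/-- A loop whose successive states are `σ 0, …, σ l`. -/
theorem TreeProg.Eval.loop_iterate {c f : TreeProg} {σ b : ℕ → BinaryTree Unit} {l B : ℕ}
    (hc : ∀ i < l, b i ≠ .nil ∧ ∃ s, c.Eval (σ i) (b i) s ∧ s ≤ B)
    (hl : ∃ s, c.Eval (σ l) .nil s ∧ s ≤ B)
    (hf : ∀ i < l, ∃ t, f.Eval (σ i) (σ (i + 1)) t ∧ t ≤ B) :
    ∃ t, (TreeProg.loop c f).Eval (σ 0) (σ l) t ∧ t ≤ (l + 1) * (2 * B + 1) := by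
  induction l generalizing σ b with
  | zero =>
    obtain ⟨s, hs, hsB⟩ := hl
    exact ⟨_, TreeProg.Eval.loop_stop hs, by omega⟩
  | succ l ih =>
    obtain ⟨hb, s, hs, hsB⟩ := hc 0 (by omega)
    obtain ⟨t, ht, htB⟩ := hf 0 (by omega)
    obtain ⟨r, hr, hrB⟩ := ih (σ := fun i => σ (i + 1)) (b := fun i => b (i + 1))
      (fun i hi => hc (i + 1) (by omega)) hl (fun i hi => hf (i + 1) (by omega))
    refine ⟨_, .loop_step hs hb ht hr, ?_⟩
    have : (l + 1 + 1) * (2 * B + 1) = (l + 1) * (2 * B + 1) + (2 * B + 1) := by ring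
    omega

namespace PolyTime
variable {α β γ δ : Type} [TEnc α] [TEnc β] [TEnc γ] [TEnc δ] {Γ : α → ℕ → Prop}

theorem of_prog {f : α → β} (p : TreeProg) (n : ℕ)
    (h : ∀ a N, Γ a N → ∃ t, p.Eval (enc a) (enc (f a)) t ∧ t ≤ n) : PolyTime Γ f :=
  ⟨p, .C n, fun a N ha => by simpa using h a N ha⟩

theorem id' : PolyTime Γ (fun a => a) := of_prog .id 1 fun _ _ _ => ⟨_, .id _, le_rfl⟩

theorem comp {Γ' : β → ℕ → Prop} {f : α → β} {g : β → γ} (hg : PolyTime Γ' g) (hf : PolyTime Γ f)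
    (h : ∀ a N, Γ a N → Γ' (f a) N) : PolyTime Γ (fun a => g (f a)) := by
  obtain ⟨p, q, hp⟩ := hf
  obtain ⟨p', q', hp'⟩ := hg
  refine ⟨.seq p p', q + q' + 1, fun a N ha => ?_⟩
  obtain ⟨t, ht, htq⟩ := hp a N ha
  obtain ⟨t', ht', htq'⟩ := hp' _ N (h a N ha)
  exact ⟨_, .seq ht ht', by simp; omega⟩

theorem congr {f g : α → β} (hf : PolyTime Γ f) (h : ∀ a N, Γ a N → f a = g a) : PolyTime Γ g := by
  obtain ⟨p, q, hp⟩ := hf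
  exact ⟨p, q, fun a N ha => h a N ha ▸ hp a N ha⟩

theorem weaken {Γ' : α → ℕ → Prop} {f : α → β} (hf : PolyTime Γ f)
    (h : ∀ a N, Γ' a N → Γ a N) : PolyTime Γ' f :=
  let ⟨p, q, hp⟩ := hf
  ⟨p, q, fun a N ha => hp a N (h a N ha)⟩

/-- Changing the type of the result without changing its encoding. -/
theorem recode {f : α → β} {g : α → γ} (hf : PolyTime Γ f) (h : ∀ a, enc (g a) = enc (f a)) :
    PolyTime Γ g := by
  obtain ⟨p, q, hp⟩ := hf
  exact ⟨p, q, fun a N ha => h a ▸ hp a N ha⟩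

theorem prod {f : α → β} {g : α → γ} (hf : PolyTime Γ f) (hg : PolyTime Γ g) :
    PolyTime Γ (fun a => (f a, g a)) := by
  obtain ⟨p, q, hp⟩ := hf
  obtain ⟨p', q', hp'⟩ := hg
  refine ⟨.pair p p', q + q' + 1, fun a N ha => ?_⟩
  obtain ⟨t, ht, htq⟩ := hp a N ha
  obtain ⟨t', ht', htq'⟩ := hp' a N ha
  exact ⟨_, .pair ht ht', by simp; omega⟩

/-- Composition with a function that one fixed program computes in constant time. -/
theorem post {f : α → β} {g : β → γ} (hf : PolyTime Γ f) (p : TreeProg) (n : ℕ)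
    (h : ∀ b, ∃ t, p.Eval (enc b) (enc (g b)) t ∧ t ≤ n) : PolyTime Γ (fun a => g (f a)) :=
  (of_prog (Γ := fun _ _ => True) p n fun b _ _ => h b).comp hf fun _ _ _ => trivial

theorem fst {f : α → β × γ} (hf : PolyTime Γ f) : PolyTime Γ (fun a => (f a).1) :=
  hf.post .left 1 fun _ => ⟨_, .left _, le_rfl⟩

theorem snd {f : α → β × γ} (hf : PolyTime Γ f) : PolyTime Γ (fun a => (f a).2) :=
  hf.post .right 1 fun _ => ⟨_, .right _, le_rfl⟩

theorem nil : PolyTime Γ (fun _ => ([] : List β)) :=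
  of_prog .leaf 1 fun _ _ _ => ⟨_, .leaf _, le_rfl⟩

theorem false : PolyTime Γ (fun _ => false) :=
  of_prog .leaf 1 fun _ _ _ => ⟨_, .leaf _, le_rfl⟩

theorem zero : PolyTime Γ (fun _ => 0) :=
  of_prog .leaf 1 fun _ _ _ => ⟨_, .leaf _, le_rfl⟩

theorem unit : PolyTime Γ (fun _ => ()) :=
  of_prog .leaf 1 fun _ _ _ => ⟨_, .leaf _, le_rfl⟩

theorem leaf : PolyTime Γ (fun _ => (BinaryTree.nil : BinaryTree Unit)) :=
  of_prog .leaf 1 fun _ _ _ => ⟨_, .leaf _, le_rfl⟩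

theorem true : PolyTime Γ (fun _ => Bool.true) :=
  (unit.prod unit).recode fun _ => rfl

theorem cons {f : α → β} {g : α → List β} (hf : PolyTime Γ f) (hg : PolyTime Γ g) :
    PolyTime Γ (fun a => f a :: g a) :=
  (hf.prod hg).recode fun _ => rfl

theorem succ {f : α → ℕ} (hf : PolyTime Γ f) : PolyTime Γ (fun a => f a + 1) :=
  (unit.prod hf).recode fun _ => rfl

theorem natConst (n : ℕ) : PolyTime Γ (fun _ => n) := by
  induction n with
  | zero => exact zero
  | succ n ih => exact ih.succ

theorem node {f g : α → BinaryTree Unit} (hf : PolyTime Γ f) (hg : PolyTime Γ g) :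
    PolyTime Γ (fun a => BinaryTree.node () (f a) (g a)) :=
  (hf.prod hg).recode fun _ => rfl

theorem treeLeft {f : α → BinaryTree Unit} (hf : PolyTime Γ f) :
    PolyTime Γ (fun a => (f a).left) :=
  hf.post .left 1 fun _ => ⟨_, .left _, le_rfl⟩

theorem treeRight {f : α → BinaryTree Unit} (hf : PolyTime Γ f) :
    PolyTime Γ (fun a => (f a).right) :=
  hf.post .right 1 fun _ => ⟨_, .right _, le_rfl⟩

theorem tail {f : α → List β} (hf : PolyTime Γ f) : PolyTime Γ (fun a => (f a).tail) :=
  hf.post (g := List.tail) .right 1 fun b => ⟨_, .right_eq (by cases b <;> rfl), le_rfl⟩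

theorem pred {f : α → ℕ} (hf : PolyTime Γ f) : PolyTime Γ (fun a => f a - 1) :=
  hf.post (g := fun n => n - 1) .right 1 fun b => ⟨_, .right_eq (by cases b <;> rfl), le_rfl⟩

theorem ite {c : α → Bool} {f g : α → β} (hc : PolyTime Γ c)
    (hf : PolyTime (fun a N => Γ a N ∧ c a = Bool.true) f)
    (hg : PolyTime (fun a N => Γ a N ∧ c a = Bool.false) g) :
    PolyTime Γ (fun a => if c a then f a else g a) := by
  obtain ⟨p, q, hp⟩ := hc
  obtain ⟨p', q', hp'⟩ := hf
  obtain ⟨p'', q'', hp''⟩ := hg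
  refine ⟨.cond p p' p'', q + q' + q'' + 1, fun a N ha => ?_⟩
  obtain ⟨t, ht, htq⟩ := hp a N ha
  cases hca : c a with
  | true =>
    obtain ⟨t', ht', htq'⟩ := hp' a N ⟨ha, hca⟩
    rw [hca] at ht
    exact ⟨_, .cond_true ht (by simp [enc_true]) (by simpa [hca] using ht'), by simp; omega⟩
  | false =>
    obtain ⟨t', ht', htq'⟩ := hp'' a N ⟨ha, hca⟩
    rw [hca] at ht
    exact ⟨_, .cond_false ht (by simpa [hca] using ht'), by simp; omega⟩

theorem ite' {c : α → Bool} {f g : α → β} (hc : PolyTime Γ c)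
    (hf : PolyTime Γ f) (hg : PolyTime Γ g) :
    PolyTime Γ (fun a => if c a then f a else g a) :=
  hc.ite (hf.weaken fun _ _ h => h.1) (hg.weaken fun _ _ h => h.1)

theorem and {f g : α → Bool} (hf : PolyTime Γ f) (hg : PolyTime Γ g) :
    PolyTime Γ (fun a => f a && g a) :=
  (hf.ite' hg false).congr fun a _ _ => by cases f a <;> simp

theorem or {f g : α → Bool} (hf : PolyTime Γ f) (hg : PolyTime Γ g) :
    PolyTime Γ (fun a => f a || g a) :=
  (hf.ite' true hg).congr fun a _ _ => by cases f a <;> simp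

theorem not {f : α → Bool} (hf : PolyTime Γ f) : PolyTime Γ (fun a => !f a) :=
  (hf.ite' false true).congr fun a _ _ => by cases f a <;> simp

/-- Testing whether a result is encoded by the leaf. -/
theorem isLeaf {f : α → β} {g : α → Bool} (hf : PolyTime Γ f)
    (h : ∀ a, g a = Bool.true ↔ enc (f a) = .nil) : PolyTime Γ g := by
  obtain ⟨p, q, hp⟩ := hf
  refine ⟨.cond p .leaf (.pair .leaf .leaf), q + 5, fun a N ha => ?_⟩
  obtain ⟨t, ht, htq⟩ := hp a N ha
  by_cases hn : enc (f a) = .nil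
  · rw [(h a).2 hn]
    rw [hn] at ht
    exact ⟨_, .cond_false ht (.pair (.leaf _) (.leaf _)), by simp; omega⟩
  · have : g a = Bool.false := by simpa using mt (h a).1 hn
    rw [this]
    exact ⟨_, .cond_true ht hn (.leaf _), by simp; omega⟩

theorem isEmpty {f : α → List β} (hf : PolyTime Γ f) : PolyTime Γ (fun a => (f a).isEmpty) :=
  hf.isLeaf fun a => by cases f a <;> simp [enc_nil, enc_cons]

theorem headD {f : α → List β} {d : β} (hf : PolyTime Γ f) (hd : PolyTime Γ (fun _ => d)) :
    PolyTime Γ (fun a => (f a).headD d) := by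
  have h : PolyTime (fun (l : List β) _ => l.isEmpty = Bool.false) (fun l => l.headD d) :=
    of_prog .left 1 fun l _ hl => by
      cases l with
      | nil => simp at hl
      | cons => exact ⟨_, .left_eq rfl, le_rfl⟩
  refine (hf.isEmpty.ite (hd.weaken fun _ _ h => h.1) (h.comp (hf.weaken fun _ _ h => h.1)
    fun _ _ h => h.2)).congr fun a _ _ => ?_
  cases f a <;> rfl

theorem isZero {f : α → ℕ} (hf : PolyTime Γ f) : PolyTime Γ (fun a => f a == 0) :=
  hf.isLeaf fun a => by cases f a <;> simp [enc_zero, enc_succ]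

/-- The loop takes one round per list element, so its time is the length of the list times a bound
for one step. The size of the accumulator is not charged; `Inv` only has to record what the time
bound of the step function needs to know about it. -/
theorem foldl {L : α → List γ} {b : α → β} {f : α → β → γ → β} (Inv : α → ℕ → β → Prop)
    (hL : PolyTime Γ L) (hb : PolyTime Γ b) (hlen : PolyBdd Γ (fun a => (L a).length))
    (h0 : ∀ a N, Γ a N → Inv a N (b a))
    (hstep : ∀ a N y x, Γ a N → x ∈ L a → Inv a N y → Inv a N (f a y x))
    (hf : PolyTime (fun p N => Γ p.1 N ∧ Inv p.1 N p.2.1 ∧ p.2.2 ∈ L p.1)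
      (fun p : α × β × γ => f p.1 p.2.1 p.2.2)) :
    PolyTime Γ (fun a => (L a).foldl (f a) (b a)) := by
  obtain ⟨pL, qL, hpL⟩ := hL
  obtain ⟨pb, qb, hpb⟩ := hb
  obtain ⟨ql, hql⟩ := hlen
  obtain ⟨pf, qf, hpf⟩ := hf
  -- The loop state is the tree (argument, (accumulator, remaining list)); the body regroups it to
  -- (argument, (accumulator, head)) for `pf` and drops the head.
  let body : TreeProg := .pair .left (.pair (.seq (.pair .left (.pair (.seq .right .left)
    (.seq (.seq .right .right) .left))) pf) (.seq (.seq .right .right) .right))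
  refine ⟨.seq (.pair .id (.pair pb pL)) (.seq (.loop (.seq .right .right) body)
    (.seq .right .left)), qL + qb + (ql + 1) * (2 * (qf + 40) + 1) + 20, fun a N ha => ?_⟩
  obtain ⟨tL, htL, htLq⟩ := hpL a N ha
  obtain ⟨tb, htb, htbq⟩ := hpb a N ha
  let y : ℕ → β := fun i => ((L a).take i).foldl (f a) (b a)
  let σ : ℕ → BinaryTree Unit := fun i => .node () (enc a) (.node () (enc (y i)) (enc ((L a).drop i)))
  have hInv : ∀ i, Inv a N (y i) := by
    have key : ∀ l : List γ, l ⊆ L a → ∀ y, Inv a N y → Inv a N (l.foldl (f a) y) := by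
      intro l
      induction l with
      | nil => intro _ y hy; exact hy
      | cons x l ih =>
        intro hl y hy
        exact ih (fun z hz => hl (by simp [hz])) _ (hstep a N y x ha (hl (by simp)) hy)
    exact fun i => key _ (List.take_subset i _) _ (h0 a N ha)
  have hloop := TreeProg.Eval.loop_iterate (c := .seq .right .right) (f := body) (σ := σ)
    (b := fun i => enc ((L a).drop i)) (l := (L a).length) (B := qf.eval N + 40)
    (fun i hi => ⟨by rw [List.drop_eq_getElem_cons hi, enc_cons]; simp,
      _, .seq (.right _) (.right _), by omega⟩)
    ⟨_, .seq (.right _) (.right_eq (by simp [σ, BinaryTree.right, enc_nil])), by omega⟩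
    (fun i hi => by
      have hmem : (L a)[i] ∈ L a := List.getElem_mem hi
      obtain ⟨t, ht, htq⟩ := hpf (a, y i, (L a)[i]) N ⟨ha, hInv i, hmem⟩
      have hy : f a (y i) (L a)[i] = y (i + 1) := by
        simp only [y]
        rw [← List.take_append_getElem hi, List.foldl_append]
        rfl
      have hσ : σ i = .node () (enc a) (.node () (enc (y i))
          (.node () (enc (L a)[i]) (enc ((L a).drop (i + 1))))) := by
        simp only [σ, List.drop_eq_getElem_cons hi, enc_cons]
      rw [hσ]
      simp only [hy] at ht
      refine ⟨_, .pair (.left _) (.pair (.seq (.pair (.left _) (.pair (.seq (.right _) (.left _))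
        (.seq (.seq (.right _) (.right _)) (.left _)))) ht)
        (.seq (.seq (.right _) (.right _)) (.right _))), ?_⟩
      omega)
  obtain ⟨t, ht, htB⟩ := hloop
  have hσ0 : σ 0 = .node () (enc a) (.node () (enc (b a)) (enc (L a))) := by simp [σ, y]
  have hσl : (σ (L a).length).right.left = enc ((L a).foldl (f a) (b a)) := by
    simp [σ, y, BinaryTree.right, BinaryTree.left]
  rw [hσ0] at ht
  refine ⟨_, .seq (.pair (.id _) (.pair htb htL)) (.seq ht (.seq (.right _) (.left_eq hσl))), ?_⟩
  have h1 : (L a).length ≤ ql.eval N := hql a N ha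
  have h2 : ((L a).length + 1) * (2 * (qf.eval N + 40) + 1) ≤
    (ql.eval N + 1) * (2 * (qf.eval N + 40) + 1) := Nat.mul_le_mul_right _ (by omega)
  simp
  omega

/-- A fold whose step needs no information on the accumulator. -/
theorem foldl' {L : α → List γ} {b : α → β} {f : α → β → γ → β}
    (hL : PolyTime Γ L) (hb : PolyTime Γ b) (hlen : PolyBdd Γ (fun a => (L a).length))
    (hf : PolyTime (fun p N => Γ p.1 N ∧ p.2.2 ∈ L p.1)
      (fun p : α × β × γ => f p.1 p.2.1 p.2.2)) :
    PolyTime Γ (fun a => (L a).foldl (f a) (b a)) :=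
  foldl (fun _ _ _ => True) hL hb hlen (fun _ _ _ => trivial) (fun _ _ _ _ _ _ _ => trivial)
    (hf.weaken fun _ _ h => ⟨h.1, h.2.2⟩)

/-- A unary number has the same encoding as a list of that many units, so that iteration is a fold.
-/
theorem iterate {n : α → ℕ} {b : α → β} {f : α → β → β} (Inv : α → ℕ → β → Prop)
    (hn : PolyTime Γ n) (hb : PolyTime Γ b) (hlen : PolyBdd Γ n)
    (h0 : ∀ a N, Γ a N → Inv a N (b a))
    (hstep : ∀ a N y, Γ a N → Inv a N y → Inv a N (f a y))
    (hf : PolyTime (fun p N => Γ p.1 N ∧ Inv p.1 N p.2) (fun p : α × β => f p.1 p.2)) :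
    PolyTime Γ (fun a => (f a)^[n a] (b a)) := by
  have hL : PolyTime Γ (fun a => List.replicate (n a) ()) := hn.recode fun a => enc_replicate _
  have key : ∀ (g : β → β) (y : β) (k : ℕ),
      (List.replicate k ()).foldl (fun y _ => g y) y = g^[k] y := by
    intro g y k
    induction k generalizing y with
    | zero => rfl
    | succ k ih => simp [List.replicate_succ, ih]
  refine (foldl (f := fun a y _ => f a y) Inv hL hb (by simpa using hlen) h0
    (fun a N y x ha _ hy => hstep a N y ha hy) ?_).congr fun a _ _ => key _ _ _
  exact hf.comp (f := fun p : α × β × Unit => (p.1, p.2.1)) (id'.fst.prod id'.snd.fst)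
    fun p N h => ⟨h.1, h.2.1⟩

theorem iterate' {n : α → ℕ} {b : α → β} {f : α → β → β}
    (hn : PolyTime Γ n) (hb : PolyTime Γ b) (hlen : PolyBdd Γ n)
    (hf : PolyTime (fun p N => Γ p.1 N) (fun p : α × β => f p.1 p.2)) :
    PolyTime Γ (fun a => (f a)^[n a] (b a)) :=
  iterate (fun _ _ _ => True) hn hb hlen (fun _ _ _ => trivial) (fun _ _ _ _ _ => trivial)
    (hf.weaken fun _ _ h => h.1)

/-! ### List operations -/

theorem reverse {L : α → List β} (hL : PolyTime Γ L) (hlen : PolyBdd Γ (fun a => (L a).length)) :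
    PolyTime Γ (fun a => (L a).reverse) := by
  refine (foldl' (f := fun _ (y : List β) x => x :: y) hL nil hlen
    (id'.snd.snd.cons id'.snd.fst)).congr fun a _ _ => ?_
  simp

theorem append {L M : α → List β} (hL : PolyTime Γ L) (hM : PolyTime Γ M)
    (hlen : PolyBdd Γ (fun a => (L a).length)) : PolyTime Γ (fun a => L a ++ M a) := by
  refine (foldl' (f := fun _ (y : List β) x => x :: y) (hL.reverse hlen) hM (by simpa using hlen)
    (id'.snd.snd.cons id'.snd.fst)).congr fun a _ _ => ?_
  simp

theorem map {L : α → List γ} {f : α → γ → β} (hL : PolyTime Γ L)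
    (hlen : PolyBdd Γ (fun a => (L a).length))
    (hf : PolyTime (fun p N => Γ p.1 N ∧ p.2 ∈ L p.1) (fun p : α × γ => f p.1 p.2)) :
    PolyTime Γ (fun a => (L a).map (f a)) := by
  refine (foldl' (f := fun a (y : List β) x => f a x :: y) (hL.reverse hlen) nil
    (by simpa using hlen) (PolyTime.cons ?_ id'.snd.fst)).congr fun a _ _ => ?_
  · exact hf.comp (f := fun p : α × List β × γ => (p.1, p.2.2)) (id'.fst.prod id'.snd.snd)
      fun p N h => ⟨h.1, by simpa using h.2⟩
  · simp

theorem flatMap {L : α → List γ} {f : α → γ → List β} (hL : PolyTime Γ L)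
    (hlen : PolyBdd Γ (fun a => (L a).length))
    (hf : PolyTime (fun p N => Γ p.1 N ∧ p.2 ∈ L p.1) (fun p : α × γ => f p.1 p.2))
    (hlen' : PolyBdd (fun p N => Γ p.1 N ∧ p.2 ∈ L p.1)
      (fun p : α × γ => (f p.1 p.2).length)) :
    PolyTime Γ (fun a => (L a).flatMap (f a)) := by
  refine (foldl' (f := fun a (y : List β) x => f a x ++ y) (hL.reverse hlen) nil
    (by simpa using hlen) (PolyTime.append ?_ id'.snd.fst ?_)).congr fun a _ _ => ?_
  · exact hf.comp (f := fun p : α × List β × γ => (p.1, p.2.2)) (id'.fst.prod id'.snd.snd)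
      fun p N h => ⟨h.1, by simpa using h.2⟩
  · exact hlen'.comp (i := fun p : α × List β × γ => (p.1, p.2.2))
      fun p N h => ⟨h.1, by simpa using h.2⟩
  · simp only [List.foldl_reverse]
    induction L a with
    | nil => rfl
    | cons x l ih => simp [ih]

theorem filter {L : α → List β} {f : α → β → Bool} (hL : PolyTime Γ L)
    (hlen : PolyBdd Γ (fun a => (L a).length))
    (hf : PolyTime (fun p N => Γ p.1 N ∧ p.2 ∈ L p.1) (fun p : α × β => f p.1 p.2)) :
    PolyTime Γ (fun a => (L a).filter (f a)) := by
  refine (flatMap (f := fun a x => if f a x then [x] else []) hL hlen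
    (hf.ite' (id'.snd.cons nil) nil) ((PolyBdd.const 1).mono fun p _ _ => ?_)).congr
    fun a _ _ => ?_
  · split <;> simp
  · induction L a with
    | nil => rfl
    | cons x l ih => by_cases h : f a x <;> simp [h, ih]

theorem any {L : α → List β} {f : α → β → Bool} (hL : PolyTime Γ L)
    (hlen : PolyBdd Γ (fun a => (L a).length))
    (hf : PolyTime (fun p N => Γ p.1 N ∧ p.2 ∈ L p.1) (fun p : α × β => f p.1 p.2)) :
    PolyTime Γ (fun a => (L a).any (f a)) := by
  refine ((hL.filter hlen hf).isEmpty.not).congr fun a _ _ => ?_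
  induction L a with
  | nil => rfl
  | cons x l ih => by_cases h : f a x <;> simp [h, ← ih]

theorem length {L : α → List β} (hL : PolyTime Γ L) (hlen : PolyBdd Γ (fun a => (L a).length)) :
    PolyTime Γ (fun a => (L a).length) := by
  refine (foldl' (f := fun _ (y : ℕ) _ => y + 1) hL zero hlen id'.snd.fst.succ).congr fun a _ _ => ?_
  have : ∀ (l : List β) (n : ℕ), l.foldl (fun (y : ℕ) _ => y + 1) n = n + l.length := by
    intro l
    induction l with
    | nil => simp
    | cons x l ih => intro n; simp [ih]; omega
  simp [this]

/-! ### Arithmetic and comparisons in unary -/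

theorem add {f g : α → ℕ} (hf : PolyTime Γ f) (hg : PolyTime Γ g) (hb : PolyBdd Γ g) :
    PolyTime Γ (fun a => f a + g a) :=
  (iterate' (f := fun _ (y : ℕ) => y + 1) hg hf hb id'.snd.succ).congr fun a _ _ => by
    simp

theorem sub {f g : α → ℕ} (hf : PolyTime Γ f) (hg : PolyTime Γ g) (hb : PolyBdd Γ g) :
    PolyTime Γ (fun a => f a - g a) :=
  (iterate' (f := fun _ (y : ℕ) => y - 1) hg hf hb id'.snd.pred).congr fun a _ _ => by
    have : ∀ n k : ℕ, (fun y => y - 1)^[k] n = n - k := by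
      intro n k
      induction k with
      | zero => rfl
      | succ k ih => rw [Function.iterate_succ_apply', ih]; omega
    exact this _ _

theorem mul {f g : α → ℕ} (hf : PolyTime Γ f) (hg : PolyTime Γ g) (hb : PolyBdd Γ f)
    (hb' : PolyBdd Γ g) : PolyTime Γ (fun a => f a * g a) :=
  (iterate' (f := fun a (y : ℕ) => y + f a) hg zero hb'
    (id'.snd.add (hf.comp id'.fst fun _ _ h => h) (hb.comp fun _ _ h => h))).congr fun a _ _ => by
      have : ∀ n k : ℕ, (fun y => y + n)^[k] 0 = n * k := by
        intro n k
        induction k with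
        | zero => rfl
        | succ k ih => rw [Function.iterate_succ_apply', ih]; ring
      exact this _ _

theorem max {f g : α → ℕ} (hf : PolyTime Γ f) (hg : PolyTime Γ g) (hb : PolyBdd Γ f)
    (hb' : PolyBdd Γ g) : PolyTime Γ (fun a => Max.max (f a) (g a)) :=
  (hf.add (hg.sub hf hb) (hb'.mono fun _ _ _ => Nat.sub_le _ _)).congr fun a _ _ => by omega

theorem ble {f g : α → ℕ} (hf : PolyTime Γ f) (hg : PolyTime Γ g) (hb' : PolyBdd Γ g) :
    PolyTime Γ (fun a => decide (f a ≤ g a)) :=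
  (hf.sub hg hb').isZero.congr fun a _ _ => by
    rw [Bool.eq_iff_iff]; simp [Nat.sub_eq_zero_iff_le]

theorem natEq {f g : α → ℕ} (hf : PolyTime Γ f) (hg : PolyTime Γ g) (hb : PolyBdd Γ f)
    (hb' : PolyBdd Γ g) : PolyTime Γ (fun a => decide (f a = g a)) :=
  ((hf.ble hg hb').and (hg.ble hf hb)).congr fun a _ _ => by
    rw [Bool.eq_iff_iff]; simp; omega

theorem boolEq {f g : α → Bool} (hf : PolyTime Γ f) (hg : PolyTime Γ g) :
    PolyTime Γ (fun a => decide (f a = g a)) :=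
  (hf.ite' hg hg.not).congr fun a _ _ => by cases f a <;> cases g a <;> rfl

theorem getD {L : α → List β} {i : α → ℕ} {d : β} (hL : PolyTime Γ L)
    (hd : PolyTime Γ (fun _ => d))
    (hi : PolyTime Γ i) (hb : PolyBdd Γ i) : PolyTime Γ (fun a => (L a).getD (i a) d) :=
  (headD (iterate' (f := fun _ (l : List β) => l.tail) hi hL hb id'.snd.tail) hd).congr
    fun a _ _ => by
      have : ∀ (l : List β) k, (List.tail^[k] l).headD d = l.getD k d := by
        intro l k
        induction k generalizing l with
        | zero => cases l <;> rfl
        | succ k ih =>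
          rw [Function.iterate_succ_apply, ih]
          cases l <;> simp
      exact this _ _

theorem range {n : α → ℕ} (hn : PolyTime Γ n) (hb : PolyBdd Γ n) :
    PolyTime Γ (fun a => List.range (n a)) := by
  have key : ∀ k : ℕ, (fun s : ℕ × List ℕ => (s.1 + 1, s.1 :: s.2))^[k] (0, []) =
      (k, (List.range k).reverse) := by
    intro k
    induction k with
    | zero => rfl
    | succ k ih => rw [Function.iterate_succ_apply', ih]; simp [List.range_succ]
  have h := (iterate' (f := fun _ (s : ℕ × List ℕ) => (s.1 + 1, s.1 :: s.2)) hn (zero.prod nil) hb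
    (id'.snd.fst.succ.prod (id'.snd.fst.cons id'.snd.snd))).snd
  simp only [key] at h
  exact (h.reverse (by simpa using hb)).congr fun a _ _ => by simp

end PolyTime

/-! ## Sliding tokens -/

namespace Sliding
set_option linter.unusedSectionVars false
open Relation Finset

variable {V : Type} [DecidableEq V] {G : SimpleGraph V}

/-- No two elements of `X` are adjacent. -/
def Ind (G : SimpleGraph V) (X : Finset V) : Prop := ∀ a ∈ X, ∀ b ∈ X, ¬ G.Adj a b

/-- One token of the independent set `X` slides along an edge, which gives the independent
set `Y`. -/
def Step (G : SimpleGraph V) (X Y : Finset V) : Prop :=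
  Ind G X ∧ Ind G Y ∧ ∃ u ∈ X, ∃ v ∉ X, G.Adj u v ∧ Y = insert v (X.erase u)

theorem Step.symm {X Y : Finset V} (h : Step G X Y) : Step G Y X := by
  obtain ⟨hX, hY, u, hu, v, hv, huv, rfl⟩ := h
  refine ⟨hY, hX, v, by simp, u, ?_, huv.symm, ?_⟩
  · simp [huv.ne]
  · ext w
    simp only [mem_insert, mem_erase]
    by_cases h1 : w = u <;> by_cases h2 : w = v <;> simp_all

theorem Step.card_eq {X Y : Finset V} (h : Step G X Y) : Y.card = X.card := by
  obtain ⟨hX, hY, u, hu, v, hv, huv, rfl⟩ := h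
  rw [card_insert_of_notMem (by simp [hv]), card_erase_of_mem hu]
  have := card_pos.2 ⟨u, hu⟩
  omega

/-- Reconfigurability by slides. -/
def Reach (G : SimpleGraph V) : Finset V → Finset V → Prop := ReflTransGen (Step G)

theorem Reach.symm {X Y : Finset V} (h : Reach G X Y) : Reach G Y X := by
  induction h with
  | refl => exact .refl
  | tail _ h ih => exact ih.head h.symm

theorem Reach.card_eq {X Y : Finset V} (h : Reach G X Y) : Y.card = X.card := by
  induction h with
  | refl => rfl
  | tail _ h ih => rw [h.card_eq, ih]

theorem isNIndepSet_iff {k : ℕ} {X : Finset V} : G.IsNIndepSet k X ↔ Ind G X ∧ X.card = k := by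
  rw [SimpleGraph.isNIndepSet_iff]
  refine and_congr_left fun _ => ⟨fun h a ha b hb hab => h ha hb hab.ne hab,
    fun h a ha b hb _ => h a ha b hb⟩

theorem adj_iff_step {k : ℕ} {A B : {A : Finset V // G.IsNIndepSet k A}} :
    (tokenSlidingGraph G k).Adj A B ↔ Step G A.1 B.1 := by
  constructor
  · rintro ⟨u, v, huv, hA, hB⟩
    have hu : u ∈ A.1 \ B.1 := by rw [hA]; simp
    have hv : v ∈ B.1 \ A.1 := by rw [hB]; simp
    rw [mem_sdiff] at hu hv
    refine ⟨(isNIndepSet_iff.1 A.2).1, (isNIndepSet_iff.1 B.2).1, u, hu.1, v, hv.2, huv, ?_⟩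
    ext w
    have h1 := Finset.ext_iff.1 hA w
    have h2 := Finset.ext_iff.1 hB w
    simp only [mem_sdiff, mem_singleton, mem_insert, mem_erase] at h1 h2 ⊢
    tauto
  · rintro ⟨_, _, u, hu, v, hv, huv, hB⟩
    refine ⟨u, v, huv, ?_, ?_⟩ <;> ext w <;> rw [hB] <;>
      simp only [mem_sdiff, mem_singleton, mem_insert, mem_erase]
    · constructor
      · tauto
      · rintro rfl; exact ⟨hu, by simp [huv.ne]⟩
    · constructor
      · tauto
      · rintro rfl; exact ⟨by simp, hv⟩

/-- A slide preserves independence and size, so a sequence of slides that starts in the subtype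
never leaves it. -/
theorem reachable_iff_reach {k : ℕ} {A B : {A : Finset V // G.IsNIndepSet k A}} :
    (tokenSlidingGraph G k).Reachable A B ↔ Reach G A.1 B.1 := by
  rw [SimpleGraph.reachable_iff_reflTransGen]
  constructor
  · intro h
    exact h.lift (p := Step G) Subtype.val fun _ _ => adj_iff_step.1
  · obtain ⟨A, hA⟩ := A
    obtain ⟨B, hB⟩ := B
    intro h
    change ReflTransGen (Step G) A B at h
    induction h using ReflTransGen.head_induction_on with
    | refl => rfl
    | head h _ ih =>
      have hc := isNIndepSet_iff.2 ⟨h.2.1, h.card_eq.trans hA.card_eq⟩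
      exact (ih hc).head (adj_iff_step.2 h)

/-! ### Moving a token within a connected set -/

/-- `p 0, …, p l` is a walk within `C`. -/
def IsWalk (G : SimpleGraph V) (C : Finset V) (l : ℕ) (p : ℕ → V) : Prop :=
  (∀ i ≤ l, p i ∈ C) ∧ ∀ i < l, G.Adj (p i) (p (i + 1))

/-- Any two vertices of `C` are joined by a walk within `C`. -/
def Conn (G : SimpleGraph V) (C : Finset V) : Prop :=
  ∀ x ∈ C, ∀ z ∈ C, ∃ l p, IsWalk G C l p ∧ p 0 = x ∧ p l = z

/-- The closed neighbourhoods of `x` and `y` are disjoint. -/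
def Far (G : SimpleGraph V) (x y : V) : Prop :=
  x ≠ y ∧ ¬ G.Adj x y ∧ ∀ c, G.Adj c x → ¬ G.Adj c y

theorem Far.symm {x y : V} (h : Far G x y) : Far G y x :=
  ⟨h.1.symm, fun e => h.2.1 e.symm, fun c h1 h2 => h.2.2 c h2 h1⟩

/-- Distinct elements of `X` are far from each other. -/
def Scattered (G : SimpleGraph V) (X : Finset V) : Prop :=
  ∀ x ∈ X, ∀ y ∈ X, x ≠ y → Far G x y

theorem Scattered.mono {X Y : Finset V} (h : Scattered G Y) (hX : X ⊆ Y) : Scattered G X :=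
  fun x hx y hy => h x (hX hx) y (hX hy)

theorem Scattered.ind {X : Finset V} (h : Scattered G X) : Ind G X := fun x hx y hy hxy =>
  (h x hx y hy hxy.ne).2.1 hxy

/-- The vertex `v` neither belongs to `X` nor has a neighbour in `X`. -/
def Free (G : SimpleGraph V) (X : Finset V) (v : V) : Prop := v ∉ X ∧ ∀ x ∈ X, ¬ G.Adj v x

theorem Ind.insert {X : Finset V} {v : V} (h : Ind G X) (hv : Free G X v) :
    Ind G (insert v X) := by
  intro a ha b hb hab
  rw [mem_insert] at ha hb
  rcases ha with rfl | ha <;> rcases hb with rfl | hb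
  · exact hab.ne rfl
  · exact hv.2 b hb hab
  · exact hv.2 a ha hab.symm
  · exact h a ha b hb hab

theorem step_insert {X : Finset V} {u v : V} (hX : Ind G X) (hu : Free G X u) (hv : Free G X v)
    (huv : G.Adj u v) : Step G (insert u X) (insert v X) := by
  refine ⟨hX.insert hu, hX.insert hv, u, by simp, v, ?_, huv, ?_⟩
  · simp [huv.ne.symm, hv.1]
  · rw [erase_insert hu.1]

theorem reach_walk {X : Finset V} {l : ℕ} {p : ℕ → V} (hX : Ind G X)
    (hp : ∀ i < l, G.Adj (p i) (p (i + 1))) (hfree : ∀ i ≤ l, Free G X (p i)) :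
    Reach G (insert (p 0) X) (insert (p l) X) := by
  induction l with
  | zero => exact .refl
  | succ l ih =>
    exact (ih (fun i hi => hp i (by omega)) (fun i hi => hfree i (by omega))).tail
      (step_insert hX (hfree l (by omega)) (hfree _ le_rfl) (hp l (by omega)))

/-- The tokens on a scattered set move as if they could jump over each other: from `X`, the
elements of which are far from each other and from `z`, one can reach `X - x + z`. The set `Y` of
tokens outside `C` does not matter. -/
theorem reach_exchange {C Y : Finset V} (hY : Ind G Y) (hCY : ∀ c ∈ C, Free G Y c) (l : ℕ) :
    ∀ {X : Finset V} {z : V} {p : ℕ → V}, X ⊆ C → z ∉ X →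
    Scattered G (insert z X) → IsWalk G C l p → p 0 ∈ X → p l = z →
    Reach G (X ∪ Y) (insert z (X.erase (p 0)) ∪ Y) := by
  classical
  induction l using Nat.strong_induction_on with
  | _ l ih =>
    intro X z p hXC hz hS hw hp0 hpl
    -- the last vertex of the walk that is not free
    obtain ⟨i, hi, hmax⟩ : ∃ i, (i ≤ l ∧ ¬ Free G X (p i)) ∧
        ∀ j, i < j → j ≤ l → Free G X (p j) := by
      have h0 : ∃ i, i ≤ l ∧ ¬ Free G X (p i) := ⟨0, by omega, fun h => h.1 hp0⟩
      refine ⟨Nat.findGreatest (fun i => ¬ Free G X (p i)) l, ⟨Nat.findGreatest_le l, ?_⟩, ?_⟩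
      · obtain ⟨i, hi, h⟩ := h0
        exact Nat.findGreatest_spec (P := fun i => ¬ Free G X (p i)) hi h
      · intro j hj hjl
        exact not_not.1 (Nat.findGreatest_is_greatest hj hjl)
    have hzfree : Free G X z := ⟨hz, fun x hx =>
      (hS z (by simp) x (by simp [hx]) fun h => hz (h ▸ hx)).2.1⟩
    have hil : i < l := lt_of_le_of_ne hi.1 fun h => hi.2 (by rw [h, hpl]; exact hzfree)
    -- the token `u` next to it
    obtain ⟨u, hu, hui⟩ : ∃ u ∈ X, p i = u ∨ G.Adj (p i) u := by
      by_contra h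
      push Not at h
      exact hi.2 ⟨fun h' => (h _ h').1 rfl, fun x hx => (h x hx).2⟩
    have huz : Far G u z := (hS z (by simp) u (by simp [hu]) fun h => hz (h ▸ hu)).symm
    have hX' : Scattered G X := hS.mono (subset_insert _ _)
    have hYu : ∀ v ∈ C, Free G (X.erase u) v → Free G (X.erase u ∪ Y) v := fun v hv h =>
      ⟨by simp only [mem_union, not_or]; exact ⟨h.1, (hCY v hv).1⟩, fun x hx => by
        rcases mem_union.1 hx with hx | hx
        · exact h.2 x hx
        · exact (hCY v hv).2 x hx⟩
    have hind : Ind G (X.erase u ∪ Y) := by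
      intro a ha b hb hab
      rcases mem_union.1 ha with ha | ha <;> rcases mem_union.1 hb with hb | hb
      · exact hX'.ind a (mem_of_mem_erase ha) b (mem_of_mem_erase hb) hab
      · exact (hCY a (hXC (mem_of_mem_erase ha))).2 b hb hab
      · exact (hCY b (hXC (mem_of_mem_erase hb))).2 a ha hab.symm
      · exact hY a ha b hb hab
    have hfu : Free G (X.erase u) u := ⟨by simp, fun x hx =>
      (hX' u hu x (mem_of_mem_erase hx) (ne_of_mem_erase hx).symm).2.1⟩
    -- Distinct tokens have disjoint closed neighbourhoods, so `u` is the only token that blocks `p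
    -- i`.
    have hfi : Free G (X.erase u) (p i) := by
      rcases hui with h | h
      · rw [h]; exact hfu
      · refine ⟨fun h' => ?_, fun x hx hx' => ?_⟩
        · exact (hX' u hu _ (mem_of_mem_erase h') (ne_of_mem_erase h').symm).2.1 h.symm
        · exact (hX' u hu x (mem_of_mem_erase hx) (ne_of_mem_erase hx).symm).2.2 _ h hx'
    have hfj : ∀ j, i ≤ j → j ≤ l → Free G (X.erase u) (p j) := by
      intro j hj hjl
      rcases hj.eq_or_lt with rfl | hj
      · exact hfi
      · have := hmax j hj hjl
        exact ⟨fun h => this.1 (mem_of_mem_erase h), fun x hx => this.2 x (mem_of_mem_erase hx)⟩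
    -- The token on `u` gets onto the walk at `p i` and follows it to `z`; all later vertices of the
    -- walk are free by the choice of `i`.
    have h1 : Reach G (insert u (X.erase u ∪ Y)) (insert z (X.erase u ∪ Y)) := by
      have h2 : Reach G (insert (p i) (X.erase u ∪ Y)) (insert z (X.erase u ∪ Y)) := by
        have := reach_walk (G := G) (X := X.erase u ∪ Y) (l := l - i) (p := fun j => p (i + j)) hind
          (fun j hj => hw.2 (i + j) (by omega))
          (fun j hj => hYu _ (hw.1 _ (by omega)) (hfj _ (by omega) (by omega)))
        simpa [show i + (l - i) = l by omega, hpl] using this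
      rcases hui with h | h
      · rw [← h] at h2 ⊢; exact h2
      · exact .head (step_insert hind (hYu _ (hXC hu) hfu) (hYu _ (hw.1 _ hi.1) hfi) h.symm) h2
    have e1 : insert u (X.erase u ∪ Y) = X ∪ Y := by
      rw [← insert_union, insert_erase hu]
    rw [e1, ← insert_union] at h1
    by_cases hu0 : u = p 0
    · rwa [hu0] at h1
    -- now `u` is the free place
    have hX1C : insert z (X.erase u) ⊆ C := by
      intro v hv
      rcases mem_insert.1 hv with rfl | hv
      · exact hpl ▸ hw.1 l le_rfl
      · exact hXC (mem_of_mem_erase hv)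
    have hu1 : u ∉ insert z (X.erase u) := by simp [huz.1]
    have hins : insert u (insert z (X.erase u)) = insert z X := by
      rw [insert_comm, insert_erase hu]
    have hp0' : p 0 ∈ insert z (X.erase u) := by simp [hp0, Ne.symm hu0]
    have e2 : insert u ((insert z (X.erase u)).erase (p 0)) = insert z (X.erase (p 0)) := by
      have hz0 : z ≠ p 0 := fun h => hz (h ▸ hp0)
      ext w
      simp only [mem_insert, mem_erase]
      by_cases hw1 : w = u
      · subst hw1; simp [hu0, hu]
      · by_cases hw2 : w = z
        · subst hw2; simp [hz0]
        · simp [hw1, hw2]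
    -- What remains is to bring the token on `p 0` to the vacated vertex `u`. The initial part of
    -- the walk up to `p i`, followed by `u` if `p i ≠ u`, is shorter than the given walk, so
    -- induction applies.
    rcases hui with h | h
    · have := ih i hil (X := insert z (X.erase u)) (z := u) (p := p) hX1C hu1 (by rwa [hins])
        ⟨fun j hj => hw.1 j (by omega), fun j hj => hw.2 j (by omega)⟩ hp0' h
      rw [e2] at this
      exact h1.trans this
    -- If `i + 1` were `l`, then `p i` would be a common neighbour of `u` and `z`, which are far
    -- from each other.
    · have hil2 : i + 1 < l := by
        refine lt_of_le_of_ne hil fun h' => ?_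
        have := hw.2 i hil
        rw [show i + 1 = l from h', hpl] at this
        exact huz.2.2 _ h this
      have := ih (i + 1) hil2 (X := insert z (X.erase u)) (z := u)
        (p := fun j => if j ≤ i then p j else u) hX1C hu1 (by rwa [hins])
        ⟨fun j hj => ?_, fun j hj => ?_⟩ (by simpa using hp0') (by simp)
      · simp only [Nat.zero_le, if_true] at this
        rw [e2] at this
        exact h1.trans this
      · dsimp only
        split
        · exact hw.1 j (by omega)
        · exact hXC hu
      · dsimp only
        rcases (show j ≤ i by omega).eq_or_lt with rfl | hj'
        · simpa using h
        · rw [if_pos (by omega), if_pos (by omega)]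
          exact hw.2 j (by omega)

/-- Two subsets of a scattered set of the same size can be transformed into each other. -/
theorem reach_of_scattered_union {C Y : Finset V} (hY : Ind G Y) (hCY : ∀ c ∈ C, Free G Y c)
    (hC : Conn G C) {X Z : Finset V} (hX : X ⊆ C) (hZ : Z ⊆ C) (h : X.card = Z.card)
    (hS : Scattered G (X ∪ Z)) : Reach G (X ∪ Y) (Z ∪ Y) := by
  induction hn : (X \ Z).card using Nat.strong_induction_on generalizing X with
  | _ n ih =>
    rcases (X \ Z).eq_empty_or_nonempty with he | ⟨x, hx⟩
    · rw [sdiff_eq_empty_iff_subset] at he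
      rw [eq_of_subset_of_card_le he h.ge]
      exact .refl
    · have hne : (Z \ X).Nonempty := by
        rw [← card_pos, ← card_sdiff_comm h]
        exact card_pos.2 ⟨x, hx⟩
      obtain ⟨z, hz⟩ := hne
      rw [mem_sdiff] at hx hz
      obtain ⟨l, p, hp, hp0, hpl⟩ := hC x (hX hx.1) z (hZ hz.1)
      have h1 := reach_exchange hY hCY l hX hz.2 (hS.mono (insert_subset (by simp [hz.1])
        subset_union_left)) hp (hp0 ▸ hx.1) hpl
      rw [hp0] at h1
      refine h1.trans (ih _ ?_ (X := insert z (X.erase x)) ?_ ?_ ?_ rfl)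
      · rw [← hn]
        refine card_lt_card ((ssubset_iff_of_subset ?_).2 ⟨x, by simp [hx], ?_⟩)
        · intro w hw
          simp only [mem_sdiff, mem_insert, mem_erase] at hw ⊢
          rcases hw with ⟨rfl | hw, hw'⟩
          · exact absurd hz.1 hw'
          · exact ⟨hw.2, hw'⟩
        · simp only [mem_sdiff, mem_insert, mem_erase]
          rintro ⟨rfl | h, _⟩
          · exact hz.2 hx.1
          · exact h.1 rfl
      · exact insert_subset (hZ hz.1) ((erase_subset _ _).trans hX)
      · rw [card_insert_of_notMem (by simp [hz.2]), card_erase_of_mem hx.1, ← h]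
        have := card_pos.2 ⟨x, hx.1⟩
        omega
      · refine hS.mono (union_subset (insert_subset (by simp [hz.1]) ?_) subset_union_right)
        exact (erase_subset _ _).trans subset_union_left

end Sliding

namespace Sliding
open Relation Finset
set_option linter.unusedSectionVars false

/-! ### Absorbing sets -/

section Absorb
variable {V W : Type} [DecidableEq V] [DecidableEq W] [Fintype W]

/-- The tokens in the set `C` can be rearranged at will, and each token on a vertex `b ∉ C` with a
neighbour in `C` can enter `C`, for a suitable arrangement of the tokens there (fewer
than `k`). -/
structure Absorbing (G : SimpleGraph V) (C : Finset V) (k : ℕ) : Prop where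
  rearrange : ∀ Y Q R : Finset V, Ind G Y → (∀ c ∈ C, Free G Y c) → Q ⊆ C → R ⊆ C →
    Scattered G Q → Scattered G R → Q.card = R.card → Q.card ≤ k → Reach G (Q ∪ Y) (R ∪ Y)
  enter : ∀ b ∉ C, (∃ c ∈ C, G.Adj b c) → ∀ m < k, ∃ Q ⊆ C, Q.card = m ∧ Free G Q b ∧
    ∃ c ∈ C, G.Adj b c ∧ c ∉ Q ∧ Scattered G (insert c Q)

/-- A configuration of tokens on the vertices outside of an absorbing set, together with a number
of tokens in or next to it, absorbs one of the former tokens through a vertex of `B`. -/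
def Absorb (H : SimpleGraph W) (B : Finset W) (p q : Finset W × ℕ) : Prop :=
  ∃ v ∉ q.1, ∃ b ∈ B, p.1 = insert v q.1 ∧ q.2 = p.2 + 1 ∧ Ind H p.1 ∧ Disjoint p.1 B ∧
    H.Adj v b ∧ ∀ y ∈ q.1, ¬ H.Adj b y

/-- The moves of the configurations of tokens on the vertices outside of an absorbing set. -/
def AbsStep (H : SimpleGraph W) (B : Finset W) (p q : Finset W × ℕ) : Prop :=
  (Step H p.1 q.1 ∧ p.2 = q.2 ∧ Disjoint p.1 B ∧ Disjoint q.1 B) ∨ Absorb H B p q ∨ Absorb H B q p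

variable {G : SimpleGraph V} {H : SimpleGraph W} {C : Finset V} {B : Finset W} {ι : W ↪ V} {k : ℕ}

theorem AbsStep.card_add {p q : Finset W × ℕ} (h : AbsStep H B p q) :
    q.1.card + q.2 = p.1.card + p.2 := by
  rcases h with ⟨h, e, _⟩ | ⟨v, hv, b, hb, e, e', _⟩ | ⟨v, hv, b, hb, e, e', _⟩
  · rw [h.card_eq, e]
  · rw [e, e', card_insert_of_notMem hv]; omega
  · rw [e, e', card_insert_of_notMem hv]; omega

theorem Ind.map (hH : ∀ a b, G.Adj (ι a) (ι b) ↔ H.Adj a b) {Y : Finset W} (hY : Ind H Y) :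
    Ind G (Y.map ι) := by
  intro a ha b hb hab
  rw [mem_map] at ha hb
  obtain ⟨a, ha, rfl⟩ := ha
  obtain ⟨b, hb, rfl⟩ := hb
  exact hY a ha b hb ((hH a b).1 hab)

theorem free_map (hC : ∀ w, ι w ∉ C) (hB : ∀ w, w ∈ B ↔ ∃ c ∈ C, G.Adj (ι w) c)
    {Y : Finset W} (hY : Disjoint Y B) : ∀ c ∈ C, Free G (Y.map ι) c := by
  intro c hc
  refine ⟨fun h => ?_, fun x hx hcx => ?_⟩
  · obtain ⟨w, _, rfl⟩ := mem_map.1 h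
    exact hC w hc
  · obtain ⟨w, hw, rfl⟩ := mem_map.1 hx
    exact disjoint_left.1 hY hw ((hB w).2 ⟨c, hc, hcx.symm⟩)

theorem Ind.union {X Y : Finset V} (hX : Ind G X) (hY : Ind G Y) (h : ∀ x ∈ X, Free G Y x) :
    Ind G (X ∪ Y) := by
  intro a ha b hb hab
  rcases mem_union.1 ha with ha | ha <;> rcases mem_union.1 hb with hb | hb
  · exact hX a ha b hb hab
  · exact (h a ha).2 b hb hab
  · exact (h b hb).2 a ha hab.symm
  · exact hY a ha b hb hab

theorem Free.union {X Y : Finset V} {v : V} (hX : Free G X v) (hY : Free G Y v) :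
    Free G (X ∪ Y) v :=
  ⟨by simp [hX.1, hY.1], fun x hx => (mem_union.1 hx).elim (hX.2 x) (hY.2 x)⟩

/-- The token slides from `v` to the border vertex `b` and on to a vertex `c` of `C`. The
arrangement `Q` from `Absorbing.enter` keeps `b` and `c` free of tokens in `C`. The outer tokens do
not interfere: `Absorb` demands that none of them but `v` is adjacent to `b`, and since they avoid
`B` none is adjacent to `c`. -/
theorem reach_absorb (hH : ∀ a b, G.Adj (ι a) (ι b) ↔ H.Adj a b) (hC : ∀ w, ι w ∉ C)
    (hB : ∀ w, w ∈ B ↔ ∃ c ∈ C, G.Adj (ι w) c) (hA : Absorbing G C k)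
    {p q : Finset W × ℕ} (h : Absorb H B p q) (hk : p.1.card + p.2 = k) :
    ∃ Q ⊆ C, ∃ R ⊆ C, Scattered G Q ∧ Scattered G R ∧ Q.card = p.2 ∧ R.card = q.2 ∧
      Reach G (Q ∪ p.1.map ι) (R ∪ q.1.map ι) := by
  obtain ⟨v, hv, b, hb, e, e', hind, hdisj, hvb, hbY⟩ := h
  have hpk : p.2 < k := by rw [e, card_insert_of_notMem hv] at hk; omega
  obtain ⟨Q, hQC, hQ, hbQ, c, hc, hbc, hcQ, hS⟩ := hA.enter (ι b) (hC b) ((hB b).1 hb) _ hpk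
  have hQS : Scattered G Q := hS.mono (subset_insert _ _)
  have hqp : q.1 ⊆ p.1 := by rw [e]; exact subset_insert _ _
  have hfree := free_map hC hB hdisj
  have hfree' := free_map hC hB (disjoint_of_subset_left hqp hdisj)
  have hindq : Ind H q.1 := fun a ha b hb => hind a (hqp ha) b (hqp hb)
  have hI : Ind G (Q ∪ q.1.map ι) := hQS.ind.union (hindq.map hH) fun x hx => hfree' x (hQC hx)
  have hvp : v ∈ p.1 := by rw [e]; simp
  have hvB : v ∉ B := disjoint_left.1 hdisj hvp
  have hfv : Free G (Q ∪ q.1.map ι) (ι v) := by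
    refine Free.union ⟨fun h => hC v (hQC h), fun x hx hvx => hvB ((hB v).2 ⟨x, hQC hx, hvx⟩)⟩
      ⟨by simpa using hv, fun x hx hvx => ?_⟩
    obtain ⟨w, hw, rfl⟩ := mem_map.1 hx
    exact hind v hvp w (hqp hw) ((hH _ _).1 hvx)
  have hfb : Free G (Q ∪ q.1.map ι) (ι b) := by
    refine hbQ.union ⟨fun h => ?_, fun x hx hbx => ?_⟩
    · rw [mem_map] at h
      obtain ⟨w, hw, e⟩ := h
      rw [ι.injective e] at hw
      exact disjoint_left.1 hdisj (hqp hw) hb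
    · obtain ⟨w, hw, rfl⟩ := mem_map.1 hx
      exact hbY w hw ((hH _ _).1 hbx)
  have hfc : Free G (Q ∪ q.1.map ι) c :=
    Free.union ⟨hcQ, fun x hx => (hS c (by simp) x (by simp [hx]) fun h => hcQ (h ▸ hx)).2.1⟩
      (hfree' c hc)
  refine ⟨Q, hQC, insert c Q, insert_subset hc hQC, hQS, hS, hQ,
    by rw [card_insert_of_notMem hcQ, hQ, e'], ?_⟩
  have h1 := step_insert hI hfv hfb ((hH _ _).2 hvb)
  have h2 := step_insert hI hfb hfc hbc
  rw [e, map_insert, union_insert, insert_union]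
  exact (ReflTransGen.single h1).tail h2

/-- A slide between outer vertices leaves the arrangement in `C` alone. An absorption or a release
works only for a special arrangement in `C`, so the given one is first transformed into it by
`Absorbing.rearrange`. Only such moves need `C` to be absorbing, and they exist only if `B` is not
empty. -/
theorem reach_of_absStep (hH : ∀ a b, G.Adj (ι a) (ι b) ↔ H.Adj a b) (hC : ∀ w, ι w ∉ C)
    (hB : ∀ w, w ∈ B ↔ ∃ c ∈ C, G.Adj (ι w) c) (hA : B.Nonempty → Absorbing G C k)
    {p q : Finset W × ℕ} (h : AbsStep H B p q) (hk : p.1.card + p.2 = k)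
    {Q : Finset V} (hQC : Q ⊆ C) (hQS : Scattered G Q) (hQ : Q.card = p.2) :
    ∃ R ⊆ C, Scattered G R ∧ R.card = q.2 ∧ Reach G (Q ∪ p.1.map ι) (R ∪ q.1.map ι) := by
  have hk' := h.card_add
  rcases h with ⟨h, e, hp, hq⟩ | h | h
  · refine ⟨Q, hQC, hQS, hQ.trans e, .single ?_⟩
    obtain ⟨hi, hi', u, hu, v, hv, huv, e⟩ := h
    refine ⟨hQS.ind.union (hi.map hH) fun x hx => free_map hC hB hp x (hQC hx),
      hQS.ind.union (hi'.map hH) fun x hx => free_map hC hB hq x (hQC hx),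
      ι u, by simp [hu], ι v, ?_, (hH _ _).2 huv, ?_⟩
    · simp only [mem_union, mem_map', not_or]
      exact ⟨fun h => hC v (hQC h), hv⟩
    · rw [e, map_insert, map_erase, union_insert, erase_union_distrib,
        erase_eq_of_notMem fun h => hC u (hQC h)]
  · have hAC := hA (let ⟨_, _, b, hb, _⟩ := h; ⟨b, hb⟩)
    obtain ⟨Q', hQ'C, R, hRC, hQ'S, hRS, hQ', hR, hreach⟩ := reach_absorb hH hC hB hAC h hk
    obtain ⟨v, hv, b, hb, e, e', hind, hdisj, hvb, hbY⟩ := h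
    exact ⟨R, hRC, hRS, hR, (hAC.rearrange _ _ _ (hind.map hH) (free_map hC hB hdisj) hQC hQ'C
      hQS hQ'S (hQ.trans hQ'.symm) (by omega)).trans hreach⟩
  · have hAC := hA (let ⟨_, _, b, hb, _⟩ := h; ⟨b, hb⟩)
    obtain ⟨R, hRC, Q', hQ'C, hRS, hQ'S, hR, hQ', hreach⟩ :=
      reach_absorb hH hC hB hAC h (by omega)
    obtain ⟨v, hv, b, hb, e, e', hind, hdisj, hvb, hbY⟩ := h
    have hsub : p.1 ⊆ q.1 := by rw [e]; exact subset_insert _ _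
    have hindp : Ind H p.1 := fun a ha b hb => hind a (hsub ha) b (hsub hb)
    exact ⟨R, hRC, hRS, hR, (hAC.rearrange _ _ _ (hindp.map hH)
      (free_map hC hB (disjoint_of_subset_left hsub hdisj)) hQC hQ'C
      hQS hQ'S (hQ.trans hQ'.symm) (by omega)).trans hreach.symm⟩

theorem reach_of_absReach (hH : ∀ a b, G.Adj (ι a) (ι b) ↔ H.Adj a b) (hC : ∀ w, ι w ∉ C)
    (hB : ∀ w, w ∈ B ↔ ∃ c ∈ C, G.Adj (ι w) c) (hA : B.Nonempty → Absorbing G C k)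
    {S T : Finset W} (hk : S.card = k) (h : ReflTransGen (AbsStep H B) (S, 0) (T, 0)) :
    Reach G (S.map ι) (T.map ι) := by
  have key : ∀ q, ReflTransGen (AbsStep H B) (S, 0) q → q.1.card + q.2 = k ∧
      ∃ R ⊆ C, Scattered G R ∧ R.card = q.2 ∧ Reach G (S.map ι) (R ∪ q.1.map ι) := by
    intro q h
    induction h with
    | refl => exact ⟨by simpa using hk, ∅, by simp, by simp [Scattered], rfl, by
        rw [empty_union]; exact .refl⟩
    | tail _ h ih =>
      obtain ⟨hc, R, hRC, hRS, hR, hreach⟩ := ih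
      obtain ⟨R', hRC', hRS', hR', hreach'⟩ := reach_of_absStep hH hC hB hA h hc hRC hRS hR
      exact ⟨h.card_add.trans hc, R', hRC', hRS', hR', hreach.trans hreach'⟩
  obtain ⟨_, R, _, _, hR, hreach⟩ := key _ h
  rw [card_eq_zero.1 hR, empty_union] at hreach
  exact hreach

/-! ### Projecting configurations to the vertices outside of an absorbing set and its border -/

open scoped Classical in
/-- The tokens of a configuration that are neither in `C` nor next to it. -/
noncomputable def outer (ι : W ↪ V) (B : Finset W) (X : Finset V) : Finset W :=
  univ.filter fun w => ι w ∈ X ∧ w ∉ B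

theorem mem_outer {X : Finset V} {w : W} : w ∈ outer ι B X ↔ ι w ∈ X ∧ w ∉ B := by
  simp [outer]

theorem card_outer_le {X : Finset V} : (outer ι B X).card ≤ X.card := by
  rw [← card_map ι]
  refine card_le_card fun x hx => ?_
  obtain ⟨w, hw, rfl⟩ := mem_map.1 hx
  exact (mem_outer.1 hw).1

theorem outer_map {S : Finset W} (hS : Disjoint S B) : outer ι B (S.map ι) = S := by
  ext w
  rw [mem_outer]
  simp only [mem_map']
  exact ⟨fun h => h.1, fun h => ⟨h, disjoint_left.1 hS h⟩⟩

theorem ind_outer (hH : ∀ a b, G.Adj (ι a) (ι b) ↔ H.Adj a b) {X : Finset V} (hX : Ind G X) :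
    Ind H (outer ι B X) := fun a ha b hb hab =>
  hX _ (mem_outer.1 ha).1 _ (mem_outer.1 hb).1 ((hH a b).2 hab)

theorem disjoint_outer {X : Finset V} : Disjoint (outer ι B X) B :=
  disjoint_left.2 fun _ h => (mem_outer.1 h).2

/-- An outer token that stops being outer can only have moved to `B`: a vertex outside of `C` with a
neighbour in `C` belongs to `B`, so the token cannot slide into `C` directly. -/
theorem absorb_of_step (hH : ∀ a b, G.Adj (ι a) (ι b) ↔ H.Adj a b)
    (hC : ∀ v, v ∉ C → ∃ w, ι w = v) (hB : ∀ w, w ∈ B ↔ ∃ c ∈ C, G.Adj (ι w) c)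
    {X Y : Finset V} (hX : Ind G X) (hY : Ind G Y) {u : W} {v : V} (hu : ι u ∈ X) (huB : u ∉ B)
    (hv : v ∉ X) (hvo : ∀ w, ι w = v → w ∈ B) (huv : G.Adj (ι u) v)
    (e : Y = insert v (X.erase (ι u))) :
    Absorb H B (outer ι B X, X.card - (outer ι B X).card)
      (outer ι B Y, Y.card - (outer ι B Y).card) := by
  have hvC : v ∉ C := fun h => huB ((hB u).2 ⟨v, h, huv⟩)
  obtain ⟨b, rfl⟩ := hC v hvC
  have hb := hvo b rfl
  have hbu : b ≠ u := fun h => huB (h ▸ hb)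
  have huY : u ∉ outer ι B Y := by
    rw [mem_outer, e]
    simp [hbu.symm]
  have eo : outer ι B X = insert u (outer ι B Y) := by
    ext w
    rw [mem_insert, mem_outer, mem_outer, e]
    by_cases h1 : w = u
    · subst h1; simp [hu, huB]
    · by_cases h2 : w = b
      · subst h2; simp [hb, h1]
      · simp [h1, h2]
  refine ⟨u, huY, b, hb, eo, ?_, ind_outer hH hX, disjoint_outer, (hH _ _).1 huv, ?_⟩
  · have hc : Y.card = X.card :=
      Step.card_eq (G := G) ⟨hX, hY, _, hu, _, hv, huv, e⟩
    have h1 := card_outer_le (ι := ι) (B := B) (X := X)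
    rw [eo, card_insert_of_notMem huY] at h1
    dsimp only
    rw [hc, eo, card_insert_of_notMem huY]
    omega
  · intro y hy hby
    exact hY (ι b) (by simp [e]) (ι y) (mem_outer.1 hy).1 ((hH _ _).2 hby)

/-- Each configuration is projected to its outer tokens and the number of the others. According to
which ends of a slide are outer, it becomes a slide, an absorption, a release, or no move at all.
This direction does not need `C` to be absorbing. -/
theorem absReach_of_reach (hH : ∀ a b, G.Adj (ι a) (ι b) ↔ H.Adj a b)
    (hC : ∀ v, v ∉ C → ∃ w, ι w = v) (hB : ∀ w, w ∈ B ↔ ∃ c ∈ C, G.Adj (ι w) c)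
    {S T : Finset W} (hS : Disjoint S B) (hT : Disjoint T B)
    (h : Reach G (S.map ι) (T.map ι)) : ReflTransGen (AbsStep H B) (S, 0) (T, 0) := by
  have key : ∀ X Y, Step G X Y → ReflTransGen (AbsStep H B)
      (outer ι B X, X.card - (outer ι B X).card) (outer ι B Y, Y.card - (outer ι B Y).card) := by
    intro X Y h
    have hcard := h.card_eq
    obtain ⟨hX, hY, u, hu, v, hv, huv, e⟩ := h
    have huY : u ∉ Y := by simp [e, huv.ne]
    have hvY : v ∈ Y := by simp [e]
    have e' : X = insert u (Y.erase v) := by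
      ext w
      rw [e]
      simp only [mem_insert, mem_erase]
      by_cases h1 : w = u <;> by_cases h2 : w = v <;> simp_all
    by_cases hou : ∃ w, ι w = u ∧ w ∉ B <;> by_cases hov : ∃ w, ι w = v ∧ w ∉ B
    · obtain ⟨u, rfl, huB⟩ := hou
      obtain ⟨v, rfl, hvB⟩ := hov
      have hvX : v ∉ outer ι B X := fun h => hv (mem_outer.1 h).1
      have hstep : Step H (outer ι B X) (outer ι B Y) := by
        refine ⟨ind_outer hH hX, ind_outer hH hY, u, mem_outer.2 ⟨hu, huB⟩, v, hvX,
          (hH _ _).1 huv, ?_⟩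
        ext w
        rw [mem_insert, mem_erase, mem_outer, mem_outer, e, mem_insert, mem_erase,
          ι.injective.eq_iff, ι.injective.ne_iff]
        by_cases h1 : w = v
        · subst h1; simp [hvB]
        · simp only [h1, false_or]; tauto
      refine .single (.inl ⟨hstep, ?_, disjoint_outer, disjoint_outer⟩)
      dsimp only
      rw [hcard, hstep.card_eq]
    · obtain ⟨u, rfl, huB⟩ := hou
      push Not at hov
      exact .single (.inr (.inl (absorb_of_step hH hC hB hX hY hu huB hv hov huv e)))
    · obtain ⟨v, rfl, hvB⟩ := hov
      push Not at hou
      exact .single (.inr (.inr (absorb_of_step hH hC hB hY hX hvY hvB huY hou huv.symm e')))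
    · have eo : outer ι B X = outer ι B Y := by
        ext w
        rw [mem_outer, mem_outer, e, mem_insert, mem_erase]
        by_cases hw : w ∈ B
        · simp [hw]
        · have h1 : ι w ≠ u := fun h => hou ⟨w, h, hw⟩
          have h2 : ι w ≠ v := fun h => hov ⟨w, h, hw⟩
          simp [h1, h2]
      rw [eo, hcard]
  have h1 : ∀ X Y, Reach G X Y → ReflTransGen (AbsStep H B)
      (outer ι B X, X.card - (outer ι B X).card) (outer ι B Y, Y.card - (outer ι B Y).card) := by
    intro X Y h
    induction h with
    | refl => exact .refl
    | tail _ h ih => exact ih.trans (key _ _ h)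
  have := h1 _ _ h
  rwa [outer_map hS, outer_map hT, card_map, card_map, Nat.sub_self, Nat.sub_self] at this

/-- Token Sliding between configurations away from an absorbing set depends only on the graph
outside of this set and on the vertices through which the set can be entered. -/
theorem reach_iff_of_absorbing {V' : Type} [DecidableEq V'] {G' : SimpleGraph V'} {C' : Finset V'}
    {ι' : W ↪ V'} (hH : ∀ a b, G.Adj (ι a) (ι b) ↔ G'.Adj (ι' a) (ι' b))
    (hC : ∀ v, v ∈ C ↔ ∀ w, ι w ≠ v) (hC' : ∀ v, v ∈ C' ↔ ∀ w, ι' w ≠ v)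
    (hB : ∀ w, w ∈ B ↔ ∃ c ∈ C, G.Adj (ι w) c) (hB' : ∀ w, w ∈ B ↔ ∃ c ∈ C', G'.Adj (ι' w) c)
    {S T : Finset W} (hS : Disjoint S B) (hT : Disjoint T B)
    (hA : B.Nonempty → Absorbing G C S.card) (hA' : B.Nonempty → Absorbing G' C' S.card) :
    Reach G' (S.map ι') (T.map ι') ↔ Reach G (S.map ι) (T.map ι) := by
  have h1 : ∀ w, ι w ∉ C := fun w h => (hC _).1 h w rfl
  have h1' : ∀ w, ι' w ∉ C' := fun w h => (hC' _).1 h w rfl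
  have h2 : ∀ v, v ∉ C → ∃ w, ι w = v := fun v hv => by simpa [hC] using hv
  have h2' : ∀ v, v ∉ C' → ∃ w, ι' w = v := fun v hv => by simpa [hC'] using hv
  have e : ∀ a b, G.Adj (ι a) (ι b) ↔ (G.comap ι).Adj a b := fun _ _ => Iff.rfl
  have e' : ∀ a b, G'.Adj (ι' a) (ι' b) ↔ (G.comap ι).Adj a b := fun a b => (hH a b).symm
  exact ⟨fun h => reach_of_absReach e h1 hB hA rfl (absReach_of_reach e' h2' hB' hS hT h),
    fun h => reach_of_absReach e' h1' hB' hA' rfl (absReach_of_reach e h2 hB hS hT h)⟩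

end Absorb
end Sliding

namespace Sliding
open Relation Finset
set_option linter.unusedSectionVars false

/-! ### Large connected sets in graphs of bounded degree -/

section Large
variable {V : Type} [DecidableEq V] [Fintype V] {G : SimpleGraph V}

open scoped Classical in
/-- The closed neighbourhood of a vertex. -/
noncomputable def nbhd (G : SimpleGraph V) (v : V) : Finset V :=
  univ.filter fun w => w = v ∨ G.Adj v w

theorem mem_nbhd {v w : V} : w ∈ nbhd G v ↔ w = v ∨ G.Adj v w := by simp [nbhd]

/-- A vertex that is not far from `x` has distance at most two from it, so it lies in the
neighbourhood of a neighbourhood. -/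
theorem card_not_far_le {D : ℕ} (hD : ∀ v, (nbhd G v).card ≤ D) (X : Finset V) :
    (X.biUnion fun x => (nbhd G x).biUnion (nbhd G)).card ≤ X.card * (D * D) := by
  refine card_biUnion_le_card_mul _ _ _ fun x _ => ?_
  exact (card_biUnion_le_card_mul _ _ D fun y _ => hD y).trans (Nat.mul_le_mul_right _ (hD x))

theorem exists_far {D : ℕ} (hD : ∀ v, (nbhd G v).card ≤ D) {C X : Finset V}
    (h : X.card * (D * D) < C.card) : ∃ z ∈ C, ∀ x ∈ X, Far G x z := by
  obtain ⟨z, hz, hz'⟩ := exists_mem_notMem_of_card_lt_card ((card_not_far_le hD X).trans_lt h)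
  refine ⟨z, hz, fun x hx => ?_⟩
  simp only [mem_biUnion, mem_nbhd, not_exists, not_and, not_or] at hz'
  have := hz' x hx
  exact ⟨fun h => (this x (.inl rfl)).1 h.symm, fun h => (this x (.inl rfl)).2 h,
    fun c hc hcz => (this c (.inr hc.symm)).2 hcz⟩

/-- Greedy choice: every vertex that has to be avoided, whether given or already chosen, excludes at
most `D * D` vertices. -/
theorem exists_scattered {D : ℕ} (hD : ∀ v, (nbhd G v).card ≤ D) (h0 : 1 ≤ D) {C X : Finset V}
    (m : ℕ) (h : (X.card + m) * (D * D) ≤ C.card) :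
    ∃ Z ⊆ C, Z.card = m ∧ Scattered G Z ∧ ∀ x ∈ X, ∀ z ∈ Z, Far G x z := by
  induction m with
  | zero => exact ⟨∅, by simp, by simp, by simp [Scattered], by simp⟩
  | succ m ih =>
    have hDD : 1 ≤ D * D := Nat.mul_pos h0 h0
    have e : (X.card + (m + 1)) * (D * D) = (X.card + m) * (D * D) + D * D := by ring
    obtain ⟨Z, hZC, hZ, hS, hX⟩ := ih (by omega)
    have hc : (X ∪ Z).card * (D * D) < C.card := by
      have := Nat.mul_le_mul_right (D * D) (card_union_le X Z)
      rw [hZ] at this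
      omega
    obtain ⟨z, hz, hfar⟩ := exists_far hD hc
    have hzZ : z ∉ Z := fun h => (hfar z (by simp [h])).1 rfl
    refine ⟨insert z Z, insert_subset hz hZC, by rw [card_insert_of_notMem hzZ, hZ], ?_, ?_⟩
    · intro x hx y hy hxy
      rcases mem_insert.1 hx with rfl | hx' <;> rcases mem_insert.1 hy with rfl | hy'
      · exact absurd rfl hxy
      · exact (hfar y (by simp [hy'])).symm
      · exact hfar x (by simp [hx'])
      · exact hS x hx' y hy' hxy
    · intro x hx y hy
      rcases mem_insert.1 hy with rfl | hy
      · exact hfar x (by simp [hx])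
      · exact hX x hx y hy

/-- Large connected sets of vertices are absorbing. -/
theorem Conn.absorbing {C : Finset V} {k D : ℕ} (hC : Conn G C)
    (hD : ∀ v, (nbhd G v).card ≤ D) (h0 : 1 ≤ D) (hk : 1 ≤ k)
    (h : 4 * k * (D * D * D) ≤ C.card) : Absorbing G C k := by
  constructor
  · intro Y Q R hY hCY hQC hRC hQ hR hQR hQk
    -- `Q ∪ R` need not be scattered, so the tokens pass through a third set `Z` that is far from
    -- both. At most `3 * k` positions are involved.
    have hcard : ((Q ∪ R).card + Q.card) * (D * D) ≤ C.card := by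
      have h1 : (Q ∪ R).card + Q.card ≤ 3 * k := by
        have := card_union_le Q R
        omega
      calc _ ≤ 3 * k * (D * D) := Nat.mul_le_mul_right _ h1
        _ ≤ 4 * k * (D * D * D) := by
          have : D * D * 1 ≤ D * D * D := Nat.mul_le_mul_left _ h0
          rw [mul_one] at this
          exact Nat.mul_le_mul (by omega) this
        _ ≤ _ := h
    obtain ⟨Z, hZC, hZ, hZS, hfar⟩ := exists_scattered hD h0 _ hcard
    have key : ∀ P ⊆ Q ∪ R, Scattered G P → Scattered G (P ∪ Z) := by
      intro P hP hPS x hx y hy hxy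
      rcases mem_union.1 hx with hx | hx <;> rcases mem_union.1 hy with hy | hy
      · exact hPS x hx y hy hxy
      · exact hfar x (hP hx) y hy
      · exact (hfar y (hP hy) x hx).symm
      · exact hZS x hx y hy hxy
    exact (reach_of_scattered_union hY hCY hC hQC hZC hZ.symm
      (key Q subset_union_left hQ)).trans (reach_of_scattered_union hY hCY hC hRC hZC
      (by omega) (key R subset_union_right hR)).symm
  · rintro b hb ⟨c, hc, hbc⟩ m hm
    -- The arrangement is chosen far from the entire closed neighbourhood of `b`, and so from both
    -- `b` and `c`. This accounts for the third factor `D` in the size of `C`.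
    have hcard : ((nbhd G b).card + m) * (D * D) ≤ C.card := by
      have h1 : (nbhd G b).card + m ≤ 2 * k * D := by
        have h2 : 1 * D ≤ k * D := Nat.mul_le_mul_right _ hk
        have h3 : k * 1 ≤ k * D := Nat.mul_le_mul_left _ h0
        have h4 : 2 * k * D = k * D + k * D := by ring
        have := hD b
        omega
      calc _ ≤ 2 * k * D * (D * D) := Nat.mul_le_mul_right _ h1
        _ = 2 * k * (D * D * D) := by ring
        _ ≤ 4 * k * (D * D * D) := Nat.mul_le_mul_right _ (by omega)
        _ ≤ _ := h
    obtain ⟨Q, hQC, hQ, hQS, hfar⟩ := exists_scattered hD h0 _ hcard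
    have hcb : c ∈ nbhd G b := mem_nbhd.2 (.inr hbc)
    have hbb : b ∈ nbhd G b := mem_nbhd.2 (.inl rfl)
    refine ⟨Q, hQC, hQ, ⟨fun h => (hfar b hbb b h).1 rfl, fun x hx => (hfar b hbb x hx).2.1⟩,
      c, hc, hbc, fun h => (hfar c hcb c h).1 rfl, ?_⟩
    intro x hx y hy hxy
    rcases mem_insert.1 hx with rfl | hx' <;> rcases mem_insert.1 hy with rfl | hy'
    · exact absurd rfl hxy
    · exact hfar _ hcb y hy'
    · exact (hfar _ hcb x hx').symm
    · exact hQS x hx' y hy' hxy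

end Large
end Sliding

/-! ## The kernelization, as a function on raw instances -/

/-- The data of an instance: the number of tokens, the rows of the adjacency matrix, and the
characteristic vectors of the two configurations. -/
abbrev Raw := ℕ × List (List Bool) × List Bool × List Bool

namespace Raw

/-- the number of vertices -/
def order (r : Raw) : ℕ := r.2.1.length

/-- adjacency of two vertices -/
def adj (r : Raw) (i j : ℕ) : Bool := (r.2.1.getD i []).getD j false

/-- whether a vertex carries a token of one of the two configurations -/
def token (r : Raw) (i : ℕ) : Bool := r.2.2.1.getD i false || r.2.2.2.getD i false

/-- whether a vertex carries a token or is adjacent to one -/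
def near (r : Raw) (i : ℕ) : Bool :=
  token r i || (List.range r.order).any fun j => token r j && adj r i j

/-- the degree of a vertex -/
def deg (r : Raw) (i : ℕ) : ℕ := ((List.range r.order).filter fun j => adj r i j).length

/-- the maximum size of a closed neighbourhood -/
def width (r : Raw) : ℕ := (List.range r.order).foldl (fun d i => max d (deg r i + 1)) 1

/-- the number of vertices from which on a connected set is absorbing -/
def threshold (r : Raw) : ℕ := 4 * r.1 * (width r * width r * width r)

/-- the vertices of the bipartite double cover -/
def cover (r : Raw) : List (ℕ × Bool) :=
  (List.range r.order).flatMap fun i => [(i, false), (i, true)]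

/-- one round of a search in the double cover of the graph on the vertices that are not near -/
def round (r : Raw) (R : List (ℕ × Bool)) : List (ℕ × Bool) :=
  (cover r).filter fun p => R.any fun q => (decide (q.1 = p.1) && decide (q.2 = p.2)) ||
    (!near r p.1 && (adj r p.1 q.1 && !decide (q.2 = p.2)))

/-- what can be reached from a vertex in the double cover -/
def reach (r : Raw) (v : ℕ) : List (ℕ × Bool) := (round r)^[r.order] [(v, false)]

/-- the component of a vertex in the graph on the vertices that are not near -/
def comp (r : Raw) (v : ℕ) : List ℕ :=
  (List.range r.order).filter fun w => (reach r v).any fun q => decide (q.1 = w)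

/-- the vertices next to the component of `v` -/
def border (r : Raw) (v : ℕ) : List ℕ :=
  (List.range r.order).filter fun b => near r b && (comp r v).any fun c => adj r b c

/-- the colour of the vertices of the component of `v` to which `b` is adjacent -/
def colour (r : Raw) (v b : ℕ) : Bool := (reach r v).any fun q => adj r b q.1 && q.2

/-- The vertices of the path that replaces a component are described by pairs: `(0, e)` is a vertex
of colour `e`, and `(b + 1, e)` a vertex of colour `e` that is adjacent to `b`. -/
def filler (g : List (ℕ × Bool)) : List (ℕ × Bool) := (0, !(g.headD (0, false)).2) :: g

/-- extend the path by a vertex that is adjacent to `b` -/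
def attach (r : Raw) (v : ℕ) (g : List (ℕ × Bool)) (b : ℕ) : List (ℕ × Bool) :=
  if decide ((g.headD (0, false)).2 = colour r v b) then (b + 1, colour r v b) :: filler g
  else (b + 1, colour r v b) :: g

/-- the path that replaces the component of `v` -/
def gadget (r : Raw) (v : ℕ) : List (ℕ × Bool) :=
  if (border r v).isEmpty then [] else
    (border r v).tail.foldl (attach r v)
      (filler^[threshold r] [((border r v).headD 0 + 1, colour r v ((border r v).headD 0))])

/-- the vertices outside of the component of `v` -/
def kept (r : Raw) (v : ℕ) : List ℕ :=
  (List.range r.order).filter fun w => !(comp r v).any fun c => decide (c = w)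

/-- the instance in which the component of `v` is replaced by its path -/
def replace (r : Raw) (v : ℕ) : Raw :=
  (r.1,
   ((kept r v).map fun i => ((kept r v).map fun j => adj r i j) ++
      (gadget r v).map fun p => decide (p.1 = i + 1)) ++
    (List.range (gadget r v).length).map fun i =>
      ((kept r v).map fun j => decide (((gadget r v).getD i (0, false)).1 = j + 1)) ++
      (List.range (gadget r v).length).map fun j => decide (i + 1 = j) || decide (j + 1 = i),
   ((kept r v).map fun i => r.2.2.1.getD i false) ++ (gadget r v).map fun _ => false,
   ((kept r v).map fun i => r.2.2.2.getD i false) ++ (gadget r v).map fun _ => false)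

/-- the vertices of the components that are larger than the paths that could replace them -/
def large (r : Raw) : List ℕ :=
  (List.range r.order).filter fun v =>
    !near r v && decide ((gadget r v).length + 1 ≤ (comp r v).length)

/-- replace one of the components that are too large, if there is one -/
def shrink (r : Raw) : Raw :=
  if (large r).isEmpty then r else replace r ((large r).headD 0)

/-- the kernel -/
def kernel (r : Raw) : Raw := shrink^[r.order] r

end Raw

/-! ## The kernelization runs in polynomial time -/

/-- A raw instance that is computed in polynomial time and has polynomial size. -/
structure RawCtx {α : Type} [TEnc α] (Γ : α → ℕ → Prop) (r : α → Raw) : Prop where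
  poly : PolyTime Γ r
  order : PolyBdd Γ fun a => (r a).order
  tokens : PolyBdd Γ fun a => (r a).1

/-- A number that is computed in polynomial time and is polynomially bounded. -/
structure NatCtx {α : Type} [TEnc α] (Γ : α → ℕ → Prop) (i : α → ℕ) : Prop where
  poly : PolyTime Γ i
  bdd : PolyBdd Γ i

/-- A list that is computed in polynomial time, with a polynomial bound on its length and
on the sizes `s` of its elements. -/
structure ListCtx {α β : Type} [TEnc α] [TEnc β] (s : β → ℕ) (Γ : α → ℕ → Prop) (L : α → List β) :
    Prop where
  poly : PolyTime Γ L
  length : PolyBdd Γ fun a => (L a).length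
  elt : PolyBdd (fun p N => Γ p.1 N ∧ p.2 ∈ L p.1) fun p : α × β => s p.2

/-! ### Closure properties of efficiently computable instances, numbers and lists -/

section Ctx
variable {α β γ : Type} [TEnc α] [TEnc β] [TEnc γ] {Γ : α → ℕ → Prop} {r : α → Raw} {i j : α → ℕ}
  {Γ' : β → ℕ → Prop} {f : β → α}

theorem RawCtx.comp (hr : RawCtx Γ r) (hf : PolyTime Γ' f) (h : ∀ b N, Γ' b N → Γ (f b) N) :
    RawCtx Γ' fun b => r (f b) :=
  ⟨hr.poly.comp hf h, hr.order.comp h, hr.tokens.comp h⟩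

theorem NatCtx.comp (hi : NatCtx Γ i) (hf : PolyTime Γ' f) (h : ∀ b N, Γ' b N → Γ (f b) N) :
    NatCtx Γ' fun b => i (f b) :=
  ⟨hi.poly.comp hf h, hi.bdd.comp h⟩

theorem ListCtx.comp {s : γ → ℕ} {L : α → List γ} (hL : ListCtx s Γ L) (hf : PolyTime Γ' f)
    (h : ∀ b N, Γ' b N → Γ (f b) N) : ListCtx s Γ' fun b => L (f b) :=
  ⟨hL.poly.comp hf h, hL.length.comp h,
    hL.elt.comp (i := fun p : β × γ => (f p.1, p.2)) fun _ _ hp => ⟨h _ _ hp.1, hp.2⟩⟩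

theorem RawCtx.fst {Γ' : α × γ → ℕ → Prop} (hr : RawCtx Γ r) (h : ∀ p N, Γ' p N → Γ p.1 N) :
    RawCtx Γ' fun p => r p.1 := hr.comp PolyTime.id'.fst h

theorem NatCtx.fst {Γ' : α × γ → ℕ → Prop} (hi : NatCtx Γ i) (h : ∀ p N, Γ' p N → Γ p.1 N) :
    NatCtx Γ' fun p => i p.1 := hi.comp PolyTime.id'.fst h

theorem ListCtx.fst {δ : Type} [TEnc δ] {s : δ → ℕ} {L : α → List δ} {Γ' : α × γ → ℕ → Prop}
    (hL : ListCtx s Γ L) (h : ∀ p N, Γ' p N → Γ p.1 N) :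
    ListCtx s Γ' fun p => L p.1 := hL.comp PolyTime.id'.fst h

theorem NatCtx.succ (hi : NatCtx Γ i) : NatCtx Γ fun a => i a + 1 :=
  ⟨hi.poly.succ, hi.bdd.add (.const 1)⟩

theorem NatCtx.eq (hi : NatCtx Γ i) (hj : NatCtx Γ j) : PolyTime Γ fun a => decide (i a = j a) :=
  hi.poly.natEq hj.poly hi.bdd hj.bdd

theorem NatCtx.mul (hi : NatCtx Γ i) (hj : NatCtx Γ j) : NatCtx Γ fun a => i a * j a :=
  ⟨hi.poly.mul hj.poly hi.bdd hj.bdd, hi.bdd.mul hj.bdd⟩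

theorem NatCtx.const (n : ℕ) : NatCtx Γ fun _ => n := ⟨.natConst n, .const n⟩

theorem ListCtx.range (hi : NatCtx Γ i) : ListCtx id Γ fun a => List.range (i a) :=
  ⟨hi.poly.range hi.bdd, by simpa using hi.bdd,
    (hi.bdd.comp (i := Prod.fst) fun _ _ h => h.1).mono fun p N h => by
      simpa using (List.mem_range.1 h.2).le⟩

theorem ListCtx.of_subset {s : γ → ℕ} {L M : α → List γ} (hL : ListCtx s Γ L)
    (hM : PolyTime Γ M) (hlen : PolyBdd Γ fun a => (M a).length) (h : ∀ a, M a ⊆ L a) :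
    ListCtx s Γ M :=
  ⟨hM, hlen, hL.elt.weaken fun _ _ hp => ⟨hp.1, h _ hp.2⟩⟩

theorem ListCtx.filter {s : γ → ℕ} {L : α → List γ} {f : α → γ → Bool} (hL : ListCtx s Γ L)
    (hf : PolyTime (fun p N => Γ p.1 N ∧ p.2 ∈ L p.1) fun p : α × γ => f p.1 p.2) :
    ListCtx s Γ fun a => (L a).filter (f a) :=
  hL.of_subset (hL.poly.filter hL.length hf) (hL.length.mono fun _ _ _ => List.length_filter_le ..)
    fun _ => List.filter_subset_self _

theorem ListCtx.any {s : γ → ℕ} {L : α → List γ} {f : α → γ → Bool} (hL : ListCtx s Γ L)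
    (hf : PolyTime (fun p N => Γ p.1 N ∧ p.2 ∈ L p.1) fun p : α × γ => f p.1 p.2) :
    PolyTime Γ fun a => (L a).any (f a) := hL.poly.any hL.length hf

theorem ListCtx.map {s : γ → ℕ} {L : α → List γ} {f : α → γ → β} (hL : ListCtx s Γ L)
    (hf : PolyTime (fun p N => Γ p.1 N ∧ p.2 ∈ L p.1) fun p : α × γ => f p.1 p.2) :
    PolyTime Γ fun a => (L a).map (f a) := hL.poly.map hL.length hf

theorem ListCtx.nat_length {s : γ → ℕ} {L : α → List γ} (hL : ListCtx s Γ L) :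
    NatCtx Γ fun a => (L a).length := ⟨hL.poly.length hL.length, hL.length⟩

theorem ListCtx.mem {L : α → List ℕ} (hL : ListCtx id Γ L) :
    NatCtx (fun p N => Γ p.1 N ∧ p.2 ∈ L p.1) fun p : α × ℕ => p.2 :=
  ⟨PolyTime.id'.snd, hL.elt⟩

theorem ListCtx.mem_fst {L : α → List (ℕ × Bool)} (hL : ListCtx Prod.fst Γ L) :
    NatCtx (fun p N => Γ p.1 N ∧ p.2 ∈ L p.1) fun p : α × (ℕ × Bool) => p.2.1 :=
  ⟨PolyTime.id'.snd.fst, hL.elt⟩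

theorem ListCtx.headD {L : α → List ℕ} (hL : ListCtx id Γ L) :
    NatCtx Γ fun a => (L a).headD 0 := by
  refine ⟨hL.poly.headD .zero, ?_⟩
  obtain ⟨q, hq⟩ := hL.elt
  refine ⟨q, fun a N ha => ?_⟩
  change (L a).headD 0 ≤ _
  cases h : L a with
  | nil => simp
  | cons x l => exact hq (a, x) N ⟨ha, by simp [h]⟩

theorem ListCtx.tail {s : γ → ℕ} {L : α → List γ} (hL : ListCtx s Γ L) :
    ListCtx s Γ fun a => (L a).tail :=
  hL.of_subset hL.poly.tail (hL.length.mono fun _ _ _ => by simp) fun _ => List.tail_subset _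

end Ctx

namespace Raw

/-! ### Bounds -/

theorem deg_le (r : Raw) (i : ℕ) : deg r i ≤ r.order :=
  (List.length_filter_le ..).trans (by simp)

theorem width_le (r : Raw) : width r ≤ r.order + 1 := by
  unfold width
  have : ∀ (l : List ℕ) d, d ≤ r.order + 1 →
      l.foldl (fun d i => max d (deg r i + 1)) d ≤ r.order + 1 := by
    intro l
    induction l with
    | nil => exact fun d hd => hd
    | cons i l ih => exact fun d hd => ih _ (max_le hd (by have := deg_le r i; omega))
  exact this _ _ (by omega)

theorem mem_cover {r : Raw} {p : ℕ × Bool} : p ∈ cover r ↔ p.1 < r.order := by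
  obtain ⟨i, e⟩ := p
  unfold cover
  cases e <;> simp

theorem length_cover (r : Raw) : (cover r).length = 2 * r.order := by
  simp [cover, List.length_flatMap, mul_comm]

/-- After at least one round the list is a sublist of the double cover. The slack `+ 1` and `+ v` is
for round zero, where `v` need not be a vertex. The bounds are uniform in the number of rounds, as
the timing of the iteration requires. -/
theorem reach_bound (r : Raw) (v n : ℕ) : ((round r)^[n] [(v, false)]).length ≤ 2 * r.order + 1 ∧
    ∀ p ∈ (round r)^[n] [(v, false)], p.1 ≤ r.order + v := by
  cases n with
  | zero => simp
  | succ n =>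
    rw [Function.iterate_succ_apply']
    refine ⟨?_, fun p hp => ?_⟩
    · have := length_cover r
      exact (List.length_filter_le ..).trans (by omega)
    · have := mem_cover.1 (List.mem_of_mem_filter hp)
      omega

theorem length_filler (g : List (ℕ × Bool)) : (filler g).length = g.length + 1 := rfl

theorem length_iterate_filler (n : ℕ) (g : List (ℕ × Bool)) :
    (filler^[n] g).length = g.length + n := by
  induction n with
  | zero => rfl
  | succ n ih => rw [Function.iterate_succ_apply', length_filler, ih]; rfl

theorem mem_iterate_filler {n : ℕ} {g : List (ℕ × Bool)} {p : ℕ × Bool} (h : p ∈ filler^[n] g) :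
    p.1 = 0 ∨ p ∈ g := by
  induction n with
  | zero => exact .inr h
  | succ n ih =>
    rw [Function.iterate_succ_apply'] at h
    rcases List.mem_cons.1 h with rfl | h
    · exact .inl rfl
    · exact ih h

theorem mem_attach {r : Raw} {v b : ℕ} {g : List (ℕ × Bool)} {p : ℕ × Bool}
    (h : p ∈ attach r v g b) : p.1 = 0 ∨ p = (b + 1, colour r v b) ∨ p ∈ g := by
  unfold attach filler at h
  split at h <;> simp only [List.mem_cons] at h
  · rcases h with h | rfl | h
    · exact .inr (.inl h)
    · exact .inl rfl
    · exact .inr (.inr h)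
  · exact .inr h

theorem length_attach_le (r : Raw) (v b : ℕ) (g : List (ℕ × Bool)) :
    (attach r v g b).length ≤ g.length + 2 := by
  unfold attach filler
  split <;> simp

theorem length_attach_ge (r : Raw) (v b : ℕ) (g : List (ℕ × Bool)) :
    g.length + 1 ≤ (attach r v g b).length := by
  unfold attach filler
  split <;> simp

theorem gadget_nil {r : Raw} {v : ℕ} (h : border r v = []) : gadget r v = [] := by
  simp [gadget, h]

theorem gadget_cons {r : Raw} {v b : ℕ} {l : List ℕ} (h : border r v = b :: l) :
    gadget r v = l.foldl (attach r v) (filler^[threshold r] [(b + 1, colour r v b)]) := by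
  simp [gadget, h]

theorem mem_gadget {r : Raw} {v : ℕ} {p : ℕ × Bool} (h : p ∈ gadget r v) :
    p.1 = 0 ∨ ∃ b ∈ border r v, p = (b + 1, colour r v b) := by
  cases hb : border r v with
  | nil => simp [gadget_nil hb] at h
  | cons b l =>
    rw [gadget_cons hb] at h
    have key : ∀ (l : List ℕ) g, p ∈ l.foldl (attach r v) g →
        p.1 = 0 ∨ (∃ b ∈ l, p = (b + 1, colour r v b)) ∨ p ∈ g := by
      intro l
      induction l with
      | nil => exact fun g h => .inr (.inr h)
      | cons c l ih =>
        intro g h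
        rcases ih _ h with h | ⟨b, hb, h⟩ | h
        · exact .inl h
        · exact .inr (.inl ⟨b, by simp [hb], h⟩)
        · rcases mem_attach h with h | h | h
          · exact .inl h
          · exact .inr (.inl ⟨c, by simp, h⟩)
          · exact .inr (.inr h)
    rcases key l _ h with h | ⟨c, hc, h⟩ | h
    · exact .inl h
    · exact .inr ⟨c, by simp [hc], h⟩
    · rcases mem_iterate_filler h with h | h
      · exact .inl h
      · exact .inr ⟨b, by simp, by simpa using h⟩

/-- The first border vertex contributes one path vertex, followed by `threshold` fillers; each
further border vertex contributes one vertex and possibly a filler that corrects the colour. -/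
theorem length_gadget_le (r : Raw) (v : ℕ) :
    (gadget r v).length ≤ threshold r + 2 * (border r v).length := by
  cases hb : border r v with
  | nil => simp [gadget_nil hb]
  | cons b l =>
    rw [gadget_cons hb]
    have key : ∀ (l : List ℕ) g, (l.foldl (attach r v) g).length ≤ g.length + 2 * l.length := by
      intro l
      induction l with
      | nil => simp
      | cons c l ih =>
        intro g
        have h1 := ih (attach r v g c)
        have h2 := length_attach_le r v c g
        simp only [List.foldl_cons, List.length_cons]
        omega
    have := key l (filler^[threshold r] [(b + 1, colour r v b)])
    rw [length_iterate_filler] at this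
    simp only [List.length_cons, List.length_nil] at this ⊢
    omega

theorem length_gadget_ge {r : Raw} {v : ℕ} (h : border r v ≠ []) :
    threshold r ≤ (gadget r v).length := by
  cases hb : border r v with
  | nil => exact absurd hb h
  | cons b l =>
    rw [gadget_cons hb]
    have key : ∀ (l : List ℕ) g, g.length ≤ (l.foldl (attach r v) g).length := by
      intro l
      induction l with
      | nil => simp
      | cons c l ih =>
        intro g
        have h1 := ih (attach r v g c)
        have h2 := length_attach_ge r v c g
        simp only [List.foldl_cons]
        omega
    have := key l (filler^[threshold r] [(b + 1, colour r v b)])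
    rw [length_iterate_filler] at this
    omega

theorem mem_border_lt {r : Raw} {v b : ℕ} (h : b ∈ border r v) : b < r.order :=
  List.mem_range.1 (List.mem_of_mem_filter h)

theorem length_kept_add (r : Raw) (v : ℕ) :
    (kept r v).length + (comp r v).length = r.order := by
  have h : kept r v = (List.range r.order).filter
      fun w => !((reach r v).any fun q => decide (q.1 = w)) := by
    refine List.filter_congr fun w hw => ?_
    congr 1
    rw [Bool.eq_iff_iff]
    simp [comp, List.mem_range.1 hw]
  have h2 := List.length_eq_length_filter_add (l := List.range r.order)
    fun w => (reach r v).any fun q => decide (q.1 = w)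
  rw [List.length_range] at h2
  rw [h, comp]
  omega

theorem order_replace (r : Raw) (v : ℕ) :
    (replace r v).order = (kept r v).length + (gadget r v).length := by
  simp only [replace, order, List.length_append, List.length_map, List.length_range]

theorem mem_large {r : Raw} {v : ℕ} : v ∈ large r ↔ v < r.order ∧ near r v = false ∧
    (gadget r v).length < (comp r v).length := by
  simp [large]

theorem shrink_fst (r : Raw) : (shrink r).1 = r.1 := by
  unfold shrink
  split <;> rfl

/-- The vertices of a component are traded for a strictly shorter path; this makes the number of
vertices the termination measure. -/
theorem order_shrink_lt {r : Raw} (h : large r ≠ []) : (shrink r).order < r.order := by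
  obtain ⟨v, l, hl⟩ := List.exists_cons_of_ne_nil h
  have hv : v ∈ large r := by simp [hl]
  have := (mem_large.1 hv).2.2
  have := length_kept_add r v
  have e : shrink r = replace r v := by simp [shrink, hl]
  rw [e, order_replace]
  omega

theorem shrink_eq_self {r : Raw} (h : large r = []) : shrink r = r := by simp [shrink, h]

theorem order_shrink_le (r : Raw) : (shrink r).order ≤ r.order := by
  by_cases h : large r = []
  · rw [shrink_eq_self h]
  · exact (order_shrink_lt h).le

/-! ### Running times -/

section Time
variable {α : Type} [TEnc α] {Γ : α → ℕ → Prop} {r : α → Raw} {i j : α → ℕ}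

theorem nat_order (hr : RawCtx Γ r) : NatCtx Γ fun a => (r a).order :=
  ⟨hr.poly.snd.fst.length hr.order, hr.order⟩

theorem poly_adj (hr : RawCtx Γ r) (hi : NatCtx Γ i) (hj : NatCtx Γ j) :
    PolyTime Γ fun a => adj (r a) (i a) (j a) :=
  (hr.poly.snd.fst.getD .nil hi.poly hi.bdd).getD .false hj.poly hj.bdd

theorem poly_token (hr : RawCtx Γ r) (hi : NatCtx Γ i) : PolyTime Γ fun a => token (r a) (i a) :=
  (hr.poly.snd.snd.fst.getD .false hi.poly hi.bdd).or (hr.poly.snd.snd.snd.getD .false hi.poly hi.bdd)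

theorem list_vertices (hr : RawCtx Γ r) : ListCtx id Γ fun a => List.range (r a).order :=
  .range (nat_order hr)

theorem poly_near (hr : RawCtx Γ r) (hi : NatCtx Γ i) : PolyTime Γ fun a => near (r a) (i a) :=
  (poly_token hr hi).or <| (list_vertices hr).any <|
    have hr' := hr.fst fun _ _ h => h.1
    have hj := (list_vertices hr).mem
    (poly_token hr' hj).and (poly_adj hr' (hi.fst fun _ _ h => h.1) hj)

theorem nat_deg (hr : RawCtx Γ r) (hi : NatCtx Γ i) : NatCtx Γ fun a => deg (r a) (i a) :=
  ListCtx.nat_length <| (list_vertices hr).filter <|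
    poly_adj (hr.fst fun _ _ h => h.1) (hi.fst fun _ _ h => h.1) (list_vertices hr).mem

theorem bdd_width (hr : RawCtx Γ r) : PolyBdd Γ fun a => width (r a) :=
  (hr.order.add (.const 1)).mono fun _ _ _ => width_le _

theorem nat_width (hr : RawCtx Γ r) : NatCtx Γ fun a => width (r a) := by
  -- The time of a maximum of unary numbers depends on its arguments, so the invariant has to bound
  -- the running maximum.
  refine ⟨(list_vertices hr).poly.foldl (f := fun a d i => max d (deg (r a) i + 1))
    (fun a _ d => d ≤ (r a).order + 1) (.natConst 1) (list_vertices hr).length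
    (fun _ _ _ => by omega)
    (fun a _ d i _ _ hd => max_le hd (by have := deg_le (r a) i; omega)) ?_, bdd_width hr⟩
  have hb := hr.order.comp (Γ' := fun (p : α × ℕ × ℕ) N => Γ p.1 N ∧ p.2.1 ≤ (r p.1).order + 1 ∧
    p.2.2 ∈ List.range (r p.1).order) (i := fun p => p.1) fun _ _ h => h.1
  have hi : NatCtx (fun (p : α × ℕ × ℕ) N => Γ p.1 N ∧ p.2.1 ≤ (r p.1).order + 1 ∧
      p.2.2 ∈ List.range (r p.1).order) fun p => p.2.2 :=
    ⟨PolyTime.id'.snd.snd, hb.mono fun p _ h => (List.mem_range.1 h.2.2).le⟩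
  have hdeg := nat_deg (hr.fst fun _ _ h => h.1) hi
  exact PolyTime.max PolyTime.id'.snd.fst hdeg.succ.poly
    ((hb.add (.const 1)).mono fun p _ h => h.2.1) hdeg.succ.bdd

theorem nat_threshold (hr : RawCtx Γ r) : NatCtx Γ fun a => threshold (r a) :=
  have hw := nat_width hr
  (NatCtx.mul (.const 4) ⟨hr.poly.fst, hr.tokens⟩).mul ((hw.mul hw).mul hw)

theorem list_cover (hr : RawCtx Γ r) : ListCtx Prod.fst Γ fun a => cover (r a) := by
  refine ⟨?_, ?_, ?_⟩
  · refine (list_vertices hr).poly.flatMap (f := fun _ i => [(i, false), (i, true)])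
      (list_vertices hr).length ?_ (PolyBdd.const 2)
    exact (PolyTime.id'.snd.prod .false).cons ((PolyTime.id'.snd.prod .true).cons .nil)
  · simp only [length_cover]
    exact (PolyBdd.const 2).mul hr.order
  · exact (hr.order.comp (i := Prod.fst) fun _ _ h => h.1).mono
      fun p _ h => (mem_cover.1 h.2).le

theorem poly_round {R : α → List (ℕ × Bool)} (hr : RawCtx Γ r) (hR : ListCtx Prod.fst Γ R) :
    PolyTime Γ fun a => round (r a) (R a) := by
  refine ((list_cover hr).filter ?_).poly
  have hr1 := hr.fst (γ := ℕ × Bool) (Γ' := fun p N => Γ p.1 N ∧ p.2 ∈ cover (r p.1)) fun _ _ h => h.1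
  have hR1 := hR.fst (γ := ℕ × Bool) (Γ' := fun p N => Γ p.1 N ∧ p.2 ∈ cover (r p.1)) fun _ _ h => h.1
  have hp := (list_cover hr).mem_fst
  refine hR1.any ?_
  have hr2 := hr1.fst (γ := ℕ × Bool)
    (Γ' := fun p N => (Γ p.1.1 N ∧ p.1.2 ∈ cover (r p.1.1)) ∧ p.2 ∈ R p.1.1) fun _ _ h => h.1
  have hp2 := hp.fst (γ := ℕ × Bool)
    (Γ' := fun p N => (Γ p.1.1 N ∧ p.1.2 ∈ cover (r p.1.1)) ∧ p.2 ∈ R p.1.1) fun _ _ h => h.1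
  have hq := hR1.mem_fst
  have he : PolyTime (fun (p : (α × ℕ × Bool) × ℕ × Bool) N =>
      (Γ p.1.1 N ∧ p.1.2 ∈ cover (r p.1.1)) ∧ p.2 ∈ R p.1.1)
      fun p => decide (p.2.2 = p.1.2.2) :=
    PolyTime.id'.snd.snd.boolEq PolyTime.id'.fst.snd.snd
  exact ((hq.eq hp2).and he).or ((poly_near hr2 hp2).not.and ((poly_adj hr2 hp2 hq).and he.not))

/-- The invariant of the iteration is that the current list is some iterate of `round`, to which
`reach_bound` applies. -/
theorem list_reach (hr : RawCtx Γ r) (hi : NatCtx Γ i) :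
    ListCtx Prod.fst Γ fun a => reach (r a) (i a) := by
  refine ⟨?_, ?_, ?_⟩
  · refine PolyTime.iterate (f := fun a R => round (r a) R)
      (fun a _ R => ∃ n, R = (round (r a))^[n] [(i a, false)]) (nat_order hr).poly
      ((hi.poly.prod .false).cons .nil) hr.order (fun a _ _ => ⟨0, rfl⟩) ?_ ?_
    · rintro a N _ _ ⟨n, rfl⟩
      exact ⟨n + 1, by rw [Function.iterate_succ_apply']⟩
    · refine poly_round (hr.fst fun _ _ h => h.1) ⟨PolyTime.id'.snd, ?_, ?_⟩
      · refine (((PolyBdd.const 2).mul (hr.order.comp (i := Prod.fst) fun _ _ h => h.1)).add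
          (.const 1)).mono ?_
        rintro ⟨a, R⟩ N ⟨_, n, hn⟩
        dsimp only at hn ⊢
        rw [hn]
        exact (reach_bound _ _ _).1
      · refine ((hr.order.add hi.bdd).comp (i := fun p : (α × List (ℕ × Bool)) × ℕ × Bool => p.1.1)
          fun _ _ h => h.1.1).mono ?_
        rintro ⟨⟨a, R⟩, p⟩ N ⟨⟨_, n, hn⟩, hp⟩
        dsimp only at hn hp ⊢
        rw [hn] at hp
        exact (reach_bound _ _ _).2 p hp
  · exact (((PolyBdd.const 2).mul hr.order).add (.const 1)).mono fun a _ _ => (reach_bound _ _ _).1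
  · exact ((hr.order.add hi.bdd).comp (i := Prod.fst) fun _ _ h => h.1).mono
      fun p _ h => (reach_bound _ _ _).2 _ h.2

theorem list_comp (hr : RawCtx Γ r) (hi : NatCtx Γ i) :
    ListCtx id Γ fun a => comp (r a) (i a) := by
  refine (list_vertices hr).filter ?_
  have hR := (list_reach hr hi).fst (γ := ℕ)
    (Γ' := fun p N => Γ p.1 N ∧ p.2 ∈ List.range (r p.1).order) fun _ _ h => h.1
  exact hR.any (hR.mem_fst.eq ((list_vertices hr).mem.fst fun _ _ h => h.1))

theorem list_border (hr : RawCtx Γ r) (hi : NatCtx Γ i) :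
    ListCtx id Γ fun a => border (r a) (i a) := by
  refine (list_vertices hr).filter ?_
  have hr' := hr.fst (γ := ℕ)
    (Γ' := fun p N => Γ p.1 N ∧ p.2 ∈ List.range (r p.1).order) fun _ _ h => h.1
  have hC := (list_comp hr hi).fst (γ := ℕ)
    (Γ' := fun p N => Γ p.1 N ∧ p.2 ∈ List.range (r p.1).order) fun _ _ h => h.1
  exact (poly_near hr' (list_vertices hr).mem).and
    (hC.any (poly_adj (hr'.fst fun _ _ h => h.1) ((list_vertices hr).mem.fst fun _ _ h => h.1)
      hC.mem))

theorem poly_colour (hr : RawCtx Γ r) (hi : NatCtx Γ i) (hj : NatCtx Γ j) :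
    PolyTime Γ fun a => colour (r a) (i a) (j a) :=
  (list_reach hr hi).any <| (poly_adj (hr.fst fun _ _ h => h.1) (hj.fst fun _ _ h => h.1)
    (list_reach hr hi).mem_fst).and PolyTime.id'.snd.snd

theorem poly_filler {g : α → List (ℕ × Bool)} (hg : PolyTime Γ g) :
    PolyTime Γ fun a => filler (g a) :=
  (PolyTime.zero.prod (hg.headD (PolyTime.zero.prod .false)).snd.not).cons hg

theorem list_gadget (hr : RawCtx Γ r) (hi : NatCtx Γ i) :
    ListCtx Prod.fst Γ fun a => gadget (r a) (i a) := by
  have hB := list_border hr hi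
  have hj := hB.headD
  refine ⟨hB.poly.isEmpty.ite' .nil ?_, ?_, ?_⟩
  · refine hB.tail.poly.foldl' (f := fun a g b => attach (r a) (i a) g b) ?_ hB.tail.length ?_
    · exact PolyTime.iterate' (f := fun _ g => filler g) (nat_threshold hr).poly
        ((hj.succ.poly.prod (poly_colour hr hi hj)).cons .nil) (nat_threshold hr).bdd
        (poly_filler PolyTime.id'.snd)
    · have hb : NatCtx (fun (p : α × List (ℕ × Bool) × ℕ) N => Γ p.1 N ∧
          p.2.2 ∈ (border (r p.1) (i p.1)).tail) fun p => p.2.2 :=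
        ⟨PolyTime.id'.snd.snd, hB.tail.elt.comp
          (i := fun p : α × List (ℕ × Bool) × ℕ => (p.1, p.2.2)) fun _ _ h => h⟩
      have hc := poly_colour (hr.fst fun _ _ h => h.1) (hi.fst fun _ _ h => h.1) hb
      have hg : PolyTime (fun (p : α × List (ℕ × Bool) × ℕ) N => Γ p.1 N ∧
          p.2.2 ∈ (border (r p.1) (i p.1)).tail) fun p => p.2.1 := PolyTime.id'.snd.fst
      exact ((hg.headD (d := (0, false)) (PolyTime.zero.prod .false)).snd.boolEq hc).ite'
        ((hb.succ.poly.prod hc).cons (poly_filler hg)) ((hb.succ.poly.prod hc).cons hg)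
  · exact ((nat_threshold hr).bdd.add ((PolyBdd.const 2).mul hB.length)).mono
      fun a _ _ => length_gadget_le _ _
  · refine ((hr.order.add (.const 1)).comp (i := Prod.fst) fun _ _ h => h.1).mono fun p N h => ?_
    rcases mem_gadget h.2 with h | ⟨b, hb, h⟩
    · omega
    · have := mem_border_lt hb
      rw [h]
      exact Nat.succ_le_succ this.le

theorem list_kept (hr : RawCtx Γ r) (hi : NatCtx Γ i) :
    ListCtx id Γ fun a => kept (r a) (i a) := by
  refine (list_vertices hr).filter ?_
  have hC := (list_comp hr hi).fst (γ := ℕ)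
    (Γ' := fun p N => Γ p.1 N ∧ p.2 ∈ List.range (r p.1).order) fun _ _ h => h.1
  exact (hC.any (hC.mem.eq ((list_vertices hr).mem.fst fun _ _ h => h.1))).not

theorem poly_replace (hr : RawCtx Γ r) (hi : NatCtx Γ i) :
    PolyTime Γ fun a => replace (r a) (i a) := by
  have hK := list_kept hr hi
  have hG := list_gadget hr hi
  have hL := ListCtx.range hG.nat_length
  refine hr.poly.fst.prod (PolyTime.prod ?_ (PolyTime.prod ?_ ?_))
  · refine PolyTime.append (hK.map ?_) (hL.map ?_) (by simpa using hK.length)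
    · have hr1 := hr.fst (γ := ℕ) (Γ' := fun p N => Γ p.1 N ∧ p.2 ∈ kept (r p.1) (i p.1))
        fun _ _ h => h.1
      have hK1 := hK.fst (γ := ℕ) (Γ' := fun p N => Γ p.1 N ∧ p.2 ∈ kept (r p.1) (i p.1))
        fun _ _ h => h.1
      have hG1 := hG.fst (γ := ℕ) (Γ' := fun p N => Γ p.1 N ∧ p.2 ∈ kept (r p.1) (i p.1))
        fun _ _ h => h.1
      refine PolyTime.append (hK1.map ?_) (hG1.map ?_) (by simpa using hK1.length)
      · exact poly_adj (hr1.fst fun _ _ h => h.1) (hK.mem.fst fun _ _ h => h.1) hK1.mem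
      · exact hG1.mem_fst.eq (hK.mem.fst fun _ _ h => h.1).succ
    · have hK1 := hK.fst (γ := ℕ)
        (Γ' := fun p N => Γ p.1 N ∧ p.2 ∈ List.range (gadget (r p.1) (i p.1)).length)
        fun _ _ h => h.1
      have hG1 := hG.fst (γ := ℕ)
        (Γ' := fun p N => Γ p.1 N ∧ p.2 ∈ List.range (gadget (r p.1) (i p.1)).length)
        fun _ _ h => h.1
      have hL1 := hL.fst (γ := ℕ)
        (Γ' := fun p N => Γ p.1 N ∧ p.2 ∈ List.range (gadget (r p.1) (i p.1)).length)
        fun _ _ h => h.1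
      have hget : NatCtx (fun (p : α × ℕ) N => Γ p.1 N ∧
          p.2 ∈ List.range (gadget (r p.1) (i p.1)).length)
          fun p => ((gadget (r p.1) (i p.1)).getD p.2 (0, false)).1 := by
        refine ⟨(hG1.poly.getD (d := (0, false)) (PolyTime.zero.prod .false) hL.mem.poly hL.mem.bdd).fst, ?_⟩
        obtain ⟨q, hq⟩ := hG.elt
        refine ⟨q, fun p N h => hq (p.1, _) N ⟨h.1, ?_⟩⟩
        change (gadget (r p.1) (i p.1)).getD p.2 (0, false) ∈ gadget (r p.1) (i p.1)
        rw [List.getD_eq_getElem _ _ (List.mem_range.1 h.2)]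
        exact List.getElem_mem _
      refine PolyTime.append (hK1.map ?_) (hL1.map ?_) (by simpa using hK1.length)
      · exact (hget.fst fun _ _ h => h.1).eq hK1.mem.succ
      · exact ((hL.mem.fst fun _ _ h => h.1).succ.eq hL1.mem).or
          (hL1.mem.succ.eq (hL.mem.fst fun _ _ h => h.1))
  · exact PolyTime.append (hK.map ((hr.poly.snd.snd.fst.comp PolyTime.id'.fst
      fun _ _ h => h.1).getD .false hK.mem.poly hK.mem.bdd)) (hG.map .false)
      (by simpa using hK.length)
  · exact PolyTime.append (hK.map ((hr.poly.snd.snd.snd.comp PolyTime.id'.fst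
      fun _ _ h => h.1).getD .false hK.mem.poly hK.mem.bdd)) (hG.map .false)
      (by simpa using hK.length)

theorem list_large (hr : RawCtx Γ r) : ListCtx id Γ fun a => large (r a) := by
  refine (list_vertices hr).filter ?_
  have hr' := hr.fst (γ := ℕ)
    (Γ' := fun p N => Γ p.1 N ∧ p.2 ∈ List.range (r p.1).order) fun _ _ h => h.1
  have hv := (list_vertices hr).mem
  have hC := (list_comp hr' hv).nat_length
  exact (poly_near hr' hv).not.and
    ((list_gadget hr' hv).nat_length.succ.poly.ble hC.poly hC.bdd)

theorem poly_shrink (hr : RawCtx Γ r) : PolyTime Γ fun a => shrink (r a) :=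
  (list_large hr).poly.isEmpty.ite' hr.poly (poly_replace hr (list_large hr).headD)

/-- No round increases the number of vertices or changes `k`, so the same `N` bounds every
intermediate instance and the polynomial bounds do not compound. -/
theorem poly_kernel : PolyTime (fun r N => r.1 ≤ N ∧ r.order ≤ N) kernel := by
  have hr : RawCtx (fun r N => r.1 ≤ N ∧ r.order ≤ N) fun r : Raw => r :=
    ⟨PolyTime.id', .of_le_param fun _ _ h => h.2, .of_le_param fun _ _ h => h.1⟩
  refine PolyTime.iterate (f := fun _ r => shrink r) (fun _ N r => r.1 ≤ N ∧ r.order ≤ N)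
    (nat_order hr).poly hr.poly hr.order (fun _ _ h => h) ?_ ?_
  · intro a N r _ h
    exact ⟨(shrink_fst r).le.trans h.1, (order_shrink_le r).trans h.2⟩
  · exact poly_shrink (hr.comp PolyTime.id'.snd fun _ _ h => h.2)

end Time
end Raw

namespace Sliding
open Relation Finset
set_option linter.unusedSectionVars false

/-! ### Extending a graph by a path -/

section PathExt
variable {a L : ℕ} {H : SimpleGraph (Fin a)} {att : Fin L → Fin a → Prop}

/-- Adjacency in the extension of a graph by a path. -/
def pathExtAdj (H : SimpleGraph (Fin a)) (att : Fin L → Fin a → Prop) :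
    Fin a ⊕ Fin L → Fin a ⊕ Fin L → Prop
  | .inl i, .inl j => H.Adj i j
  | .inl i, .inr j => att j i
  | .inr j, .inl i => att j i
  | .inr i, .inr j => (i : ℕ) + 1 = j ∨ (j : ℕ) + 1 = i

/-- The extension of the graph `H` by a path on `L` new vertices; the new vertex `j` is adjacent to
the old vertex `i` when `att j i`. -/
def pathExt (H : SimpleGraph (Fin a)) (att : Fin L → Fin a → Prop) : SimpleGraph (Fin (a + L)) where
  Adj x y := pathExtAdj H att (finSumFinEquiv.symm x) (finSumFinEquiv.symm y)
  symm := ⟨fun x y h => by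
    generalize finSumFinEquiv.symm x = x at h ⊢
    generalize finSumFinEquiv.symm y = y at h ⊢
    cases x <;> cases y <;> simp only [pathExtAdj] at h ⊢
    · exact h.symm
    · exact h
    · exact h
    · omega⟩
  loopless := ⟨fun x h => by
    generalize finSumFinEquiv.symm x = x at h
    cases x <;> simp [pathExtAdj] at h⟩

@[simp] theorem pathExt_adj_old (i j : Fin a) :
    (pathExt H att).Adj (Fin.castAdd L i) (Fin.castAdd L j) ↔ H.Adj i j := by
  simp [pathExt, pathExtAdj]

@[simp] theorem pathExt_adj_old_new (i : Fin a) (j : Fin L) :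
    (pathExt H att).Adj (Fin.castAdd L i) (Fin.natAdd a j) ↔ att j i := by
  simp [pathExt, pathExtAdj]

@[simp] theorem pathExt_adj_new_old (i : Fin a) (j : Fin L) :
    (pathExt H att).Adj (Fin.natAdd a j) (Fin.castAdd L i) ↔ att j i := by
  simp [pathExt, pathExtAdj]

@[simp] theorem pathExt_adj_new (i j : Fin L) :
    (pathExt H att).Adj (Fin.natAdd a i) (Fin.natAdd a j) ↔
      (i : ℕ) + 1 = j ∨ (j : ℕ) + 1 = i := by
  simp [pathExt, pathExtAdj]

/-- The new vertices. -/
def newVerts (a L : ℕ) : Finset (Fin (a + L)) := univ.map (Fin.natAddEmb a)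

theorem mem_newVerts {x : Fin (a + L)} : x ∈ newVerts a L ↔ ∃ j, Fin.natAdd a j = x := by
  simp [newVerts]

theorem mem_newVerts' {x : Fin (a + L)} :
    x ∈ newVerts a L ↔ ∀ i, Fin.castAddEmb (n := a) L i ≠ x := by
  refine Fin.addCases (fun i => ?_) (fun j => ?_) x
  · rw [mem_newVerts]
    refine iff_of_false ?_ fun h => h i rfl
    rintro ⟨j, hj⟩
    have := congrArg Fin.val hj
    simp at this
    omega
  · rw [mem_newVerts]
    refine iff_of_true ⟨j, rfl⟩ fun i hi => ?_
    have := congrArg Fin.val hi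
    simp at this
    omega

theorem card_newVerts : (newVerts a L).card = L := by simp [newVerts]

theorem Conn.of_reachable {V : Type} [DecidableEq V] {G : SimpleGraph V} {C : Finset V}
    {F : SimpleGraph V} (hF : F ≤ G) (h : ∀ x ∈ C, ∀ z ∈ C, F.Reachable x z)
    (hC : ∀ x ∈ C, ∀ z, F.Adj x z → z ∈ C) : Conn G C := by
  intro x hx z hz
  obtain ⟨w⟩ := h x hx z hz
  have hmem : ∀ i, w.getVert i ∈ C := by
    intro i
    induction i with
    | zero => simpa using hx
    | succ i ih =>
      by_cases hi : i < w.length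
      · exact hC _ ih _ (w.adj_getVert_succ hi)
      · rw [w.getVert_of_length_le (by omega)]; exact hz
  exact ⟨w.length, w.getVert, ⟨fun i _ => hmem i, fun i hi => hF (w.adj_getVert_succ hi)⟩,
    w.getVert_zero, w.getVert_length⟩

theorem conn_newVerts : Conn (pathExt H att) (newVerts a L) := by
  have h1 : ∀ n (i j : Fin L), (i : ℕ) + n = j →
      ∃ l p, IsWalk (pathExt H att) (newVerts a L) l p ∧ p 0 = Fin.natAdd a i ∧
        p l = Fin.natAdd a j := by
    intro n i j hij
    -- A walk is a function on all of `ℕ`; the minimum keeps its values on the path beyond the end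
    -- `j`.
    have hL : ∀ m, min (i + m : ℕ) j < L := fun m => by omega
    refine ⟨n, fun m => Fin.natAdd a ⟨min (i + m) j, hL m⟩,
      ⟨fun m _ => mem_newVerts.2 ⟨_, rfl⟩, fun m hm => ?_⟩, ?_, ?_⟩
    · rw [pathExt_adj_new]; simp only; omega
    · exact congrArg (Fin.natAdd a) (Fin.ext (by simp only; omega))
    · exact congrArg (Fin.natAdd a) (Fin.ext (by simp only; omega))
  intro x hx z hz
  obtain ⟨i, rfl⟩ := mem_newVerts.1 hx
  obtain ⟨j, rfl⟩ := mem_newVerts.1 hz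
  rcases le_total (i : ℕ) j with h | h
  · exact h1 (j - i) i j (by omega)
  · obtain ⟨l, p, hp, h0, hl⟩ := h1 (i - j) j i (by omega)
    refine ⟨l, fun m => p (l - m), ⟨fun m _ => hp.1 _ (by omega), fun m hm => ?_⟩, by simpa, by
      simpa⟩
    have := hp.2 (l - (m + 1)) (by omega)
    rw [show l - (m + 1) + 1 = l - m by omega] at this
    exact this.symm

theorem isBipartite_iff {V : Type} {G : SimpleGraph V} :
    G.IsBipartite ↔ ∃ c : V → Bool, ∀ x y, G.Adj x y → c x ≠ c y := by
  constructor
  · rintro ⟨c⟩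
    refine ⟨fun v => decide (c v = 0), fun x y hxy h => c.valid hxy ?_⟩
    have h1 : c x = 0 ↔ c y = 0 := by simpa using h
    have := (c x).isLt
    have := (c y).isLt
    ext
    simp only [Fin.ext_iff] at h1
    simp at h1
    omega
  · rintro ⟨c, hc⟩
    refine ⟨SimpleGraph.Coloring.mk (fun v => if c v then 0 else 1) fun {x y} hxy h => ?_⟩
    have := hc x y hxy
    cases h1 : c x <;> cases h2 : c y <;> simp_all

theorem isBipartite_pathExt (c : Fin a → Bool) (e : Fin L → Bool)
    (hc : ∀ i j, H.Adj i j → c i ≠ c j) (he : ∀ i j : Fin L, (i : ℕ) + 1 = j → e i ≠ e j)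
    (hatt : ∀ j i, att j i → e j ≠ c i) : (pathExt H att).IsBipartite := by
  refine isBipartite_iff.2 ⟨Fin.addCases c e, fun x y => ?_⟩
  refine Fin.addCases (fun i => ?_) (fun i => ?_) x <;>
    refine Fin.addCases (fun j => ?_) (fun j => ?_) y <;>
    simp only [pathExt_adj_old, pathExt_adj_old_new, pathExt_adj_new_old, pathExt_adj_new,
      Fin.addCases_left, Fin.addCases_right]
  · exact hc i j
  · exact fun h => (hatt j i h).symm
  · exact hatt i j
  · rintro (h | h)
    · exact he i j h
    · exact (he j i h).symm

/-- A path vertex sees at most three path vertices including itself, two if it is an end, and at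
most one old vertex. So `4 ≤ D` always suffices, and for `D = 3` the attachments have to be at the
ends. An old vertex gains at most one neighbour, for which `hB` reserves room. -/
theorem card_nbhd_pathExt {D : ℕ} (hH : ∀ i, (nbhd H i).card ≤ D)
    (hB : ∀ j i, att j i → (nbhd H i).card + 1 ≤ D)
    (h1 : ∀ j j' i, att j i → att j' i → j = j') (h2 : ∀ j i i', att j i → att j i' → i = i')
    (hL : 0 < L → 3 ≤ D) (hend : ∀ j i, att j i → (j : ℕ) = 0 ∨ (j : ℕ) + 1 = L ∨ 4 ≤ D)
    (x : Fin (a + L)) : (nbhd (pathExt H att) x).card ≤ D := by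
  classical
  refine Fin.addCases (fun i => ?_) (fun j => ?_) x
  · have hsub : nbhd (pathExt H att) (Fin.castAdd L i) ⊆ (nbhd H i).map (Fin.castAddEmb L) ∪
        (univ.filter fun j => att j i).map (Fin.natAddEmb a) := by
      intro y
      refine Fin.addCases (fun k => ?_) (fun k => ?_) y <;> rw [mem_nbhd] <;> intro hy
      · refine mem_union_left _ (mem_map.2 ⟨k, mem_nbhd.2 ?_, rfl⟩)
        rcases hy with hy | hy
        · exact .inl (Fin.castAdd_injective _ _ hy)
        · exact .inr (pathExt_adj_old _ _ |>.1 hy)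
      · refine mem_union_right _ (mem_map.2 ⟨k, ?_, rfl⟩)
        rcases hy with hy | hy
        · have := congrArg Fin.val hy
          simp at this
          omega
        · simpa using hy
    have hcard := (card_le_card hsub).trans (card_union_le _ _)
    rw [card_map, card_map] at hcard
    have hle : (univ.filter fun j => att j i).card ≤ 1 :=
      card_le_one.2 fun j hj j' hj' => h1 j j' i (by simpa using hj) (by simpa using hj')
    rcases (univ.filter fun j => att j i).eq_empty_or_nonempty with h | ⟨j, hj⟩
    · rw [h, card_empty] at hcard
      exact hcard.trans (hH i)
    · have := hB j i (by simpa using hj)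
      omega
  · have hsub : nbhd (pathExt H att) (Fin.natAdd a j) ⊆
        (univ.filter fun k : Fin L => k = j ∨ (j : ℕ) + 1 = k ∨ (k : ℕ) + 1 = j).map
          (Fin.natAddEmb a) ∪ (univ.filter fun i => att j i).map (Fin.castAddEmb L) := by
      intro y
      refine Fin.addCases (fun k => ?_) (fun k => ?_) y <;> rw [mem_nbhd] <;> intro hy
      · refine mem_union_right _ (mem_map.2 ⟨k, ?_, rfl⟩)
        rcases hy with hy | hy
        · have := congrArg Fin.val hy
          simp at this
          omega
        · simpa using hy
      · refine mem_union_left _ (mem_map.2 ⟨k, ?_, rfl⟩)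
        rcases hy with hy | hy
        · have := congrArg Fin.val hy
          simp at this
          simp [Fin.ext_iff, this]
        · simp only [pathExt_adj_new] at hy
          simp [hy]
    have hcard := (card_le_card hsub).trans (card_union_le _ _)
    rw [card_map, card_map] at hcard
    have hval : ∀ s : Finset ℕ, (∀ k : Fin L, k = j ∨ (j : ℕ) + 1 = k ∨ (k : ℕ) + 1 = j →
        (k : ℕ) ∈ s) → (univ.filter fun k : Fin L => k = j ∨ (j : ℕ) + 1 = k ∨ (k : ℕ) + 1 = j).card
          ≤ s.card := by
      intro s hs
      refine card_le_card_of_injOn Fin.val (fun k hk => hs k (by simpa using hk))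
        Fin.val_injective.injOn
    have hle : (univ.filter fun i => att j i).card ≤ 1 :=
      card_le_one.2 fun i hi i' hi' => h2 j i i' (by simpa using hi) (by simpa using hi')
    have h3 := hval {(j : ℕ) - 1, (j : ℕ), (j : ℕ) + 1} fun k hk => by
      simp only [mem_insert, mem_singleton, Fin.ext_iff] at hk ⊢
      omega
    have h3' : ({(j : ℕ) - 1, (j : ℕ), (j : ℕ) + 1} : Finset ℕ).card ≤ 3 := card_le_three
    have hL' := hL (by have := j.isLt; omega)
    rcases (univ.filter fun i => att j i).eq_empty_or_nonempty with h | ⟨i, hi⟩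
    · rw [h, card_empty] at hcard
      omega
    · rcases hend j i (by simpa using hi) with h | h | h
      · have h4 := hval {(j : ℕ), (j : ℕ) + 1} fun k hk => by
          simp only [mem_insert, mem_singleton, Fin.ext_iff] at hk ⊢
          omega
        have : ({(j : ℕ), (j : ℕ) + 1} : Finset ℕ).card ≤ 2 := card_le_two
        omega
      · have h4 := hval {(j : ℕ) - 1, (j : ℕ)} fun k hk => by
          have := k.isLt
          simp only [mem_insert, mem_singleton, Fin.ext_iff] at hk ⊢
          omega
        have : ({(j : ℕ) - 1, (j : ℕ)} : Finset ℕ).card ≤ 2 := card_le_two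
        omega
      · omega

end PathExt

/-! ### Counting the edges at a connected set -/

/-- A connected set spans at least `|C| - 1` edges, each counted twice among the at most `(D - 1) *
|C|` pairs of a vertex of `C` and a neighbour of it. At most `(D - 3) * |C| + 2` pairs remain for
the vertices of `B`. The form without subtraction also covers small `D`. -/
theorem Conn.card_add_le {V : Type} [DecidableEq V] [Fintype V] {G : SimpleGraph V}
    {C B : Finset V} {D : ℕ} (hC : Conn G C) (hne : C.Nonempty)
    (hB : ∀ b ∈ B, b ∉ C ∧ ∃ c ∈ C, G.Adj c b) (hD : ∀ v, (nbhd G v).card ≤ D) :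
    3 * C.card + B.card ≤ D * C.card + 2 := by
  classical
  have hconn : (G.induce (C : Set V)).Connected := by
    rw [SimpleGraph.connected_iff]
    refine ⟨fun x z => ?_, ⟨⟨_, hne.choose_spec⟩⟩⟩
    obtain ⟨l, p, hp, h0, hl⟩ := hC x x.2 z z.2
    have : ∀ i (hi : i ≤ l), (G.induce (C : Set V)).Reachable x ⟨p i, hp.1 i hi⟩ := by
      intro i
      induction i with
      | zero =>
        intro hi
        have : x = ⟨p 0, hp.1 0 hi⟩ := Subtype.ext h0.symm
        rw [← this]
      | succ i ih =>
        intro hi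
        exact (ih (by omega)).trans (SimpleGraph.Adj.reachable (hp.2 i (by omega)))
    have h := this l le_rfl
    have hz : z = ⟨p l, hp.1 l le_rfl⟩ := Subtype.ext hl.symm
    rwa [← hz] at h
  have hedges := hconn.card_vert_le_card_edgeSet_add_one
  have hsum := (G.induce (C : Set V)).sum_degrees_eq_twice_card_edges
  have hcardC : Nat.card (C : Set V) = C.card := by simp
  have hin : ∀ c : (C : Set V), (G.induce (C : Set V)).degree c =
      ((nbhd G c).erase c ∩ C).card := by
    intro c
    rw [← SimpleGraph.card_neighborFinset_eq_degree, ← card_map (Function.Embedding.subtype _)]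
    congr 1
    ext w
    simp only [mem_map, SimpleGraph.mem_neighborFinset, SimpleGraph.comap_adj,
      Function.Embedding.coe_subtype, mem_inter, mem_erase, mem_nbhd]
    constructor
    · rintro ⟨w, hw, rfl⟩
      exact ⟨⟨hw.ne', .inr hw⟩, w.2⟩
    · rintro ⟨⟨h1, h2⟩, h3⟩
      exact ⟨⟨w, h3⟩, h2.resolve_left h1, rfl⟩
  have hout : B.card ≤ ∑ c ∈ C, (nbhd G c \ C).card := by
    refine (card_le_card (t := C.biUnion fun c => nbhd G c \ C) fun b hb => ?_).trans card_biUnion_le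
    obtain ⟨hbC, c, hc, hcb⟩ := hB b hb
    exact mem_biUnion.2 ⟨c, hc, by simp [mem_nbhd, hcb, hbC]⟩
  have htot : ∀ c ∈ C, ((nbhd G c).erase c ∩ C).card + (nbhd G c \ C).card + 1 ≤ D := by
    intro c hc
    refine le_trans (le_of_eq ?_) (hD c)
    have hcN : c ∈ nbhd G c ∩ C := by simp [mem_nbhd, hc]
    have e : (nbhd G c).erase c ∩ C = (nbhd G c ∩ C).erase c := by
      ext w; simp only [mem_inter, mem_erase]; tauto
    rw [e, card_erase_of_mem hcN, ← card_inter_add_card_sdiff (nbhd G c) C]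
    have := card_pos.2 ⟨c, hcN⟩
    omega
  have hsum' : ∑ c ∈ C, ((nbhd G c).erase c ∩ C).card =
      2 * (G.induce (C : Set V)).edgeFinset.card := by
    rw [← hsum, ← Finset.sum_coe_sort C]
    exact Finset.sum_congr rfl fun c _ => (hin c).symm
  have hle := Finset.sum_le_sum htot
  rw [sum_add_distrib, sum_add_distrib, hsum'] at hle
  simp only [sum_const, smul_eq_mul, mul_one] at hle
  rw [Nat.card_eq_fintype_card, Nat.card_eq_fintype_card, SimpleGraph.card_edgeSet] at hedges
  rw [Nat.card_eq_fintype_card] at hcardC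
  rw [hcardC] at hedges
  rw [mul_comm D]
  omega

end Sliding

/-! ## Raw instances of instances -/

namespace TSInstance
open Finset Sliding Relation

open scoped Classical in
/-- The truth value of a proposition. -/
noncomputable def truth (P : Prop) : Bool := decide P

@[simp] theorem truth_eq_true {P : Prop} : truth P = true ↔ P := by simp [truth]

/-- The raw instance of an instance. -/
noncomputable def raw (I : TSInstance) : Raw :=
  (I.k, List.ofFn fun i => List.ofFn fun j => truth (I.G.Adj i j),
    List.ofFn fun i => truth (i ∈ I.S.1), List.ofFn fun i => truth (i ∈ I.T.1))

theorem enc_raw (I : TSInstance) : TEnc.enc I.raw = I.encode := by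
  simp only [raw, encode, TEnc.enc, List.map_ofFn, Function.comp_def]
  rfl

theorem isYes_iff (I : TSInstance) : I.IsYes ↔ Reach I.G I.S.1 I.T.1 := reachable_iff_reach

theorem k_le_n (I : TSInstance) : I.k ≤ I.n := by
  rw [← I.S.2.card_eq]
  simpa using card_le_univ I.S.1

theorem card_nbhd {V : Type} [Fintype V] [DecidableEq V] (G : SimpleGraph V) [DecidableRel G.Adj]
    (v : V) : (nbhd G v).card = G.degree v + 1 := by
  rw [← SimpleGraph.card_neighborFinset_eq_degree, ← card_insert_of_notMem (a := v) (by simp)]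
  congr 1
  ext w
  simp [mem_nbhd]

theorem maxDegree_le_iff (I : TSInstance) (d : ℕ) :
    I.maxDegree ≤ d ↔ ∀ v, (nbhd I.G v).card ≤ d + 1 := by
  classical
  unfold maxDegree
  constructor
  · intro h v
    rw [card_nbhd]
    have := I.G.degree_le_maxDegree v
    omega
  · intro h
    refine SimpleGraph.maxDegree_le_of_forall_degree_le _ _ fun v => ?_
    have := h v
    rw [card_nbhd] at this
    omega

/-! ### What the functions on raw instances compute -/

variable (I : TSInstance)

@[simp] theorem order_raw : I.raw.order = I.n := by simp [raw, Raw.order]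

theorem getD_ofFn {n : ℕ} {α : Type} (f : Fin n → α) (d : α) (i : Fin n) :
    (List.ofFn f).getD i d = f i := by
  rw [List.getD_eq_getElem _ _ (by simp)]
  simp

theorem adj_raw (i j : Fin I.n) : I.raw.adj i j = true ↔ I.G.Adj i j := by
  simp only [raw, Raw.adj, getD_ofFn, truth_eq_true]

theorem token_raw (i : Fin I.n) : I.raw.token i = true ↔ i ∈ I.S.1 ∪ I.T.1 := by
  simp only [raw, Raw.token, getD_ofFn, Bool.or_eq_true, truth_eq_true, mem_union]

theorem near_raw (i : Fin I.n) :
    I.raw.near i = true ↔ ∃ t ∈ I.S.1 ∪ I.T.1, i ∈ nbhd I.G t := by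
  simp only [Raw.near, Bool.or_eq_true, token_raw, List.any_eq_true, List.mem_range, order_raw,
    Bool.and_eq_true, mem_nbhd]
  constructor
  · rintro (h | ⟨j, hj, h1, h2⟩)
    · exact ⟨i, h, .inl rfl⟩
    · exact ⟨⟨j, hj⟩, (I.token_raw ⟨j, hj⟩).1 h1, .inr ((I.adj_raw i ⟨j, hj⟩).1 h2).symm⟩
  · rintro ⟨t, ht, rfl | h⟩
    · exact .inl ht
    · exact .inr ⟨t, t.2, (I.token_raw t).2 ht, (I.adj_raw i t).2 h.symm⟩

theorem deg_raw (i : Fin I.n) : I.raw.deg i + 1 = (nbhd I.G i).card := by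
  classical
  rw [card_nbhd, Raw.deg, ← SimpleGraph.card_neighborFinset_eq_degree, ← card_map Fin.valEmbedding,
    ← List.toFinset_card_of_nodup (List.nodup_range.filter _)]
  congr 2
  ext j
  simp only [List.mem_toFinset, List.mem_filter, List.mem_range, order_raw, mem_map,
    SimpleGraph.mem_neighborFinset, Fin.valEmbedding_apply]
  constructor
  · rintro ⟨hj, h⟩
    exact ⟨⟨j, hj⟩, (I.adj_raw i ⟨j, hj⟩).1 h, rfl⟩
  · rintro ⟨j, h, rfl⟩
    exact ⟨j.2, (I.adj_raw i j).2 h⟩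

theorem le_foldl_max (f : ℕ → ℕ) (l : List ℕ) (d : ℕ) :
    d ≤ l.foldl (fun d i => max d (f i)) d ∧
      ∀ i ∈ l, f i ≤ l.foldl (fun d i => max d (f i)) d := by
  induction l generalizing d with
  | nil => simp
  | cons j l ih =>
    have h := ih (max d (f j))
    refine ⟨(le_max_left _ _).trans h.1, fun i hi => ?_⟩
    rcases List.mem_cons.1 hi with rfl | hi
    · exact (le_max_right _ _).trans h.1
    · exact h.2 i hi

theorem foldl_max_le (f : ℕ → ℕ) (l : List ℕ) (d b : ℕ) (hd : d ≤ b) (h : ∀ i ∈ l, f i ≤ b) :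
    l.foldl (fun d i => max d (f i)) d ≤ b := by
  induction l generalizing d with
  | nil => exact hd
  | cons j l ih => exact ih _ (max_le hd (h j (by simp))) fun i hi => h i (by simp [hi])

theorem one_le_width (r : Raw) : 1 ≤ r.width :=
  (le_foldl_max (fun i => r.deg i + 1) _ 1).1

theorem card_nbhd_le_width (v : Fin I.n) : (nbhd I.G v).card ≤ I.raw.width := by
  rw [← deg_raw]
  exact (le_foldl_max (fun i => I.raw.deg i + 1) _ 1).2 _ (by simp)

theorem width_raw_le {d : ℕ} (h : ∀ v, (nbhd I.G v).card ≤ d + 1) : I.raw.width ≤ d + 1 := by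
  refine foldl_max_le _ _ _ _ (by omega) fun i hi => ?_
  have hi' : i < I.n := by simpa using hi
  exact (I.deg_raw ⟨i, hi'⟩).le.trans (h _)

/-! ### Components -/

/-- The graph on the vertices that neither carry a token nor are adjacent to one. -/
noncomputable def freeGraph : SimpleGraph (Fin I.n) where
  Adj i j := I.G.Adj i j ∧ I.raw.near i = false ∧ I.raw.near j = false
  symm := ⟨fun _ _ h => ⟨h.1.symm, h.2.2, h.2.1⟩⟩
  loopless := ⟨fun _ h => h.1.ne rfl⟩

theorem freeGraph_le : I.freeGraph ≤ I.G := fun _ _ h => h.1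

variable {I}

theorem near_of_reachable {v w : Fin I.n} (hv : I.raw.near v = false)
    (h : I.freeGraph.Reachable v w) : I.raw.near w = false := by
  rw [SimpleGraph.reachable_iff_reflTransGen] at h
  induction h with
  | refl => exact hv
  | tail _ h _ => exact h.2.2

theorem mem_round {R : List (ℕ × Bool)} {w : Fin I.n} {e : Bool} :
    ((w : ℕ), e) ∈ I.raw.round R ↔ ((w : ℕ), e) ∈ R ∨
      (I.raw.near w = false ∧ ∃ u, (u, !e) ∈ R ∧ I.raw.adj w u = true) := by
  simp only [Raw.round, List.mem_filter, Raw.mem_cover, order_raw, w.2, true_and, List.any_eq_true,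
    Bool.or_eq_true, Bool.and_eq_true, decide_eq_true_eq, Bool.not_eq_true', decide_eq_false_iff_not]
  constructor
  · rintro ⟨⟨u, e'⟩, hu, ⟨rfl, rfl⟩ | ⟨h1, h2, h3⟩⟩
    · exact .inl hu
    · refine .inr ⟨h1, u, ?_, h2⟩
      have : e' = !e := by cases e <;> cases e' <;> simp_all
      rwa [← this]
  · rintro (h | ⟨h1, u, hu, h2⟩)
    · exact ⟨_, h, .inl ⟨rfl, rfl⟩⟩
    · exact ⟨_, hu, .inr ⟨h1, h2, by simp⟩⟩

/-- Every step of the search flips the bit and, in a bipartite graph, the colour. So the bit is the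
colour relative to `v`, and a search of the double cover finds a component together with its
colouring. -/
theorem reach_sound {c : Fin I.n → Bool} (hc : ∀ x y, I.G.Adj x y → c x ≠ c y) {v : Fin I.n}
    (hv : I.raw.near v = false) (m : ℕ) {p : ℕ × Bool}
    (hp : p ∈ I.raw.round^[m] [((v : ℕ), false)]) :
    ∃ w : Fin I.n, (w : ℕ) = p.1 ∧ I.freeGraph.Reachable v w ∧ c w = (c v ^^ p.2) := by
  induction m generalizing p with
  | zero =>
    obtain rfl : p = ((v : ℕ), false) := by simpa using hp
    exact ⟨v, rfl, .refl _, by simp⟩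
  | succ m ih =>
    rw [Function.iterate_succ_apply'] at hp
    have hlt := Raw.mem_cover.1 (List.mem_of_mem_filter hp)
    rw [order_raw] at hlt
    obtain ⟨w, e⟩ := p
    rcases mem_round.1 (show (((⟨w, hlt⟩ : Fin I.n) : ℕ), e) ∈ _ from hp) with h | ⟨h1, u, hu, h2⟩
    · exact ih h
    · obtain ⟨u, rfl, hr, hcu⟩ := ih hu
      have hadj := (I.adj_raw ⟨w, hlt⟩ u).1 h2
      refine ⟨⟨w, hlt⟩, rfl, hr.trans (SimpleGraph.Adj.reachable
        ⟨hadj.symm, near_of_reachable hv hr, h1⟩), ?_⟩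
      have := hc _ _ hadj
      cases h3 : c ⟨w, hlt⟩ <;> cases h4 : c u <;> cases h5 : c v <;> cases e <;> simp_all

theorem round_mono {w : Fin I.n} {e : Bool} {m m' : ℕ} (h : m ≤ m') {R : List (ℕ × Bool)}
    (hw : ((w : ℕ), e) ∈ I.raw.round^[m] R) : ((w : ℕ), e) ∈ I.raw.round^[m'] R := by
  induction m', h using Nat.le_induction with
  | base => exact hw
  | succ m' _ ih => rw [Function.iterate_succ_apply']; exact mem_round.2 (.inl ih)

/-- A walk of length `m` from `w` to `v` is retraced from `v` in `m` rounds. A path is shorter than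
the number of vertices, so `order` rounds are enough. -/
theorem reach_complete {v w : Fin I.n} (h : I.freeGraph.Reachable v w) :
    ∃ e, ((w : ℕ), e) ∈ I.raw.reach v := by
  have key : ∀ (m : ℕ) (w : Fin I.n) (p : I.freeGraph.Walk w v), p.length = m →
      ∃ e, ((w : ℕ), e) ∈ I.raw.round^[m] [((v : ℕ), false)] := by
    intro m
    induction m with
    | zero =>
      intro w p hp
      obtain rfl := p.eq_of_length_eq_zero hp
      exact ⟨false, by simp⟩
    | succ m ih =>
      intro w p hp
      cases p with
      | nil => simp at hp
      | @cons _ u _ h p =>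
        obtain ⟨e, he⟩ := ih u p (by simpa using hp)
        refine ⟨!e, ?_⟩
        rw [Function.iterate_succ_apply']
        exact mem_round.2 (.inr ⟨h.2.1, u, by simpa using he, (I.adj_raw w u).2 h.1⟩)
  obtain ⟨p, hp⟩ := h.symm.exists_isPath
  obtain ⟨e, he⟩ := key _ w p rfl
  refine ⟨e, ?_⟩
  unfold Raw.reach
  rw [order_raw]
  refine round_mono ?_ he
  have := hp.length_lt
  simpa using this.le

theorem mem_comp_raw (hI : I.G.IsBipartite) {v w : Fin I.n} (hv : I.raw.near v = false) :
    (w : ℕ) ∈ I.raw.comp v ↔ I.freeGraph.Reachable v w := by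
  obtain ⟨c, hc⟩ := isBipartite_iff.1 hI
  simp only [Raw.comp, List.mem_filter, List.mem_range, order_raw, w.2, true_and,
    List.any_eq_true, decide_eq_true_eq]
  constructor
  · rintro ⟨p, hp, h⟩
    obtain ⟨w', hw', hr, -⟩ := reach_sound hc hv _ hp
    have : w' = w := Fin.ext (hw'.trans h)
    rwa [← this]
  · intro h
    obtain ⟨e, he⟩ := reach_complete h
    exact ⟨_, he, rfl⟩

theorem lt_of_mem_comp {r : Raw} {v w : ℕ} (h : w ∈ r.comp v) : w < r.order :=
  List.mem_range.1 (List.mem_of_mem_filter h)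

variable (I) in
/-- The component of `v` in the graph on the vertices that are not near. -/
noncomputable def compSet (v : ℕ) : Finset (Fin I.n) := univ.filter fun w => (w : ℕ) ∈ I.raw.comp v

theorem mem_compSet {v : ℕ} {w : Fin I.n} : w ∈ I.compSet v ↔ (w : ℕ) ∈ I.raw.comp v := by
  simp [compSet]

theorem card_compSet (v : ℕ) : (I.compSet v).card = (I.raw.comp v).length := by
  have hnd : (I.raw.comp v).Nodup := List.nodup_range.filter _
  rw [← List.toFinset_card_of_nodup hnd, ← card_map Fin.valEmbedding]
  congr 1
  ext w
  simp only [mem_map, mem_compSet, Fin.valEmbedding_apply, List.mem_toFinset]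
  constructor
  · rintro ⟨w, h, rfl⟩; exact h
  · intro h; exact ⟨⟨w, by simpa using lt_of_mem_comp h⟩, h, rfl⟩

theorem conn_compSet (hI : I.G.IsBipartite) {v : Fin I.n} (hv : I.raw.near v = false) :
    Conn I.G (I.compSet v) := by
  refine Conn.of_reachable I.freeGraph_le (fun x hx z hz => ?_) fun x hx z hxz => ?_
  · rw [mem_compSet, mem_comp_raw hI hv] at hx hz
    exact hx.symm.trans hz
  · rw [mem_compSet, mem_comp_raw hI hv] at hx ⊢
    exact hx.trans hxz.reachable

/-- A neighbour of the component that is not near belongs to the component itself; so the test for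
nearness in `border` amounts to lying outside. -/
theorem mem_border_raw (hI : I.G.IsBipartite) {v b : Fin I.n} (hv : I.raw.near v = false) :
    (b : ℕ) ∈ I.raw.border v ↔ b ∉ I.compSet v ∧ ∃ c ∈ I.compSet v, I.G.Adj b c := by
  simp only [Raw.border, List.mem_filter, List.mem_range, order_raw, b.2, true_and,
    Bool.and_eq_true, List.any_eq_true]
  constructor
  · rintro ⟨h1, c, hc, h2⟩
    have hlt : c < I.n := by simpa using lt_of_mem_comp hc
    refine ⟨fun h => ?_, ⟨c, hlt⟩, mem_compSet.2 hc, (I.adj_raw b ⟨c, hlt⟩).1 h2⟩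
    rw [mem_compSet, mem_comp_raw hI hv] at h
    rw [near_of_reachable hv h] at h1
    exact Bool.false_ne_true h1
  · rintro ⟨h1, c, hc, h2⟩
    refine ⟨?_, c, mem_compSet.1 hc, (I.adj_raw b c).2 h2⟩
    by_contra hb
    rw [mem_compSet, mem_comp_raw hI hv] at hc
    refine h1 (mem_compSet.2 ((mem_comp_raw hI hv).2 (hc.trans (SimpleGraph.Adj.reachable
      ⟨h2.symm, near_of_reachable hv hc, by simpa using hb⟩))))

theorem near_of_mem_border {r : Raw} {v b : ℕ} (h : b ∈ r.border v) : r.near b = true := by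
  have := List.of_mem_filter h
  simp only [Bool.and_eq_true] at this
  exact this.1

/-- All neighbours of `b` in the component have the colour opposite to that of `b`, so the
existential test in `colour` reads off their common colour relative to `v`. -/
theorem colour_raw (hI : I.G.IsBipartite) {c : Fin I.n → Bool}
    (hc : ∀ x y, I.G.Adj x y → c x ≠ c y) {v b : Fin I.n} (hv : I.raw.near v = false)
    (hb : (b : ℕ) ∈ I.raw.border v) : I.raw.colour v b = !(c b ^^ c v) := by
  have hsound : ∀ p ∈ I.raw.reach v, I.raw.adj b p.1 = true → p.2 = !(c b ^^ c v) := by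
    intro p hp h
    obtain ⟨w, hw, -, hcw⟩ := reach_sound hc hv _ hp
    rw [← hw] at h
    have := hc _ _ ((I.adj_raw b w).1 h)
    revert hcw this
    cases c w <;> cases c b <;> cases c v <;> cases p.2 <;> simp
  obtain ⟨-, w, hw, hbw⟩ := (mem_border_raw hI hv).1 hb
  obtain ⟨e, he⟩ := reach_complete ((mem_comp_raw hI hv).1 (mem_compSet.1 hw))
  have he' := hsound _ he ((I.adj_raw b w).2 hbw)
  dsimp only at he'
  rw [Bool.eq_iff_iff]
  simp only [Raw.colour, List.any_eq_true, Bool.and_eq_true]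
  constructor
  · rintro ⟨p, hp, h1, h2⟩
    rw [← hsound p hp h1, h2]
  · intro h
    exact ⟨_, he, (I.adj_raw b w).2 hbw, by rw [he', h]⟩

end TSInstance

/-! ## The path that replaces a component -/

namespace Raw

/-- Colours alternate, and the list is not empty. -/
def Alternating (g : List (ℕ × Bool)) : Prop := g ≠ [] ∧ g.IsChain fun p q => p.2 ≠ q.2

theorem Alternating.cons {g : List (ℕ × Bool)} (hg : Alternating g) {p : ℕ × Bool}
    (h : p.2 ≠ (g.headD (0, false)).2) : Alternating (p :: g) := by
  refine ⟨by simp, ?_⟩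
  cases g with
  | nil => exact absurd rfl hg.1
  | cons q g => exact List.isChain_cons_cons.2 ⟨by simpa using h, hg.2⟩

theorem Alternating.filler {g : List (ℕ × Bool)} (hg : Alternating g) : Alternating (filler g) :=
  hg.cons (by simp)

theorem Alternating.attach {r : Raw} {v b : ℕ} {g : List (ℕ × Bool)} (hg : Alternating g) :
    Alternating (attach r v g b) := by
  unfold Raw.attach
  split_ifs with h
  · refine hg.filler.cons ?_
    simp at h
    simp [Raw.filler, ← h]
  · refine hg.cons ?_
    simpa [eq_comm] using h

theorem alternating_gadget {r : Raw} {v : ℕ} (h : border r v ≠ []) :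
    Alternating (gadget r v) := by
  obtain ⟨b, l, hb⟩ := List.exists_cons_of_ne_nil h
  rw [gadget_cons hb]
  have h1 : ∀ n, Alternating (filler^[n] [(b + 1, colour r v b)]) := by
    intro n
    induction n with
    | zero => exact ⟨by simp, by simp⟩
    | succ n ih => rw [Function.iterate_succ_apply']; exact ih.filler
  have h2 : ∀ (l : List ℕ) g, Alternating g → Alternating (l.foldl (attach r v) g) := by
    intro l
    induction l with
    | nil => exact fun g hg => hg
    | cons c l ih => exact fun g hg => ih _ hg.attach
  exact h2 _ _ (h1 _)

theorem gadget_alternates {r : Raw} {v i : ℕ} (hi : i + 1 < (gadget r v).length) :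
    (gadget r v)[i].2 ≠ (gadget r v)[i + 1].2 := by
  have hb : border r v ≠ [] := fun h => by simp [gadget_nil h] at hi
  exact List.isChain_iff_getElem.1 (alternating_gadget hb).2 i hi

theorem self_mem_attach (r : Raw) (v b : ℕ) (g : List (ℕ × Bool)) :
    (b + 1, colour r v b) ∈ attach r v g b := by
  unfold attach
  split <;> simp

theorem subset_attach (r : Raw) (v b : ℕ) (g : List (ℕ × Bool)) : g ⊆ attach r v g b := by
  unfold attach filler
  split <;> intro p hp <;> simp [hp]

theorem mem_gadget_of_border {r : Raw} {v b : ℕ} (h : b ∈ border r v) :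
    (b + 1, colour r v b) ∈ gadget r v := by
  obtain ⟨c, l, hc⟩ := List.exists_cons_of_ne_nil (List.ne_nil_of_mem h)
  rw [gadget_cons hc]
  have h1 : ∀ n, (c + 1, colour r v c) ∈ filler^[n] [(c + 1, colour r v c)] := by
    intro n
    induction n with
    | zero => simp
    | succ n ih => rw [Function.iterate_succ_apply']; exact List.mem_cons_of_mem _ ih
  have h2 : ∀ (l : List ℕ) g, g ⊆ l.foldl (attach r v) g ∧
      ∀ b ∈ l, (b + 1, colour r v b) ∈ l.foldl (attach r v) g := by
    intro l
    induction l with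
    | nil => simp
    | cons d l ih =>
      intro g
      have := ih (attach r v g d)
      refine ⟨List.Subset.trans (subset_attach r v d g) this.1, fun b hb => ?_⟩
      rcases List.mem_cons.1 hb with rfl | hb
      · exact this.1 (self_mem_attach r v b g)
      · exact this.2 b hb
  rw [hc] at h
  rcases List.mem_cons.1 h with rfl | h
  · exact (h2 _ _).1 (h1 _)
  · exact (h2 _ _).2 b h

/-- The border is listed without repetition and each of its vertices is attached once; only the
label `0` of the fillers repeats. As a result, an old vertex gains at most one neighbour. -/
theorem gadget_injective {r : Raw} {v i j : ℕ} (hi : i < (gadget r v).length)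
    (hj : j < (gadget r v).length) (h : (gadget r v)[i].1 = (gadget r v)[j].1)
    (h0 : (gadget r v)[i].1 ≠ 0) : i = j := by
  have hnd : (border r v).Nodup := List.nodup_range.filter _
  have key : (gadget r v).Pairwise fun p q => p.1 ≠ 0 → p.1 ≠ q.1 := by
    cases hb : border r v with
    | nil => simp [gadget_nil hb]
    | cons b l =>
      rw [gadget_cons hb]
      rw [hb, List.nodup_cons] at hnd
      have h1 : ∀ n, (filler^[n] [(b + 1, colour r v b)]).Pairwise
          fun p q => p.1 ≠ 0 → p.1 ≠ q.1 := by
        intro n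
        induction n with
        | zero => simp
        | succ n ih =>
          rw [Function.iterate_succ_apply']
          exact List.pairwise_cons.2 ⟨by simp, ih⟩
      have h2 : ∀ (l : List ℕ) g, l.Nodup → (∀ c ∈ l, ∀ p ∈ g, p.1 ≠ c + 1) →
          (g.Pairwise fun p q => p.1 ≠ 0 → p.1 ≠ q.1) →
          (l.foldl (attach r v) g).Pairwise fun p q => p.1 ≠ 0 → p.1 ≠ q.1 := by
        intro l
        induction l with
        | nil => exact fun g _ _ hg => hg
        | cons c l ih =>
          intro g hnd hl hg
          rw [List.nodup_cons] at hnd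
          refine ih _ hnd.2 (fun d hd p hp => ?_) ?_
          · rcases mem_attach hp with h | h | h
            · omega
            · rw [h]
              have : c ≠ d := fun e => hnd.1 (e ▸ hd)
              simpa using this
            · exact hl d (by simp [hd]) p h
          · unfold attach
            split
            · refine List.pairwise_cons.2 ⟨fun q hq _ => ?_, List.pairwise_cons.2 ⟨by simp, hg⟩⟩
              rcases List.mem_cons.1 hq with rfl | hq
              · simp
              · exact (hl c (by simp) q hq).symm
            · exact List.pairwise_cons.2 ⟨fun q hq _ => (hl c (by simp) q hq).symm, hg⟩
      refine h2 _ _ hnd.2 (fun c hc p hp => ?_) (h1 _)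
      rcases mem_iterate_filler hp with h | h
      · omega
      · have : b ≠ c := fun e => hnd.1 (e ▸ hc)
        rw [List.mem_singleton.1 h]
        simpa using this
  rw [List.pairwise_iff_getElem] at key
  rcases lt_trichotomy i j with hij | hij | hij
  · exact absurd h (key i j hi hj hij h0)
  · exact hij
  · exact absurd h.symm (key j i hj hi hij (h ▸ h0))

/-- The first border vertex is at the bottom of the list and the second one is put on top. This is
needed for `Δ = 2`, where inner vertices of the path have no room for another neighbour. -/
theorem gadget_ends {r : Raw} {v i : ℕ} (hb : (border r v).length ≤ 2)
    (hi : i < (gadget r v).length) (h0 : (gadget r v)[i].1 ≠ 0) :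
    i = 0 ∨ i + 1 = (gadget r v).length := by
  have h1 : ∀ n (b : ℕ) e i (hi : i < (filler^[n] [(b + 1, e)]).length),
      (filler^[n] [(b + 1, e)])[i].1 ≠ 0 → i + 1 = (filler^[n] [(b + 1, e)]).length := by
    intro n b e
    induction n with
    | zero => intro i hi _; simp at hi; simp [hi]
    | succ n ih =>
      simp only [Function.iterate_succ_apply']
      intro i hi h
      cases i with
      | zero => simp [filler] at h
      | succ i =>
        have := ih i (by simpa [filler] using hi) (by simpa [filler] using h)
        simpa [filler] using this
  revert hi h0
  match hm : border r v with
  | [] => rw [gadget_nil hm]; simp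
  | [b] =>
    rw [gadget_cons hm]
    intro hi h0
    exact .inr (h1 _ _ _ _ hi h0)
  | [b, c] =>
    rw [gadget_cons hm]
    simp only [List.foldl_cons, List.foldl_nil]
    have h2 := h1 (threshold r) b (colour r v b)
    generalize filler^[threshold r] [(b + 1, colour r v b)] = g at h2 ⊢
    unfold attach
    split
    · intro hi h0
      match i with
      | 0 => exact .inl rfl
      | 1 => simp [filler] at h0
      | i + 2 =>
        have := h2 i (by simpa [filler] using hi) (by simpa [filler] using h0)
        exact .inr (by simpa [filler] using this)
    · intro hi h0
      match i with
      | 0 => exact .inl rfl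
      | i + 1 =>
        have := h2 i (by simpa using hi) (by simpa using h0)
        exact .inr (by simpa using this)
  | b :: c :: d :: l => rw [hm] at hb; simp at hb

end Raw

/-! ### Replacing a component of an instance -/

namespace TSInstance
open Finset Sliding Relation
variable {I : TSInstance} {v : Fin I.n}

/-- The vertices that are kept when the component of `v` is replaced. -/
noncomputable def keep (I : TSInstance) (v : Fin I.n) : Fin (I.raw.kept v).length ↪ Fin I.n where
  toFun i := ⟨(I.raw.kept v)[i], by
    have := List.mem_of_mem_filter (List.getElem_mem (l := I.raw.kept v) i.2)
    simpa using this⟩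
  inj' i j h := by
    have hnd : (I.raw.kept v).Nodup := List.nodup_range.filter _
    exact Fin.ext ((hnd.getElem_inj_iff).1 (congrArg Fin.val h))

theorem keep_val (i : Fin (I.raw.kept v).length) : ((I.keep v i : Fin I.n) : ℕ) =
    (I.raw.kept v)[i] := rfl

theorem exists_keep_iff {w : Fin I.n} : (∃ i, I.keep v i = w) ↔ w ∉ I.compSet v := by
  have : (w : ℕ) ∈ I.raw.kept v ↔ w ∉ I.compSet v := by
    simp only [Raw.kept, List.mem_filter, List.mem_range, order_raw, w.2, true_and, mem_compSet,
      Bool.not_eq_true', List.any_eq_false, decide_eq_true_eq]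
    exact ⟨fun h h' => h _ h' rfl, fun h x hx e => h (e ▸ hx)⟩
  rw [← this, List.mem_iff_getElem]
  constructor
  · rintro ⟨i, hi⟩
    exact ⟨i, i.2, by rw [← hi]; rfl⟩
  · rintro ⟨i, hi, h⟩
    exact ⟨⟨i, hi⟩, Fin.ext h⟩

theorem mem_compSet_iff {w : Fin I.n} : w ∈ I.compSet v ↔ ∀ i, I.keep v i ≠ w := by
  rw [← not_iff_not, ← exists_keep_iff]
  push Not
  rfl

/-- The new vertex `j` is adjacent to the old vertex `i`. -/
def att (I : TSInstance) (v : Fin I.n) (j : Fin (I.raw.gadget v).length)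
    (i : Fin (I.raw.kept v).length) : Prop := (I.raw.gadget v)[j].1 = (I.raw.kept v)[i] + 1

/-- The graph in which the component of `v` is replaced by its path. -/
noncomputable def newGraph (I : TSInstance) (v : Fin I.n) :
    SimpleGraph (Fin ((I.raw.kept v).length + (I.raw.gadget v).length)) :=
  pathExt (I.G.comap (I.keep v)) (I.att v)

/-- The part of a configuration on the vertices that are kept. -/
noncomputable def old (v : Fin I.n) (X : Finset (Fin I.n)) : Finset (Fin (I.raw.kept v).length) :=
  univ.filter fun i => I.keep v i ∈ X

theorem mem_old {X : Finset (Fin I.n)} {i : Fin (I.raw.kept v).length} :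
    i ∈ old v X ↔ I.keep v i ∈ X := by simp [old]

theorem map_old {X : Finset (Fin I.n)} (hX : ∀ x ∈ X, x ∉ I.compSet v) :
    (old v X).map (I.keep v) = X := by
  ext x
  simp only [mem_map, mem_old]
  constructor
  · rintro ⟨i, hi, rfl⟩; exact hi
  · intro hx
    obtain ⟨i, rfl⟩ := exists_keep_iff.2 (hX x hx)
    exact ⟨i, hx, rfl⟩

theorem isNIndepSet_old {X : Finset (Fin I.n)} (hX : ∀ x ∈ X, x ∉ I.compSet v)
    (h : I.G.IsNIndepSet I.k X) : (I.newGraph v).IsNIndepSet I.k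
      ((old v X).map (Fin.castAddEmb (I.raw.gadget v).length)) := by
  rw [isNIndepSet_iff] at h ⊢
  refine ⟨?_, by rw [card_map, ← card_map (I.keep v), map_old hX, h.2]⟩
  intro x hx y hy hxy
  obtain ⟨i, hi, rfl⟩ := mem_map.1 hx
  obtain ⟨j, hj, rfl⟩ := mem_map.1 hy
  exact h.1 _ (mem_old.1 hi) _ (mem_old.1 hj) ((pathExt_adj_old i j).1 hxy)

theorem notMem_compSet (hI : I.G.IsBipartite) (hv : I.raw.near v = false) {x t : Fin I.n}
    (ht : t ∈ I.S.1 ∪ I.T.1) (hx : x ∈ nbhd I.G t) : x ∉ I.compSet v := by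
  intro h
  rw [mem_compSet, mem_comp_raw hI hv] at h
  have h1 := near_of_reachable hv h
  rw [(I.near_raw x).2 ⟨t, ht, hx⟩] at h1
  exact Bool.noConfusion h1

theorem token_notMem_compSet (hI : I.G.IsBipartite) (hv : I.raw.near v = false) {t : Fin I.n}
    (ht : t ∈ I.S.1 ∪ I.T.1) : t ∉ I.compSet v :=
  notMem_compSet hI hv ht (mem_nbhd.2 (.inl rfl))

/-- The instance in which the component of `v` is replaced by its path. -/
noncomputable def replaceComp (I : TSInstance) (hI : I.G.IsBipartite) (v : Fin I.n)
    (hv : I.raw.near v = false) : TSInstance where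
  n := (I.raw.kept v).length + (I.raw.gadget v).length
  G := I.newGraph v
  k := I.k
  one_le_k := I.one_le_k
  S := ⟨_, isNIndepSet_old (fun _ hx => token_notMem_compSet hI hv (mem_union_left _ hx)) I.S.2⟩
  T := ⟨_, isNIndepSet_old (fun _ hx => token_notMem_compSet hI hv (mem_union_right _ hx)) I.T.2⟩

theorem map_eq_ofFn {α β : Type} (l : List α) (f : α → β) :
    l.map f = List.ofFn fun i : Fin l.length => f l[i] := by
  apply List.ext_getElem <;> simp

theorem range_map_eq_ofFn {β : Type} (n : ℕ) (f : ℕ → β) :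
    (List.range n).map f = List.ofFn fun i : Fin n => f i := by
  apply List.ext_getElem <;> simp

theorem ofFn_eq_append {α : Type} {m n : ℕ} (f : Fin (m + n) → α) : List.ofFn f =
    (List.ofFn fun i => f (Fin.castAdd n i)) ++ List.ofFn fun j => f (Fin.natAdd m j) :=
  List.ofFn_add

theorem truth_eq_iff {P : Prop} {b : Bool} (h : P ↔ b = true) : truth P = b := by
  rw [Bool.eq_iff_iff, truth_eq_true, h]

theorem natAdd_notMem_map {a L : ℕ} (X : Finset (Fin a)) (j : Fin L) :
    Fin.natAdd a j ∉ X.map (Fin.castAddEmb L) := by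
  intro h
  obtain ⟨i, -, hi⟩ := mem_map.1 h
  exact mem_newVerts'.1 (mem_newVerts.2 ⟨j, rfl⟩) i hi

theorem castAdd_mem_map {a L : ℕ} (X : Finset (Fin a)) (i : Fin a) :
    Fin.castAdd L i ∈ X.map (Fin.castAddEmb L) ↔ i ∈ X :=
  mem_map' (Fin.castAddEmb L)

/-- `keep` follows the order of the list `kept`, and the old vertices precede the new ones in
`pathExt`; so the matrix blocks of `Raw.replace` agree entry by entry. -/
theorem raw_replaceComp (hI : I.G.IsBipartite) (hv : I.raw.near v = false) :
    (I.replaceComp hI v hv).raw = I.raw.replace v := by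
  refine Prod.ext rfl (Prod.ext ?_ (Prod.ext ?_ ?_))
  · change List.ofFn (fun i => List.ofFn fun j => truth ((I.newGraph v).Adj i j)) = _
    unfold newGraph
    simp only [Raw.replace, ofFn_eq_append, map_eq_ofFn (I.raw.kept v),
      map_eq_ofFn (I.raw.gadget v), range_map_eq_ofFn, pathExt_adj_old, pathExt_adj_old_new,
      pathExt_adj_new_old, pathExt_adj_new]
    congr 2
    · funext i
      congr 2
      · funext j
        exact truth_eq_iff (I.adj_raw (I.keep v i) (I.keep v j)).symm
      · funext j
        exact truth_eq_iff (by simp [att])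
    · funext i
      congr 2
      · funext j
        refine truth_eq_iff ?_
        rw [List.getD_eq_getElem _ _ i.2]
        simp [att]
      · funext j
        exact truth_eq_iff (by simp)
  all_goals
    change List.ofFn (fun i => truth (i ∈ (old v _).map (Fin.castAddEmb _))) = _
    simp only [Raw.replace, ofFn_eq_append, map_eq_ofFn (I.raw.kept v),
      map_eq_ofFn (I.raw.gadget v), castAdd_mem_map, mem_old]
    congr 2
    · funext i
      exact (getD_ofFn (fun i => truth (i ∈ _)) false (I.keep v i)).symm
    · funext j
      exact truth_eq_iff (iff_of_false (natAdd_notMem_map _ j) Bool.false_ne_true)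

/-- The vertices outside of the component of `v` that are adjacent to it. -/
noncomputable def borderSet (v : Fin I.n) : Finset (Fin (I.raw.kept v).length) :=
  univ.filter fun i => (I.raw.kept v)[i] ∈ I.raw.border v

theorem mem_borderSet {i : Fin (I.raw.kept v).length} :
    i ∈ borderSet v ↔ ((I.keep v i : Fin I.n) : ℕ) ∈ I.raw.border v := by
  simp [borderSet, keep_val]

theorem keep_notMem (i : Fin (I.raw.kept v).length) : I.keep v i ∉ I.compSet v :=
  exists_keep_iff.1 ⟨i, rfl⟩

theorem mem_borderSet_iff (hI : I.G.IsBipartite) (hv : I.raw.near v = false)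
    (i : Fin (I.raw.kept v).length) :
    i ∈ borderSet v ↔ ∃ c ∈ I.compSet v, I.G.Adj (I.keep v i) c := by
  rw [mem_borderSet, mem_border_raw hI hv]
  exact ⟨fun h => h.2, fun h => ⟨keep_notMem i, h⟩⟩

theorem att_iff {j : Fin (I.raw.gadget v).length} {i : Fin (I.raw.kept v).length} :
    I.att v j i ↔ ((I.keep v i : Fin I.n) : ℕ) ∈ I.raw.border v ∧
      (I.raw.gadget v)[j] = (((I.keep v i : Fin I.n) : ℕ) + 1, I.raw.colour v (I.keep v i)) := by
  rw [keep_val, att]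
  constructor
  · intro h
    rcases Raw.mem_gadget (List.getElem_mem (l := I.raw.gadget v) j.2) with h' | ⟨b, hb, h'⟩
    · have : (I.raw.gadget v)[j].1 = 0 := h'
      omega
    · have h2 : (I.raw.gadget v)[j] = (b + 1, I.raw.colour v b) := h'
      rw [h2] at h ⊢
      have : b = (I.raw.kept v)[i] := by simpa using h
      rw [← this]
      exact ⟨hb, rfl⟩
  · rintro ⟨-, h⟩
    rw [h]

theorem mem_borderSet_iff' (i : Fin (I.raw.kept v).length) :
    i ∈ borderSet v ↔ ∃ c ∈ newVerts (I.raw.kept v).length (I.raw.gadget v).length,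
      (I.newGraph v).Adj (Fin.castAddEmb _ i) c := by
  rw [mem_borderSet]
  constructor
  · intro h
    obtain ⟨j, hj, e⟩ := List.mem_iff_getElem.1 (Raw.mem_gadget_of_border h)
    exact ⟨Fin.natAdd _ ⟨j, hj⟩, mem_newVerts.2 ⟨_, rfl⟩,
      (pathExt_adj_old_new i ⟨j, hj⟩).2 (att_iff.2 ⟨h, e⟩)⟩
  · rintro ⟨c, hc, h⟩
    obtain ⟨j, rfl⟩ := mem_newVerts.1 hc
    exact (att_iff.1 ((pathExt_adj_old_new i j).1 h)).1

/-- The colours stored in the path are relative to `v`; adding the colour of `v` makes them extend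
the given colouring of the old vertices. -/
theorem isBipartite_newGraph (hI : I.G.IsBipartite) (hv : I.raw.near v = false) :
    (I.newGraph v).IsBipartite := by
  obtain ⟨c, hc⟩ := isBipartite_iff.1 hI
  refine isBipartite_pathExt (fun i => c (I.keep v i)) (fun j => (I.raw.gadget v)[j].2 ^^ c v)
    (fun i j h => hc _ _ h) (fun i j h h' => ?_) fun j i h => ?_
  · have h1 := Raw.gadget_alternates (r := I.raw) (v := v) (i := i) (by rw [h]; exact j.2)
    have h2 : (I.raw.gadget v)[(i : ℕ) + 1]'(by rw [h]; exact j.2) = (I.raw.gadget v)[j] := by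
      simp [h]
    rw [h2] at h1
    exact h1 (by simpa using h')
  · obtain ⟨h1, h2⟩ := att_iff.1 h
    rw [h2, colour_raw hI hc hv h1]
    cases c (I.keep v i) <;> cases c v <;> simp

theorem card_border (hI : I.G.IsBipartite) (hv : I.raw.near v = false) {D : ℕ}
    (hD : ∀ w, (nbhd I.G w).card ≤ D) :
    3 * (I.compSet v).card + (I.raw.border v).length ≤ D * (I.compSet v).card + 2 := by
  have hnd : (I.raw.border v).Nodup := List.nodup_range.filter _
  have hlt : ∀ b ∈ I.raw.border v, b < I.n := fun b hb => by simpa using Raw.mem_border_lt hb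
  have hcard : (univ.filter fun b : Fin I.n => (b : ℕ) ∈ I.raw.border v).card =
      (I.raw.border v).length := by
    rw [← List.toFinset_card_of_nodup hnd, ← card_map Fin.valEmbedding]
    congr 1
    ext b
    simp only [mem_map, mem_filter, mem_univ, true_and, Fin.valEmbedding_apply, List.mem_toFinset]
    exact ⟨fun ⟨b, hb, e⟩ => e ▸ hb, fun hb => ⟨⟨b, hlt b hb⟩, hb, rfl⟩⟩
  rw [← hcard]
  refine (conn_compSet hI hv).card_add_le
    ⟨v, mem_compSet.2 ((mem_comp_raw hI hv).2 (.refl v))⟩ (fun b hb => ?_) hD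
  obtain ⟨h1, c, hc, h2⟩ := (mem_border_raw hI hv).1 (by simpa using hb)
  exact ⟨h1, c, hc, h2.symm⟩

theorem card_nbhd_newGraph (hI : I.G.IsBipartite) (hv : I.raw.near v = false)
    (hlarge : (I.raw.gadget v).length < (I.raw.comp v).length) {D : ℕ}
    (hD : ∀ w, (nbhd I.G w).card ≤ D) (x) : (nbhd (I.newGraph v) x).card ≤ D := by
  have hcard := card_border hI hv hD
  have hD1 : 1 ≤ D := (card_pos.2 ⟨v, mem_nbhd.2 (.inl rfl)⟩).trans_le (hD v)
  have hsub : ∀ i, (nbhd (I.G.comap (I.keep v)) i).map (I.keep v) ⊆ nbhd I.G (I.keep v i) := by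
    intro i w hw
    obtain ⟨j, hj, rfl⟩ := mem_map.1 hw
    rcases mem_nbhd.1 hj with rfl | hj
    · exact mem_nbhd.2 (.inl rfl)
    · exact mem_nbhd.2 (.inr hj)
  -- A path that is not empty comes from a nonempty border, so it has at least `threshold` vertices,
  -- which is at least 4 as `k` and `width` are positive.
  have hgL : 0 < (I.raw.gadget v).length → 4 ≤ (I.raw.gadget v).length := by
    intro h
    have hb : I.raw.border v ≠ [] := fun h' => by simp [Raw.gadget_nil h'] at h
    refine le_trans ?_ (Raw.length_gadget_ge hb)
    have hw := one_le_width I.raw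
    have h3 : 1 ≤ I.raw.width * I.raw.width * I.raw.width :=
      Nat.mul_pos (Nat.mul_pos hw hw) hw
    calc 4 = 4 * 1 * 1 := rfl
      _ ≤ _ := Nat.mul_le_mul (Nat.mul_le_mul_left _ I.one_le_k) h3
  rw [card_compSet] at hcard
  -- For `D ≤ 2` the count of edges gives a component of at most two vertices, but it is larger than
  -- a path with four.
  have hD3 : 0 < (I.raw.gadget v).length → 3 ≤ D := by
    intro h
    have := hgL h
    by_contra hlt
    have : D * (I.raw.comp v).length ≤ 2 * (I.raw.comp v).length :=
      Nat.mul_le_mul_right _ (by omega)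
    omega
  refine card_nbhd_pathExt (fun i => ?_) (fun j i h => ?_) (fun j j' i h h' => ?_)
    (fun j i i' h h' => ?_) hD3 (fun j i h => ?_) x
  · rw [← card_map (I.keep v)]
    exact (card_le_card (hsub i)).trans (hD _)
  -- A border vertex loses its neighbour `c` in the component, which makes room for the new
  -- neighbour on the path.
  · obtain ⟨c, hc, hic⟩ := (mem_borderSet_iff hI hv i).1 (mem_borderSet.2 (att_iff.1 h).1)
    rw [← card_map (I.keep v)]
    refine le_trans (card_lt_card ((ssubset_iff_of_subset (hsub i)).2
      ⟨c, mem_nbhd.2 (.inr hic), fun hc' => ?_⟩)) (hD (I.keep v i))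
    obtain ⟨j, -, rfl⟩ := mem_map.1 hc'
    exact keep_notMem j hc
  · have h1 := (att_iff.1 h).2
    have h2 := (att_iff.1 h').2
    refine Fin.ext (Raw.gadget_injective j.2 j'.2 ?_ ?_)
    · exact congrArg Prod.fst (h1.trans h2.symm)
    · have : (I.raw.gadget v)[j].1 ≠ 0 := by rw [h1]; simp
      exact this
  · have h1 := (att_iff.1 h).2
    have h2 := (att_iff.1 h').2
    rw [h1] at h2
    have := congrArg Prod.fst h2
    exact (I.keep v).injective (Fin.ext (by simpa using this))
  -- In the remaining case `D = 3`, `card_border` leaves at most two border vertices, and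
  -- `gadget_ends` places them.
  · by_cases h4 : 4 ≤ D
    · exact .inr (.inr h4)
    · have hj := j.2
      have hD3' := hD3 (by omega)
      obtain rfl : D = 3 := by omega
      have h1 : (I.raw.gadget v)[j].1 ≠ 0 := by rw [(att_iff.1 h).2]; simp
      rcases Raw.gadget_ends (r := I.raw) (v := v) (by omega) hj h1 with h | h
      · exact .inl h
      · exact .inr (.inl h)

/-- If there is a border, the path has at least `threshold` vertices and the component has more. As
`width` bounds the closed neighbourhoods in both graphs, both sets are absorbing, and they have the
same border. The tokens of `S` and `T` avoid this border because the component contains no near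
vertex. -/
theorem isYes_replaceComp (hI : I.G.IsBipartite) (hv : I.raw.near v = false)
    (hlarge : (I.raw.gadget v).length < (I.raw.comp v).length) :
    (I.replaceComp hI v hv).IsYes ↔ I.IsYes := by
  have hDI := I.card_nbhd_le_width
  have hDJ := card_nbhd_newGraph hI hv hlarge hDI
  have hw := one_le_width I.raw
  have hnS : ∀ x ∈ I.S.1, x ∉ I.compSet v := fun x hx =>
    token_notMem_compSet hI hv (mem_union_left _ hx)
  have hnT : ∀ x ∈ I.T.1, x ∉ I.compSet v := fun x hx =>
    token_notMem_compSet hI hv (mem_union_right _ hx)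
  have hdisj : ∀ X ⊆ I.S.1 ∪ I.T.1, Disjoint (old v X) (borderSet v) := by
    intro X hX
    refine disjoint_left.2 fun i hi hb => ?_
    obtain ⟨c, hc, hic⟩ := (mem_borderSet_iff hI hv i).1 hb
    exact notMem_compSet hI hv (hX (mem_old.1 hi)) (mem_nbhd.2 (.inr hic)) hc
  have hcardS : (old v I.S.1).card = I.k := by
    rw [← card_map (I.keep v), map_old hnS, I.S.2.card_eq]
  have hth : (borderSet v : Finset (Fin (I.raw.kept v).length)).Nonempty →
      4 * I.k * (I.raw.width * I.raw.width * I.raw.width) ≤ (I.raw.gadget v).length := by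
    rintro ⟨i, hi⟩
    exact Raw.length_gadget_ge (List.ne_nil_of_mem (mem_borderSet.1 hi))
  rw [isYes_iff, isYes_iff]
  have key := reach_iff_of_absorbing (G := I.G) (G' := I.newGraph v) (C := I.compSet v)
    (C' := newVerts _ _) (ι := I.keep v) (ι' := Fin.castAddEmb _) (B := borderSet v)
    (S := old v I.S.1) (T := old v I.T.1) (fun a b => (pathExt_adj_old (H := I.G.comap (I.keep v)) (att := I.att v) a b).symm)
    (fun _ => mem_compSet_iff) (fun _ => mem_newVerts') (mem_borderSet_iff hI hv)
    mem_borderSet_iff' (hdisj _ subset_union_left) (hdisj _ subset_union_right)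
    (fun hb => ?_) fun hb => ?_
  · rw [map_old hnS, map_old hnT] at key
    exact key
  · rw [hcardS]
    refine (conn_compSet hI hv).absorbing hDI hw I.one_le_k ?_
    rw [card_compSet]
    exact (hth hb).trans hlarge.le
  · rw [hcardS]
    refine conn_newVerts.absorbing hDJ hw I.one_le_k ?_
    rw [card_newVerts]
    exact hth hb

end TSInstance

/-! ## The kernel -/

namespace TSInstance
open Finset Sliding Relation

/-- `J` is a yes-instance if and only if `I` is one, and bounds on the degrees of `I` hold
for `J`. -/
structure Equivalent (I J : TSInstance) : Prop where
  isYes : J.IsYes ↔ I.IsYes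
  bipartite : J.G.IsBipartite
  maxDegree : ∀ d, I.maxDegree ≤ d → J.maxDegree ≤ d
  k_eq : J.k = I.k

theorem exists_shrink {I : TSInstance} (hI : I.G.IsBipartite) :
    ∃ J : TSInstance, J.raw = I.raw.shrink ∧ Equivalent I J := by
  by_cases h : I.raw.large = []
  · exact ⟨I, (Raw.shrink_eq_self h).symm, Iff.rfl, hI, fun _ h => h, rfl⟩
  · obtain ⟨v, l, hl⟩ := List.exists_cons_of_ne_nil h
    have hv : v ∈ I.raw.large := by simp [hl]
    obtain ⟨hlt, hnear, hlarge⟩ := Raw.mem_large.1 hv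
    rw [order_raw] at hlt
    lift v to Fin I.n using hlt
    refine ⟨I.replaceComp hI v hnear, ?_, isYes_replaceComp hI hnear hlarge,
      isBipartite_newGraph hI hnear, fun d hd => ?_, rfl⟩
    · rw [raw_replaceComp, Raw.shrink, hl]
      rfl
    · rw [maxDegree_le_iff] at hd ⊢
      exact card_nbhd_newGraph hI hnear hlarge hd

theorem exists_iterate_shrink {I : TSInstance} (hI : I.G.IsBipartite) (m : ℕ) :
    ∃ J : TSInstance, J.raw = Raw.shrink^[m] I.raw ∧ Equivalent I J := by
  induction m with
  | zero => exact ⟨I, rfl, Iff.rfl, hI, fun _ h => h, rfl⟩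
  | succ m ih =>
    obtain ⟨J, hJ, h⟩ := ih
    obtain ⟨J', hJ', h'⟩ := exists_shrink h.bipartite
    exact ⟨J', by rw [Function.iterate_succ_apply', hJ', hJ], h'.isYes.trans h.isYes, h'.bipartite,
      fun d hd => h'.maxDegree d (h.maxDegree d hd), h'.k_eq.trans h.k_eq⟩

/-- Each round with a large component left removes a vertex, so after `order` rounds either none is
left or the graph is empty. -/
theorem large_kernel (r : Raw) : r.kernel.large = [] := by
  have key : ∀ m, (Raw.shrink^[m] r).large = [] ∨ (Raw.shrink^[m] r).order + m ≤ r.order := by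
    intro m
    induction m with
    | zero => exact .inr le_rfl
    | succ m ih =>
      rw [Function.iterate_succ_apply']
      by_cases h : (Raw.shrink^[m] r).large = []
      · rw [Raw.shrink_eq_self h]; exact .inl h
      · have := Raw.order_shrink_lt h
        exact .inr (by have := ih.resolve_left h; omega)
  rcases key r.order with h | h
  · exact h
  · have h0 : r.kernel.order = 0 := by unfold Raw.kernel; omega
    simp [Raw.large, h0]

/-! ### The size of the kernel -/

variable {I : TSInstance}

/-- The vertices that carry a token or are adjacent to one. -/
noncomputable def nearSet (I : TSInstance) : Finset (Fin I.n) := (I.S.1 ∪ I.T.1).biUnion (nbhd I.G)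

theorem mem_nearSet {i : Fin I.n} : i ∈ I.nearSet ↔ I.raw.near i = true := by
  rw [near_raw, nearSet, mem_biUnion]

theorem card_nearSet_le {D : ℕ} (hD : ∀ v, (nbhd I.G v).card ≤ D) :
    I.nearSet.card ≤ 2 * I.k * D := by
  refine (card_biUnion_le_card_mul _ _ D fun v _ => hD v).trans (Nat.mul_le_mul_right _ ?_)
  refine (card_union_le _ _).trans ?_
  rw [I.S.2.card_eq, I.T.2.card_eq]
  omega

theorem length_border_le_card (v : ℕ) : (I.raw.border v).length ≤ I.nearSet.card := by
  have hnd : (I.raw.border v).Nodup := List.nodup_range.filter _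
  rw [← List.toFinset_card_of_nodup hnd, ← card_map Fin.valEmbedding]
  refine card_le_card fun b hb => ?_
  rw [List.mem_toFinset] at hb
  have hlt : b < I.n := by simpa using Raw.mem_border_lt hb
  exact mem_map.2 ⟨⟨b, hlt⟩, mem_nearSet.2 (near_of_mem_border hb), rfl⟩

theorem card_compSet_le (hlarge : I.raw.large = []) {d : ℕ}
    (hD : ∀ v, (nbhd I.G v).card ≤ d + 1) {v : Fin I.n} (hv : I.raw.near v = false) :
    (I.compSet v).card ≤ 4 * I.k * ((d + 1) * (d + 1) * (d + 1)) + 4 * I.k * (d + 1) := by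
  have h1 : ¬ (I.raw.gadget v).length < (I.raw.comp v).length := fun h => by
    have : (v : ℕ) ∈ I.raw.large := Raw.mem_large.2 ⟨by simp, hv, h⟩
    simp [hlarge] at this
  have h2 := Raw.length_gadget_le I.raw v
  have h3 : I.raw.threshold ≤ 4 * I.k * ((d + 1) * (d + 1) * (d + 1)) := by
    have := I.width_raw_le hD
    exact Nat.mul_le_mul_left _ (Nat.mul_le_mul (Nat.mul_le_mul this this) this)
  have h4 := (I.length_border_le_card v).trans (card_nearSet_le hD)
  rw [card_compSet]
  have : 2 * (2 * I.k * (d + 1)) = 4 * I.k * (d + 1) := by ring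
  omega

theorem n_le_of_large_eq_nil (hI : I.G.IsBipartite) (hlarge : I.raw.large = []) {d : ℕ}
    (hd1 : 1 ≤ d) (hd : I.maxDegree ≤ d) : I.n ≤ 576 * (I.k ^ 2 * d ^ 5) := by
  classical
  have hD := (I.maxDegree_le_iff d).1 hd
  -- `P` meets every component: if the border were empty, so would be the path, and the component
  -- would count as large. So `|P|` bounds the number of components.
  let P : Finset (Fin I.n) := (I.nearSet.biUnion (nbhd I.G)).filter
    fun c : Fin I.n => I.raw.near c = false
  let Q : Finset (Fin I.n) := P.biUnion fun c : Fin I.n => I.compSet c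
  have hcover : (univ : Finset (Fin I.n)) ⊆ I.nearSet ∪ Q := by
    intro v _
    by_cases hv : v ∈ I.nearSet
    · exact mem_union_left _ hv
    · have hv' : I.raw.near v = false := by simpa [mem_nearSet] using hv
      have hvv : v ∈ I.compSet v := mem_compSet.2 ((mem_comp_raw hI hv').2 (.refl v))
      have h1 : ¬ (I.raw.gadget v).length < (I.raw.comp v).length := fun h => by
        have : (v : ℕ) ∈ I.raw.large := Raw.mem_large.2 ⟨by simp, hv', h⟩
        simp [hlarge] at this
      have h2 := card_pos.2 ⟨v, hvv⟩
      rw [card_compSet] at h2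
      have h3 : I.raw.border v ≠ [] := fun h => by
        rw [Raw.gadget_nil h] at h1
        exact h1 h2
      obtain ⟨b, hb⟩ := List.exists_mem_of_ne_nil _ h3
      have hlt : b < I.n := by simpa using Raw.mem_border_lt hb
      lift b to Fin I.n using hlt
      obtain ⟨-, c, hc, hbc⟩ := (mem_border_raw hI hv').1 hb
      have hr := (mem_comp_raw hI hv').1 (mem_compSet.1 hc)
      have hc' := near_of_reachable hv' hr
      refine mem_union_right _ (mem_biUnion.2 ⟨c, ?_, mem_compSet.2
        ((mem_comp_raw hI hc').2 hr.symm)⟩)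
      exact mem_filter.2 ⟨mem_biUnion.2 ⟨b, mem_nearSet.2 (near_of_mem_border hb),
        mem_nbhd.2 (.inr hbc)⟩, hc'⟩
  have h1 := card_le_card hcover
  rw [card_univ, Fintype.card_fin] at h1
  set M := 4 * I.k * ((d + 1) * (d + 1) * (d + 1)) + 4 * I.k * (d + 1)
  have h2 : Q.card ≤ 2 * I.k * (d + 1) * (d + 1) * M := by
    refine (card_biUnion_le_card_mul _ _ M fun c hc =>
      card_compSet_le hlarge hD (mem_filter.1 hc).2).trans (Nat.mul_le_mul_right _ ?_)
    refine (card_filter_le _ _).trans ?_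
    exact (card_biUnion_le_card_mul _ _ _ fun v _ => hD v).trans
      (Nat.mul_le_mul_right _ (card_nearSet_le hD))
  have h3 := card_nearSet_le hD
  have h4 : I.n ≤ 2 * I.k * (d + 1) + 2 * I.k * (d + 1) * (d + 1) * M :=
    h1.trans ((card_union_le _ _).trans (add_le_add h3 h2))
  have hk := I.one_le_k
  refine h4.trans ?_
  have e : ∀ k : ℕ, 1 ≤ k → 2 * k * (d + 1) + 2 * k * (d + 1) * (d + 1) *
      (4 * k * ((d + 1) * (d + 1) * (d + 1)) + 4 * k * (d + 1)) ≤ 18 * (k ^ 2 * (d + 1) ^ 5) := by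
    intro k hk
    have hk2 : k * 1 ≤ k * k := Nat.mul_le_mul_left _ hk
    have a1 : (d + 1) ^ 1 ≤ (d + 1) ^ 5 := Nat.pow_le_pow_right (by omega) (by omega)
    have a3 : (d + 1) ^ 3 ≤ (d + 1) ^ 5 := Nat.pow_le_pow_right (by omega) (by omega)
    have b1 : k * (d + 1) ^ 1 ≤ k ^ 2 * (d + 1) ^ 5 :=
      Nat.mul_le_mul (by rw [pow_two]; simpa using hk2) a1
    have b3 : k ^ 2 * (d + 1) ^ 3 ≤ k ^ 2 * (d + 1) ^ 5 := Nat.mul_le_mul_left _ a3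
    calc _ = 2 * (k * (d + 1) ^ 1) + 8 * (k ^ 2 * (d + 1) ^ 5) + 8 * (k ^ 2 * (d + 1) ^ 3) := by
          ring
      _ ≤ _ := by omega
  refine (e I.k hk).trans ?_
  -- Here `1 ≤ d` is used; the constant is `18 * 2 ^ 5 = 576`.
  have h5 : (d + 1) ^ 5 ≤ (2 * d) ^ 5 := Nat.pow_le_pow_left (by omega) 5
  calc 18 * (I.k ^ 2 * (d + 1) ^ 5) ≤ 18 * (I.k ^ 2 * (2 * d) ^ 5) :=
        Nat.mul_le_mul_left _ (Nat.mul_le_mul_left _ h5)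
    _ = 576 * (I.k ^ 2 * d ^ 5) := by ring

/-- The kernel of an instance on a bipartite graph. -/
theorem exists_kernel (hI : I.G.IsBipartite) : ∃ J : TSInstance, J.raw = I.raw.kernel ∧
    Equivalent I J ∧ J.n ≤ I.n ∧ ∀ d, 1 ≤ d → I.maxDegree ≤ d → J.n ≤ 576 * (I.k ^ 2 * d ^ 5) := by
  obtain ⟨J, hJ, h⟩ := exists_iterate_shrink hI I.raw.order
  refine ⟨J, hJ, h, ?_, fun d hd1 hd => ?_⟩
  · have key : ∀ m, (Raw.shrink^[m] I.raw).order ≤ I.raw.order := by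
      intro m
      induction m with
      | zero => exact le_rfl
      | succ m ih => rw [Function.iterate_succ_apply']; exact (Raw.order_shrink_le _).trans ih
    have := key I.raw.order
    rw [← hJ, order_raw, order_raw] at this
    exact this
  · rw [← h.k_eq]
    refine n_le_of_large_eq_nil h.bipartite ?_ hd1 (h.maxDegree d hd)
    rw [hJ]
    exact large_kernel I.raw

/-- The kernelization. -/
theorem exists_kernelization : ∃ (kernelization : TreeProg) (p : Polynomial ℕ),
    ∀ I : TSInstance, I.G.IsBipartite → ∃ (J : TSInstance) (t : ℕ),
      kernelization.Eval I.encode J.encode t ∧ t ≤ p.eval I.n ∧ Equivalent I J ∧ J.n ≤ I.n ∧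
      ∀ d, 1 ≤ d → I.maxDegree ≤ d → J.n ≤ 576 * (I.k ^ 2 * d ^ 5) := by
  obtain ⟨p, q, hp⟩ := Raw.poly_kernel
  refine ⟨p, q, fun I hI => ?_⟩
  obtain ⟨J, hJ, h⟩ := exists_kernel hI
  obtain ⟨t, ht, htq⟩ := hp I.raw I.n ⟨I.k_le_n, by simp⟩
  rw [← hJ, enc_raw, enc_raw] at ht
  exact ⟨J, t, ht, htq, h⟩

end TSInstance

/-! ## Sets of bit strings as tries -/

namespace Trie

/-- the subtree for a bit -/
def child (t : BinaryTree Unit) (b : Bool) : BinaryTree Unit := if b then t.right else t.left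

/-- the trie whose subtree for the bit `b` is `t` and whose other subtree is `s` -/
def join (t : BinaryTree Unit) (p : Bool × BinaryTree Unit) : BinaryTree Unit :=
  if p.1 then .node () p.2 t else .node () t p.2

/-- whether a tree is the leaf -/
def isNil : BinaryTree Unit → Bool
  | .nil => true
  | .node .. => false

/-- whether the trie contains the string -/
def contains (t : BinaryTree Unit) (X : List Bool) : Bool := !isNil (X.foldl child t)

/-- One step down in the trie `s.1`, which records the bit and the other subtree in the
stack `s.2`. -/
def descend (s : BinaryTree Unit × List (Bool × BinaryTree Unit)) (b : Bool) :
    BinaryTree Unit × List (Bool × BinaryTree Unit) := (child s.1 b, (b, child s.1 !b) :: s.2)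

/-- adds a string to the trie -/
def insert (t : BinaryTree Unit) (X : List Bool) : BinaryTree Unit :=
  (X.foldl descend (t, [])).2.foldl join (.node () .nil .nil)

theorem child_join_self (t s : BinaryTree Unit) (b : Bool) : child (join t (b, s)) b = t := by
  cases b <;> rfl

theorem child_join_of_ne (t s : BinaryTree Unit) {b c : Bool} (h : c ≠ b) :
    child (join t (b, s)) c = s := by
  cases b <;> cases c <;> first | rfl | exact absurd rfl h

theorem foldl_descend (X : List Bool) (t t' : BinaryTree Unit)
    (st : List (Bool × BinaryTree Unit)) :
    (X.foldl descend (t, st)).2.foldl join t' =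
      st.foldl join ((X.foldl descend (t, [])).2.foldl join t') := by
  have : ∀ (X : List Bool) t st, (X.foldl descend (t, st)).2 =
      (X.foldl descend (t, [])).2 ++ st := by
    intro X
    induction X with
    | nil => simp
    | cons b X ih =>
      intro t st
      simp only [List.foldl_cons, descend]
      rw [ih _ (_ :: st), ih _ [_]]
      simp
  rw [this, List.foldl_append]

theorem insert_cons (t : BinaryTree Unit) (b : Bool) (X : List Bool) :
    insert t (b :: X) = join (insert (child t b) X) (b, child t !b) := by
  unfold insert
  simp only [List.foldl_cons, descend]
  rw [foldl_descend]
  rfl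

/-- A trie also contains the prefixes of its strings, and an insertion cuts off whatever extends the
new string. The assumption of equal lengths excludes both effects. -/
theorem contains_insert (t : BinaryTree Unit) (X Y : List Bool) (h : X.length = Y.length) :
    contains (insert t X) Y = true ↔ Y = X ∨ contains t Y = true := by
  induction X generalizing t Y with
  | nil =>
    obtain rfl : Y = [] := List.length_eq_zero_iff.1 h.symm
    simp [contains, insert, isNil]
  | cons b X ih =>
    cases Y with
    | nil => simp at h
    | cons c Y =>
      have e : ∀ t, contains t (c :: Y) = contains (child t c) Y := fun _ => rfl
      rw [insert_cons, e, e t]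
      by_cases hbc : c = b
      · subst hbc
        rw [child_join_self, ih _ _ (by simpa using h)]
        simp
      · rw [child_join_of_ne _ _ hbc]
        have : c = !b := by cases b <;> cases c <;> simp_all
        simp [this]

theorem contains_nil (X : List Bool) : contains .nil X = false := by
  have : X.foldl child .nil = .nil := by
    induction X with
    | nil => rfl
    | cons b X ih => cases b <;> exact ih
  simp [contains, this, isNil]

section Time
variable {α : Type} [TEnc α] {Γ : α → ℕ → Prop}

theorem poly_child {t : α → BinaryTree Unit} {b : α → Bool} (ht : PolyTime Γ t)
    (hb : PolyTime Γ b) : PolyTime Γ fun a => child (t a) (b a) :=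
  hb.ite' ht.treeRight ht.treeLeft

theorem poly_contains {t : α → BinaryTree Unit} {X : α → List Bool} (ht : PolyTime Γ t)
    (hX : PolyTime Γ X) (hlen : PolyBdd Γ fun a => (X a).length) :
    PolyTime Γ fun a => contains (t a) (X a) :=
  ((hX.foldl' (f := fun _ t b => child t b) ht hlen
    (poly_child PolyTime.id'.snd.fst PolyTime.id'.snd.snd)).isLeaf (g := fun a =>
      isNil ((X a).foldl child (t a))) fun a => by
        cases (X a).foldl child (t a) <;> simp [isNil, TEnc.enc]).not

theorem poly_insert {t : α → BinaryTree Unit} {X : α → List Bool} (ht : PolyTime Γ t)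
    (hX : PolyTime Γ X) (hlen : PolyBdd Γ fun a => (X a).length) :
    PolyTime Γ fun a => insert (t a) (X a) := by
  have h1 : PolyTime Γ fun a => ((X a).foldl descend (t a, [])).2 :=
    (hX.foldl' (f := fun _ s b => descend s b) (ht.prod .nil) hlen
      ((poly_child PolyTime.id'.snd.fst.fst PolyTime.id'.snd.snd).prod
        ((PolyTime.id'.snd.snd.prod (poly_child PolyTime.id'.snd.fst.fst
          PolyTime.id'.snd.snd.not)).cons PolyTime.id'.snd.fst.snd))).snd
  refine h1.foldl' (f := fun _ t p => join t p) (PolyTime.leaf.node .leaf) ?_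
    (PolyTime.id'.snd.snd.fst.ite' (PolyTime.id'.snd.snd.snd.node PolyTime.id'.snd.fst)
      (PolyTime.id'.snd.fst.node PolyTime.id'.snd.snd.snd))
  have : ∀ (X : List Bool) s, (X.foldl descend s).2.length = s.2.length + X.length := by
    intro X
    induction X with
    | nil => simp
    | cons b X ih => intro s; simp [ih, descend]; omega
  simpa [this] using hlen

end Time
end Trie

/-! ## The search, as a function on raw instances -/

namespace Raw

/-- whether the token on `u` can slide to `v` -/
def canSlide (r : Raw) (X : List Bool) (u v : ℕ) : Bool :=
  (X.getD u false && !X.getD v false) && (adj r u v &&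
    !(List.range r.order).any fun w => (X.getD w false && adj r v w) && !decide (w = u))

/-- the configuration in which the token on `u` has moved to `v` -/
def slide (r : Raw) (X : List Bool) (u v : ℕ) : List Bool :=
  (List.range r.order).map fun w => decide (w = v) || (X.getD w false && !decide (w = u))

/-- all configurations that arise from `X` by one slide -/
def slides (r : Raw) (X : List Bool) : List (List Bool) :=
  (List.range r.order).flatMap fun u =>
    ((List.range r.order).filter fun v => canSlide r X u v).map fun v => slide r X u v

/-- The states of the search: the set of the configurations found so far, and the list of those
that remain to be explored. -/
abbrev Search := BinaryTree Unit × List (List Bool)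

/-- register a configuration, unless it is known -/
def visit (s : Search) (Y : List Bool) : Search :=
  if Trie.contains s.1 Y then s else (Trie.insert s.1 Y, Y :: s.2)

/-- explore a configuration -/
def explore (r : Raw) (s : Search) : Search := (slides r (s.2.headD [])).foldl visit (s.1, s.2.tail)

/-- the first state of the search -/
def start (r : Raw) : Search := visit (.nil, []) r.2.2.1

theorem length_slide (r : Raw) (X : List Bool) (u v : ℕ) : (slide r X u v).length = r.order := by
  simp [slide]

theorem length_of_mem_slides {r : Raw} {X Y : List Bool} (h : Y ∈ slides r X) :
    Y.length = r.order := by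
  simp only [slides, List.mem_flatMap, List.mem_map] at h
  obtain ⟨u, -, v, -, rfl⟩ := h
  exact length_slide r X u v

section Time
variable {α : Type} [TEnc α] {Γ : α → ℕ → Prop} {r : α → Raw}

theorem poly_slides {X : α → List Bool} (hr : RawCtx Γ r) (hX : PolyTime Γ X) :
    PolyTime Γ fun a => slides (r a) (X a) := by
  have hV := list_vertices hr
  have hr1 := hr.fst (γ := ℕ) (Γ' := fun p N => Γ p.1 N ∧ p.2 ∈ List.range (r p.1).order)
    fun _ _ h => h.1
  have hX1 : PolyTime (fun (p : α × ℕ) N => Γ p.1 N ∧ p.2 ∈ List.range (r p.1).order)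
    fun p => X p.1 := hX.comp PolyTime.id'.fst fun _ _ h => h.1
  have hu := hV.mem
  have hV1 := list_vertices hr1
  have hr2 := hr1.fst (γ := ℕ) (Γ' := fun p N => (Γ p.1.1 N ∧
    p.1.2 ∈ List.range (r p.1.1).order) ∧ p.2 ∈ List.range (r p.1.1).order) fun _ _ h => h.1
  have hX2 : PolyTime (fun (p : (α × ℕ) × ℕ) N => (Γ p.1.1 N ∧
    p.1.2 ∈ List.range (r p.1.1).order) ∧ p.2 ∈ List.range (r p.1.1).order)
    fun p => X p.1.1 := hX1.comp PolyTime.id'.fst fun _ _ h => h.1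
  have hu2 := hu.fst (γ := ℕ) (Γ' := fun p N => (Γ p.1.1 N ∧
    p.1.2 ∈ List.range (r p.1.1).order) ∧ p.2 ∈ List.range (r p.1.1).order) fun _ _ h => h.1
  have hv := hV1.mem
  have hV2 := list_vertices hr2
  have hr3 := hr2.fst (γ := ℕ) (Γ' := fun p N => ((Γ p.1.1.1 N ∧
    p.1.1.2 ∈ List.range (r p.1.1.1).order) ∧ p.1.2 ∈ List.range (r p.1.1.1).order) ∧
    p.2 ∈ List.range (r p.1.1.1).order) fun _ _ h => h.1
  have hX3 : PolyTime (fun (p : ((α × ℕ) × ℕ) × ℕ) N => ((Γ p.1.1.1 N ∧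
    p.1.1.2 ∈ List.range (r p.1.1.1).order) ∧ p.1.2 ∈ List.range (r p.1.1.1).order) ∧
    p.2 ∈ List.range (r p.1.1.1).order) fun p => X p.1.1.1 :=
    hX2.comp PolyTime.id'.fst fun _ _ h => h.1
  have hu3 := hu2.fst (γ := ℕ) (Γ' := fun p N => ((Γ p.1.1.1 N ∧
    p.1.1.2 ∈ List.range (r p.1.1.1).order) ∧ p.1.2 ∈ List.range (r p.1.1.1).order) ∧
    p.2 ∈ List.range (r p.1.1.1).order) fun _ _ h => h.1
  have hv3 := hv.fst (γ := ℕ) (Γ' := fun p N => ((Γ p.1.1.1 N ∧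
    p.1.1.2 ∈ List.range (r p.1.1.1).order) ∧ p.1.2 ∈ List.range (r p.1.1.1).order) ∧
    p.2 ∈ List.range (r p.1.1.1).order) fun _ _ h => h.1
  have hw := hV2.mem
  have hXw := hX3.getD .false hw.poly hw.bdd
  have hcan := ((hX2.getD .false hu2.poly hu2.bdd).and (hX2.getD .false hv.poly hv.bdd).not).and
    ((poly_adj hr2 hu2 hv).and
      (hV2.any (f := fun a w => ((X a.1.1).getD w false && adj (r a.1.1) a.2 w) &&
        !decide (w = a.1.2)) ((hXw.and (poly_adj hr3 hv3 hw)).and (hw.eq hu3).not)).not)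
  have hslide := hV2.map (f := fun a w => decide (w = a.2) ||
    ((X a.1.1).getD w false && !decide (w = a.1.2))) ((hw.eq hv3).or (hXw.and (hw.eq hu3).not))
  have hF := hV1.filter (f := fun (a : α × ℕ) v => canSlide (r a.1) (X a.1) a.2 v) (by
    simpa only [canSlide] using hcan)
  refine hV.poly.flatMap (f := fun a u =>
    ((List.range (r a).order).filter fun v => canSlide (r a) (X a) u v).map
      fun v => slide (r a) (X a) u v) hV.length (hF.map (hslide.weaken fun p N h =>
        ⟨h.1, List.mem_of_mem_filter h.2⟩)) ?_
  simpa using hF.length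

theorem poly_visit {s : α → Search} {Y : α → List Bool} (hs : PolyTime Γ s) (hY : PolyTime Γ Y)
    (hlen : PolyBdd Γ fun a => (Y a).length) : PolyTime Γ fun a => visit (s a) (Y a) :=
  (Trie.poly_contains hs.fst hY hlen).ite' hs
    ((Trie.poly_insert hs.fst hY hlen).prod (hY.cons hs.snd))

theorem length_slides_le (r : Raw) (X : List Bool) : (slides r X).length ≤ r.order * r.order := by
  rw [slides, List.length_flatMap]
  refine (List.sum_le_card_nsmul _ r.order fun n hn => ?_).trans (by simp)
  obtain ⟨u, -, rfl⟩ := List.mem_map.1 hn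
  rw [List.length_map]
  exact (List.length_filter_le ..).trans (by simp)

theorem poly_explore {s : α → Search} (hr : RawCtx Γ r) (hs : PolyTime Γ s) :
    PolyTime Γ fun a => explore (r a) (s a) := by
  refine (poly_slides hr (hs.snd.headD .nil)).foldl' (f := fun _ s Y => visit s Y)
    (hs.fst.prod hs.snd.tail) ((hr.order.mul hr.order).mono fun a _ _ => length_slides_le _ _)
    (poly_visit PolyTime.id'.snd.fst PolyTime.id'.snd.snd ?_)
  exact (hr.order.comp (i := fun p : α × Search × List Bool => p.1) fun _ _ h => h.1).mono
    fun p N h => (length_of_mem_slides h.2).le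

end Time
end Raw

/-! ## Correctness and running time of the search -/

namespace TSInstance
open Finset Sliding Relation

variable (I : TSInstance)

/-- The characteristic vector of a configuration. -/
noncomputable def vec {n : ℕ} (X : Finset (Fin n)) : List Bool := List.ofFn fun i => truth (i ∈ X)

theorem length_vec {n : ℕ} (X : Finset (Fin n)) : (vec X).length = n := by simp [vec]

theorem vec_injective {n : ℕ} {X Y : Finset (Fin n)} (h : vec X = vec Y) : X = Y := by
  ext i
  have := congrFun (List.ofFn_injective h) i
  rw [← truth_eq_true (P := i ∈ X), this, truth_eq_true]

theorem getD_vec {n : ℕ} (X : Finset (Fin n)) (i : Fin n) :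
    (vec X).getD i false = true ↔ i ∈ X := by
  rw [vec, getD_ofFn, truth_eq_true]

variable {I}

theorem canSlide_vec {X : Finset (Fin I.n)} (hX : Ind I.G X) (u v : Fin I.n) :
    I.raw.canSlide (vec X) u v = true ↔ u ∈ X ∧ v ∉ X ∧ I.G.Adj u v ∧
      Ind I.G (insert v (X.erase u)) := by
  have h1 : ((List.range I.raw.order).any fun w => ((vec X).getD w false && I.raw.adj v w) &&
      !decide (w = u)) = false ↔ ∀ w ∈ X, I.G.Adj v w → w = u := by
    simp only [List.any_eq_false, List.mem_range, order_raw, Bool.and_eq_true, Bool.not_eq_true',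
      decide_eq_false_iff_not, not_and, not_not, and_imp]
    constructor
    · intro h w hw hvw
      exact Fin.ext (h w w.2 ((getD_vec X w).2 hw) ((I.adj_raw v w).2 hvw))
    · intro h w hlt hw hvw
      exact congrArg Fin.val
        (h ⟨w, hlt⟩ ((getD_vec X ⟨w, hlt⟩).1 hw) ((I.adj_raw v ⟨w, hlt⟩).1 hvw))
  simp only [Raw.canSlide, Bool.and_eq_true, Bool.not_eq_true', h1, getD_vec, adj_raw]
  rw [← Bool.not_eq_true, getD_vec]
  constructor
  · rintro ⟨⟨hu, hv⟩, huv, h⟩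
    refine ⟨hu, hv, huv, Ind.insert (fun a ha b hb => hX a (mem_of_mem_erase ha) b
      (mem_of_mem_erase hb)) ⟨fun h => hv (mem_of_mem_erase h), fun x hx hvx => ?_⟩⟩
    exact ne_of_mem_erase hx (h x (mem_of_mem_erase hx) hvx)
  · rintro ⟨hu, hv, huv, h⟩
    refine ⟨⟨hu, hv⟩, huv, fun w hw hvw => ?_⟩
    by_contra hwu
    exact h v (by simp) w (by simp [hw, hwu]) hvw

theorem slide_vec {X : Finset (Fin I.n)} (u v : Fin I.n) :
    I.raw.slide (vec X) u v = vec (insert v (X.erase u)) := by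
  rw [Raw.slide, order_raw, range_map_eq_ofFn, vec]
  congr 1
  funext w
  rw [Bool.eq_iff_iff]
  have hw := getD_vec X w
  simp only [vec] at hw
  simp only [Bool.or_eq_true, Bool.and_eq_true, Bool.not_eq_true', hw, truth_eq_true,
    mem_insert, mem_erase, decide_eq_true_eq, decide_eq_false_iff_not, Fin.ext_iff, ne_eq]
  tauto

theorem mem_slides {X : Finset (Fin I.n)} (hX : Ind I.G X) {Y : List Bool} :
    Y ∈ I.raw.slides (vec X) ↔ ∃ Z, Step I.G X Z ∧ Y = vec Z := by
  simp only [Raw.slides, List.mem_flatMap, List.mem_map, List.mem_filter, List.mem_range, order_raw]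
  constructor
  · rintro ⟨u, hu, v, ⟨hv, h⟩, rfl⟩
    lift u to Fin I.n using hu
    lift v to Fin I.n using hv
    obtain ⟨h1, h2, h3, h4⟩ := (canSlide_vec hX u v).1 h
    exact ⟨_, ⟨hX, h4, u, h1, v, h2, h3, rfl⟩, slide_vec u v⟩
  · rintro ⟨Z, ⟨-, hZ, u, hu, v, hv, huv, rfl⟩, rfl⟩
    exact ⟨u, u.2, v, ⟨v.2, (canSlide_vec hX u v).2 ⟨hu, hv, huv, hZ⟩⟩, slide_vec u v⟩

open scoped Classical in
/-- A bound on the number of rounds that a search can still take. -/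
noncomputable def potential (I : TSInstance) (s : Raw.Search) : ℕ :=
  ((powersetCard I.k univ).filter fun X : Finset (Fin I.n) =>
    ¬ Trie.contains s.1 (vec X) = true).card + s.2.length

/-- A configuration joins the list only when it leaves the set of unknown ones, so visits do not
raise the potential. That all visited configurations have size `k` ensures that they are counted in
it. -/
theorem visit_foldl {l : List (List Bool)} (hl : ∀ Y ∈ l, ∃ X : Finset (Fin I.n),
    X.card = I.k ∧ Y = vec X) (s : Raw.Search) :
    (∀ X : Finset (Fin I.n), Trie.contains (l.foldl Raw.visit s).1 (vec X) = true ↔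
      Trie.contains s.1 (vec X) = true ∨ vec X ∈ l) ∧
    (∀ Y ∈ (l.foldl Raw.visit s).2, Y ∈ s.2 ∨ Y ∈ l) ∧ s.2 ⊆ (l.foldl Raw.visit s).2 ∧
    (∀ X : Finset (Fin I.n), Trie.contains (l.foldl Raw.visit s).1 (vec X) = true →
      Trie.contains s.1 (vec X) = true ∨ vec X ∈ (l.foldl Raw.visit s).2) ∧
    I.potential (l.foldl Raw.visit s) ≤ I.potential s := by
  induction l generalizing s with
  | nil => exact ⟨by simp, fun Y h => .inl h, List.Subset.refl _, fun X h => .inl h, le_rfl⟩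
  | cons Y l ih =>
    obtain ⟨X, hXk, rfl⟩ := hl Y (by simp)
    have step : (∀ Z : Finset (Fin I.n), Trie.contains (Raw.visit s (vec X)).1 (vec Z) = true ↔
        Trie.contains s.1 (vec Z) = true ∨ Z = X) ∧
        (∀ Y ∈ (Raw.visit s (vec X)).2, Y ∈ s.2 ∨ Y = vec X) ∧
        s.2 ⊆ (Raw.visit s (vec X)).2 ∧
        (Trie.contains s.1 (vec X) = true ∨ vec X ∈ (Raw.visit s (vec X)).2) ∧
        I.potential (Raw.visit s (vec X)) ≤ I.potential s := by
      by_cases h : Trie.contains s.1 (vec X) = true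
      · have e : Raw.visit s (vec X) = s := by simp [Raw.visit, h]
        rw [e]
        refine ⟨fun Z => ⟨.inl, ?_⟩, fun Y hY => .inl hY, List.Subset.refl _, .inl h, le_rfl⟩
        rintro (h' | rfl)
        · exact h'
        · exact h
      · have e : Raw.visit s (vec X) = (Trie.insert s.1 (vec X), vec X :: s.2) := by
          simp [Raw.visit, h]
        have hc : ∀ Z : Finset (Fin I.n), Trie.contains (Trie.insert s.1 (vec X)) (vec Z) = true ↔
            Trie.contains s.1 (vec Z) = true ∨ Z = X := by
          intro Z
          rw [Trie.contains_insert _ _ _ (by simp [length_vec]), or_comm]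
          exact or_congr_right ⟨vec_injective, fun h => h ▸ rfl⟩
        rw [e]
        refine ⟨hc, fun Y hY => ?_, List.subset_cons_self _ _, .inr (by simp), ?_⟩
        · rcases List.mem_cons.1 hY with h | h
          · exact .inr h
          · exact .inl h
        · classical
          unfold potential
          have hlt : ((powersetCard I.k univ).filter fun Z : Finset (Fin I.n) =>
              ¬ Trie.contains (Trie.insert s.1 (vec X)) (vec Z) = true).card <
              ((powersetCard I.k univ).filter fun Z : Finset (Fin I.n) =>
              ¬ Trie.contains s.1 (vec Z) = true).card := by
            refine card_lt_card ((ssubset_iff_of_subset fun Z hZ => ?_).2 ⟨X, ?_, ?_⟩)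
            · rw [mem_filter, hc] at hZ
              exact mem_filter.2 ⟨hZ.1, fun h' => hZ.2 (.inl h')⟩
            · exact mem_filter.2 ⟨mem_powersetCard.2 ⟨subset_univ _, hXk⟩, h⟩
            · rw [mem_filter, hc]
              exact fun h' => h'.2 (.inr rfl)
          simp only [List.length_cons]
          convert Nat.add_le_add_right (Nat.succ_le_of_lt hlt) s.2.length using 1
          omega
    obtain ⟨a1, a2, a3, a4, a5⟩ := step
    obtain ⟨b1, b2, b3, b4, b5⟩ := ih (fun Y hY => hl Y (by simp [hY])) (Raw.visit s (vec X))
    simp only [List.foldl_cons]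
    refine ⟨fun Z => ?_, fun Y hY => ?_, List.Subset.trans a3 b3, fun Z hZ => ?_, b5.trans a5⟩
    · rw [b1, a1, List.mem_cons, or_assoc]
      exact or_congr_right (or_congr_left ⟨fun h => h ▸ rfl, vec_injective⟩)
    · rcases b2 Y hY with h | h
      · rcases a2 Y h with h | rfl
        · exact .inl h
        · exact .inr (by simp)
      · exact .inr (by simp [h])
    · rcases b4 Z hZ with h | h
      · rcases (a1 Z).1 h with h | rfl
        · exact .inl h
        · rcases a4 with h | h
          · exact .inl h
          · exact .inr (b3 h)
      · exact .inr h

/-- What holds at every time of the search. -/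
structure SearchInv (I : TSInstance) (s : Raw.Search) : Prop where
  sound : ∀ X : Finset (Fin I.n), Trie.contains s.1 (vec X) = true → Reach I.G I.S.1 X
  start : Trie.contains s.1 (vec I.S.1) = true
  todo : ∀ Y ∈ s.2, ∃ X : Finset (Fin I.n), Y = vec X ∧ Trie.contains s.1 (vec X) = true
  closed : ∀ X : Finset (Fin I.n), Trie.contains s.1 (vec X) = true → vec X ∈ s.2 ∨
    ∀ Z, Step I.G X Z → Trie.contains s.1 (vec Z) = true

theorem searchInv_start : SearchInv I I.raw.start := by
  have e : I.raw.start = (Trie.insert .nil (vec I.S.1), [vec I.S.1]) := by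
    have : I.raw.2.2.1 = vec I.S.1 := rfl
    simp [Raw.start, Raw.visit, Trie.contains_nil, this]
  have hc : ∀ X : Finset (Fin I.n),
      Trie.contains (Trie.insert .nil (vec I.S.1)) (vec X) = true ↔ X = I.S.1 := by
    intro X
    rw [Trie.contains_insert _ _ _ (by simp [length_vec]), Trie.contains_nil]
    simp only [Bool.false_eq_true, or_false]
    exact ⟨vec_injective, fun h => h ▸ rfl⟩
  rw [e]
  refine ⟨fun X hX => ?_, (hc _).2 rfl, fun Y hY => ⟨I.S.1, by simpa using hY, (hc _).2 rfl⟩,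
    fun X hX => .inl ?_⟩
  · rw [(hc X).1 hX]; exact .refl
  · simp [(hc X).1 hX]

theorem reach_ind_card {X : Finset (Fin I.n)} (h : Reach I.G I.S.1 X) :
    Ind I.G X ∧ X.card = I.k := by
  have hS := isNIndepSet_iff.1 I.S.2
  refine ⟨?_, h.card_eq.trans hS.2⟩
  cases h with
  | refl => exact hS.1
  | tail _ h => exact h.2.1

theorem searchInv_explore {s : Raw.Search} (hs : SearchInv I s) (hne : s.2 ≠ []) :
    SearchInv I (I.raw.explore s) ∧ I.potential (I.raw.explore s) < I.potential s := by
  obtain ⟨seen, todo⟩ := s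
  obtain ⟨Y, todo, rfl⟩ := List.exists_cons_of_ne_nil hne
  obtain ⟨X, rfl, hX⟩ := hs.todo Y (by simp)
  have hr := hs.sound X hX
  have hind := (reach_ind_card hr).1
  have e : I.raw.explore (seen, vec X :: todo) =
      (I.raw.slides (vec X)).foldl Raw.visit (seen, todo) := rfl
  have hl : ∀ Y ∈ I.raw.slides (vec X), ∃ Z : Finset (Fin I.n), Z.card = I.k ∧ Y = vec Z := by
    intro Y hY
    obtain ⟨Z, hZ, rfl⟩ := (mem_slides hind).1 hY
    exact ⟨Z, hZ.card_eq.trans (reach_ind_card hr).2, rfl⟩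
  obtain ⟨b1, b2, b3, b4, b5⟩ := visit_foldl hl (seen, todo)
  rw [e]
  refine ⟨⟨fun Z hZ => ?_, (b1 _).2 (.inl hs.start), fun Y hY => ?_, fun Z hZ => ?_⟩, ?_⟩
  · rcases (b1 Z).1 hZ with h | h
    · exact hs.sound Z h
    · obtain ⟨Z', hZ', h⟩ := (mem_slides hind).1 h
      rw [vec_injective h]
      exact hr.tail hZ'
  · rcases b2 Y hY with h | h
    · obtain ⟨Z, rfl, hZ⟩ := hs.todo Y (by simp [show Y ∈ todo from h])
      exact ⟨Z, rfl, (b1 Z).2 (.inl hZ)⟩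
    · obtain ⟨Z, hZ, rfl⟩ := (mem_slides hind).1 h
      exact ⟨Z, rfl, (b1 Z).2 (.inr h)⟩
  · rcases b4 Z hZ with h | h
    · rcases hs.closed Z h with h' | h'
      · rcases List.mem_cons.1 h' with h'' | h''
        · refine .inr fun Z' hZ' => (b1 Z').2 (.inr ?_)
          rw [vec_injective h''] at hZ'
          exact (mem_slides hind).2 ⟨Z', hZ', rfl⟩
        · exact .inl (b3 h'')
      · exact .inr fun Z' hZ' => (b1 Z').2 (.inl (h' Z' hZ'))
    · exact .inl h
  -- The explored configuration has left the list, which lowers the potential by one before any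
  -- visit.
  · refine b5.trans_lt ?_
    simp [potential]

/-- Once nothing is left to explore, the known configurations are closed under slides and include
`S`, so they are all the reachable ones. -/
theorem contains_iff_isYes {s : Raw.Search} (hs : SearchInv I s) (h : s.2 = []) :
    Trie.contains s.1 (vec I.T.1) = true ↔ I.IsYes := by
  rw [isYes_iff]
  refine ⟨hs.sound _, fun hr => ?_⟩
  have key : ∀ X, Reach I.G I.S.1 X → Trie.contains s.1 (vec X) = true := by
    intro X hX
    induction hX with
    | refl => exact hs.start
    | tail _ hstep ih =>
      rcases hs.closed _ ih with h' | h'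
      · simp [h] at h'
      · exact h' _ hstep
  exact key _ hr

theorem potential_start_le : I.potential I.raw.start ≤ I.n.choose I.k := by
  classical
  have h := (visit_foldl (I := I) (l := [vec I.S.1])
    (fun Y hY => ⟨I.S.1, I.S.2.card_eq, by simpa using hY⟩) (.nil, [])).2.2.2.2
  refine (show I.potential I.raw.start ≤ _ from h).trans ?_
  unfold potential
  simp only [List.length_nil, add_zero]
  refine (card_le_card (filter_subset _ _)).trans ?_
  rw [card_powersetCard, card_univ, Fintype.card_fin]

/-- The search ends after a number of rounds that is at most its potential. -/
theorem exists_rounds {s : Raw.Search} (hs : SearchInv I s) : ∃ l ≤ I.potential s,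
    (∀ i < l, (I.raw.explore^[i] s).2 ≠ []) ∧ (I.raw.explore^[l] s).2 = [] ∧
      SearchInv I (I.raw.explore^[l] s) := by
  induction hn : I.potential s using Nat.strong_induction_on generalizing s with
  | _ n ih =>
    by_cases h : s.2 = []
    · exact ⟨0, by omega, by simp, h, hs⟩
    · obtain ⟨h1, h2⟩ := searchInv_explore hs h
      obtain ⟨l, hl, h3, h4, h5⟩ := ih _ (hn ▸ h2) h1 rfl
      refine ⟨l + 1, by omega, fun i hi => ?_, h4, h5⟩
      cases i with
      | zero => exact h
      | succ i => exact h3 i (by omega)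

/-- The search runs in time polynomial in the number of vertices times the number of
configurations. -/
theorem exists_search : ∃ (search : TreeProg) (q : Polynomial ℕ), ∀ (J : TSInstance) (N : ℕ),
    J.n ≤ N → ∃ t, search.Eval J.encode (TreeEnc.prop J.IsYes) t ∧
      t ≤ (J.n.choose J.k + 1) * q.eval N := by
  let Γ : Raw → ℕ → Prop := fun r N =>
    r.1 ≤ N ∧ r.order ≤ N ∧ r.2.2.1.length ≤ N ∧ r.2.2.2.length ≤ N
  -- Nothing is required of the search state: the trie and the list may be exponentially large, but
  -- a round only descends along strings whose lengths the raw instance bounds.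
  let Γ' : Raw × Raw.Search → ℕ → Prop := fun p N => Γ p.1 N
  have hr : RawCtx Γ' fun p => p.1 :=
    ⟨PolyTime.id'.fst, .of_le_param fun _ _ h => h.2.1, .of_le_param fun _ _ h => h.1⟩
  have hstart : PolyTime Γ fun r : Raw => (r, r.start) :=
    PolyTime.id'.prod (Raw.poly_visit (PolyTime.leaf.prod .nil) PolyTime.id'.snd.snd.fst
      (.of_le_param fun _ _ h => h.2.2.1))
  have hcond : PolyTime Γ' fun p => !p.2.2.isEmpty := PolyTime.id'.snd.snd.isEmpty.not
  have hbody : PolyTime Γ' fun p => (p.1, Raw.explore p.1 p.2) :=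
    hr.poly.prod (Raw.poly_explore hr PolyTime.id'.snd)
  have hend : PolyTime Γ' fun p => Trie.contains p.2.1 p.1.2.2.2 :=
    Trie.poly_contains PolyTime.id'.snd.fst PolyTime.id'.fst.snd.snd.snd
      (.of_le_param fun _ _ h => h.2.2.2)
  obtain ⟨p1, q1, h1⟩ := hstart
  obtain ⟨p2, q2, h2⟩ := hcond
  obtain ⟨p3, q3, h3⟩ := hbody
  obtain ⟨p4, q4, h4⟩ := hend
  refine ⟨.seq p1 (.seq (.loop p2 p3) p4), q1 + q4 + 2 * (q2 + q3) + 5, fun J N hN => ?_⟩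
  have hJ : Γ J.raw N := ⟨J.k_le_n.trans hN, by simpa using hN,
    by simpa [raw] using hN, by simpa [raw] using hN⟩
  obtain ⟨l, hl, hne, hnil, hinv⟩ := exists_rounds (searchInv_start (I := J))
  obtain ⟨t1, e1, b1⟩ := h1 J.raw N hJ
  let σ : ℕ → Raw × Raw.Search := fun i => (J.raw, J.raw.explore^[i] J.raw.start)
  obtain ⟨t2, e2, b2⟩ := TreeProg.Eval.loop_iterate (c := p2) (f := p3)
    (σ := fun i => TEnc.enc (σ i)) (b := fun i => TEnc.enc (!(σ i).2.2.isEmpty)) (l := l)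
    (B := q2.eval N + q3.eval N)
    (fun i hi => by
      obtain ⟨t, e, b⟩ := h2 (σ i) N hJ
      refine ⟨?_, t, e, by omega⟩
      rw [Ne, enc_bool_eq_nil]
      simpa [List.isEmpty_iff] using hne i hi)
    (by
      obtain ⟨t, e, b⟩ := h2 (σ l) N hJ
      refine ⟨t, ?_, by omega⟩
      have : (!(σ l).2.2.isEmpty) = false := by simpa [List.isEmpty_iff] using hnil
      change p2.Eval _ (TEnc.enc (!(σ l).2.2.isEmpty)) t at e
      rwa [this, enc_false] at e)
    (fun i hi => by
      obtain ⟨t, e, b⟩ := h3 (σ i) N hJ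
      refine ⟨t, ?_, by omega⟩
      have : ((σ i).1, Raw.explore (σ i).1 (σ i).2) = σ (i + 1) := by
        simp only [σ, Function.iterate_succ_apply']
      change p3.Eval _ (TEnc.enc ((σ i).1, Raw.explore (σ i).1 (σ i).2)) t at e
      rwa [this] at e)
  obtain ⟨t4, e4, b4⟩ := h4 (σ l) N hJ
  have hres : TEnc.enc (Trie.contains (σ l).2.1 (σ l).1.2.2.2) = TreeEnc.prop J.IsYes := by
    have h := contains_iff_isYes hinv hnil
    have : Trie.contains (σ l).2.1 (σ l).1.2.2.2 = truth J.IsYes :=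
      (truth_eq_iff h.symm).symm
    rw [this]
    rfl
  rw [enc_raw] at e1
  rw [hres] at e4
  refine ⟨_, .seq e1 (.seq e2 e4), ?_⟩
  have hl' : l ≤ J.n.choose J.k := hl.trans potential_start_le
  have h5 : (l + 1) * (2 * (q2.eval N + q3.eval N) + 1) ≤
      (J.n.choose J.k + 1) * (2 * (q2.eval N + q3.eval N) + 1) := Nat.mul_le_mul_right _ (by omega)
  have h6 : 1 * (q1.eval N + q4.eval N + 4) ≤ (J.n.choose J.k + 1) * (q1.eval N + q4.eval N + 4) :=
    Nat.mul_le_mul_right _ (by omega)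
  have h7 : (q1 + q4 + 2 * (q2 + q3) + 5).eval N =
      (q1.eval N + q4.eval N + 4) + (2 * (q2.eval N + q3.eval N) + 1) := by
    simp; omega
  rw [h7, Nat.mul_add]
  omega

/-- While the exponent is at most `c`, the factor `c ^ c` suffices; from then on, each further
factor `c` is outweighed by the new factor of the factorial. -/
theorem pow_le_mul_factorial (c k : ℕ) (hc : 1 ≤ c) : c ^ k ≤ c ^ c * k.factorial := by
  induction k with
  | zero => simpa using Nat.one_le_pow c c hc
  | succ k ih =>
    rcases le_total c (k + 1) with h | h
    · calc c ^ (k + 1) = c ^ k * c := pow_succ _ _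
        _ ≤ c ^ c * k.factorial * (k + 1) := Nat.mul_le_mul ih h
        _ = c ^ c * (k + 1).factorial := by rw [Nat.factorial_succ]; ring
    · calc c ^ (k + 1) ≤ c ^ c := Nat.pow_le_pow_right hc h
        _ = c ^ c * 1 := (mul_one _).symm
        _ ≤ _ := Nat.mul_le_mul_left _ (Nat.factorial_pos _)

/-- The target running time has no room for `c ^ k`. The denominator `k!` of the binomial
coefficient reduces this factor to a constant. -/
theorem choose_le {n k c a : ℕ} (hc : 1 ≤ c) (h : n ≤ c * a) : n.choose k ≤ c ^ c * a ^ k := by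
  refine Nat.le_of_mul_le_mul_left ?_ k.factorial_pos
  calc k.factorial * n.choose k = n.descFactorial k := (Nat.descFactorial_eq_factorial_mul_choose n k).symm
    _ ≤ n ^ k := Nat.descFactorial_le_pow n k
    _ ≤ (c * a) ^ k := Nat.pow_le_pow_left h k
    _ = c ^ k * a ^ k := mul_pow ..
    _ ≤ c ^ c * k.factorial * a ^ k := Nat.mul_le_mul_right _ (pow_le_mul_factorial c k hc)
    _ = _ := by ring

end TSInstance

/-- Token Sliding parameterized by `k` on bipartite graphs of maximum degree `Δ` (`Δ ≥ 1`):
a kernel with `O(k ^ 2 * Δ ^ 5)` vertices, and an algorithm that runs in time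
`k ^ (2 * k) * Δ ^ (5 * k)` times a polynomial in the number of vertices. -/
theorem mainTheorem3 :
    (∃ (kernelization : TreeProg) (p : Polynomial ℕ) (C : ℕ),
      ∀ (I : TSInstance) (Δ : ℕ), I.G.IsBipartite → 1 ≤ Δ → I.maxDegree ≤ Δ →
        ∃ (J : TSInstance) (t : ℕ),
          kernelization.Eval I.encode J.encode t ∧ t ≤ p.eval I.n ∧
          (J.IsYes ↔ I.IsYes) ∧
          J.G.IsBipartite ∧ J.maxDegree ≤ Δ ∧ J.k ≤ I.k ∧
          J.n ≤ C * (I.k ^ 2 * Δ ^ 5)) ∧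
    (∃ (algorithm : TreeProg) (p : Polynomial ℕ),
      ∀ (I : TSInstance) (Δ : ℕ), I.G.IsBipartite → 1 ≤ Δ → I.maxDegree ≤ Δ →
        ∃ t : ℕ,
          algorithm.Eval I.encode (TreeEnc.prop I.IsYes) t ∧
          t ≤ I.k ^ (2 * I.k) * Δ ^ (5 * I.k) * p.eval I.n) := by
  obtain ⟨kernelization, p, hp⟩ := TSInstance.exists_kernelization
  refine ⟨⟨kernelization, p, 576, fun I Δ hI hΔ hdeg => ?_⟩, ?_⟩
  · obtain ⟨J, t, ht, htp, h, -, hn⟩ := hp I hI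
    exact ⟨J, t, ht, htp, h.isYes, h.bipartite, h.maxDegree Δ hdeg, h.k_eq.le, hn Δ hΔ hdeg⟩
  · obtain ⟨search, q, hq⟩ := TSInstance.exists_search
    refine ⟨.seq kernelization search, p + (Polynomial.C (576 ^ 576) + 1) * q + 1,
      fun I Δ hI hΔ hdeg => ?_⟩
    obtain ⟨J, t, ht, htp, h, hJn, hn⟩ := hp I hI
    obtain ⟨t', ht', htq⟩ := hq J I.n hJn
    rw [show J.IsYes = I.IsYes from propext h.isYes] at ht'
    refine ⟨_, .seq ht ht', ?_⟩
    have hA : I.k ^ (2 * I.k) * Δ ^ (5 * I.k) = (I.k ^ 2 * Δ ^ 5) ^ I.k := by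
      rw [mul_pow, ← pow_mul, ← pow_mul]
    -- The constant `576 ^ 576` arising here goes into the polynomial factor.
    have hchoose := TSInstance.choose_le (k := I.k) (c := 576) (by omega) (hn Δ hΔ hdeg)
    rw [hA]
    rw [h.k_eq] at htq
    have hpos : 1 ≤ (I.k ^ 2 * Δ ^ 5) ^ I.k :=
      Nat.one_le_pow _ _ (Nat.mul_pos (Nat.pow_pos I.one_le_k) (Nat.pow_pos hΔ))
    generalize (I.k ^ 2 * Δ ^ 5) ^ I.k = A at *
    have e : (p + (Polynomial.C (576 ^ 576) + 1) * q + 1).eval I.n =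
        p.eval I.n + (576 ^ 576 + 1) * q.eval I.n + 1 := by
      simp only [Polynomial.eval_add, Polynomial.eval_mul, Polynomial.eval_C, Polynomial.eval_one]
    rw [e]
    generalize (576 : ℕ) ^ 576 = M at *
    calc t + t' + 1 ≤ p.eval I.n + (M * A + 1) * q.eval I.n + 1 := by
          have := Nat.mul_le_mul_right (q.eval I.n) (Nat.add_le_add_right hchoose 1)
          omega
      _ ≤ A * p.eval I.n + (A * (M + 1)) * q.eval I.n + A * 1 := by
          refine add_le_add (add_le_add (Nat.le_mul_of_pos_left _ hpos)
            (Nat.mul_le_mul_right _ ?_)) (by omega)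
          calc M * A + 1 ≤ M * A + A := by omega
            _ = A * (M + 1) := by ring
      _ = A * (p.eval I.n + (M + 1) * q.eval I.n + 1) := by ring
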